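/- Let $\mathbb F$ be a field (of arbitrary characteristic), let $e\ge 2$, $I=\mathbb Z/e\mathbb Z$ and $\kappa=(0,0)$, and let $k\ge j\ge 1$ and $n=ke+je$. Write $a_{i,i'}=2\delta_{i,i'}-\delta_{i,i'+1}-\delta_{i,i'-1}$ for $i,i'\in I$. Let $\mathscr R_n^\Lambda$, $\Lambda=2\Lambda_0$, be the level two cyclotomic KLR algebra over $\mathbb F$: the unital associative algebra with generators $e(\mathbf i)$ ($\mathbf i\in I^n$), $y_1,\dots,y_n$, $\psi_1,\dots,\psi_{n-1}$ and relations $e(\mathbf i)e(\mathbf i')=\delta_{\mathbf i,\mathbf i'}e(\mathbf i)$; $\sum_{\mathbf i}e(\mathbf i)=1$; $y_re(\mathbf i)=e(\mathbf i)y_r$; $\psi_re(\mathbf i)=e(s_r\mathbf i)\psi_r$; $y_ry_s=y_sy_r$; $\psi_ry_s=y_s\psi_r$ if $s\ne r,r+1$; $\psi_r\psi_s=\psi_s\psi_r$ if $|r-s|>1$; $y_r\psi_re(\mathbf i)=(\psi_ry_{r+1}-\delta_{i_r,i_{r+1}})e(\mathbf i)$; $y_{r+1}\psi_re(\mathbf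 i)=(\psi_ry_r+\delta_{i_r,i_{r+1}})e(\mathbf i)$; $\psi_r^2e(\mathbf i)$ equal to $0$ if $i_r=i_{r+1}$, to $e(\mathbf i)$ if $i_{r+1}\ne i_r,i_r\pm1$, and for $e>2$ to $(y_{r+1}-y_r)e(\mathbf i)$ if $i_r=i_{r+1}+1$ and to $(y_r-y_{r+1})e(\mathbf i)$ if $i_r=i_{r+1}-1$, while for $e=2$ it is $(y_{r+1}-y_r)(y_r-y_{r+1})e(\mathbf i)$ if $i_r\neq i_{r+1}$; $(\psi_r\psi_{r+1}\psi_r-\psi_{r+1}\psi_r\psi_{r+1})e(\mathbf i)$ equal, for $e>2$, to $\pm e(\mathbf i)$ if $i_{r+2}=i_r=i_{r+1}\pm1$, for $e=2$, to $(y_r-2y_{r+1}+y_{r+2})e(\mathbf i)$ if $i_{r+2}=i_r\ne i_{r+1}$, and to $0$ otherwise; and $y_1^{2\delta_{i_1,0}}e(\mathbf i)=0$. It is $\mathbb Z$-graded by $\deg e(\mathbf i)=0$, $\deg y_r=2$, $\deg \psi_re(\mathbf i)=-a_{i_r,i_{r+1}}$. For integers $a,b\ge 0$ with $ae+be=n$,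 the (column) Specht module $S^{((ae),(be))}$ is the cyclic graded left $\mathscr R_n^\Lambda$-module with generator $z=z_{((ae),(be))}$ and relations $e(\mathbf i)z=z$, where $\mathbf i$ is the residue sequence of the column-initial tableau $\mathtt t$ of shape $((ae),(be))$ (the entries $1,\dots,be$ in order in the second component, then $be+1,\dots,n$ in order in the first; the node in column $c$ of either component has residue $c-1$ modulo $e$); $y_rz=0$ for $1\le r\le n$; and $\psi_rz=0$ for $1\le r\le n-1$ with $r\ne be$. The degree of $z$ is the codegree of $\mathtt t$: the sum over $r=1,\dots,n$ of the number of addable nodes minus the number of removable nodes, of the diagram formed by the entries $\leq r$ of $\mathtt t$, that lie above the node containing $r$ and have the same residue as it. For $1\le r\le j+k-1$ let $$\Psi_r=(\psi_{re}\psi_{re-1}\cdots\psi_{(r-1)e+1})(\psi_{re+1}\psi_{re}\cdots\psi_{(r-1)e+2})\cdots(\psi_{(r+1)e-1}\psi_{(r+1)e-2}\cdots\psi_{re})$$ be the $r$th brick transposition. Then there exists an $\mathscr R_n^\Lambda$-module homomorphism $$\alpha_{k,j}\colon S^{((ke+e),(je-e))}\longrightarrow S^{((ke),(je))},$$ homogeneous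 of degree $1$, such that $$\alpha_{k,j}\bigl(z_{((ke+e),(je-e))}\bigr)=\sum_{i=0}^{k}(k+1-i)\,\Psi_{j+i-1}\Psi_{j+i-2}\cdots\Psi_{j}\,z_{((ke),(je))},$$ where the product $\Psi_{j+i-1}\cdots\Psi_j$ is $1$ for $i=0$. -/

import Mathlib

/-! ## Bipartitions, tableaux, residues and codegree -/

/-- A bipartition is a pair of partitions, given by their Young diagrams; component `0` is the
first one and component `1` the second one. -/
abbrev Bipartition : Type := Fin 2 → YoungDiagram

/-- A node: row, column (both counted from `0`, as in `YoungDiagram`) and component. -/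
structure BiNode where
  row : ℕ
  col : ℕ
  comp : Fin 2

namespace Bipartition

/-- The set of nodes of a bipartition. -/
def nodes (lam : Bipartition) : Set BiNode :=
  {A | (A.row, A.col) ∈ lam A.comp}

/-- The one-row Young diagram with `a` boxes. -/
def oneRow (a : ℕ) : YoungDiagram where
  cells := {0} ×ˢ Finset.range a
  isLowerSet := by
    rintro ⟨i, c⟩ ⟨i', c'⟩ hle hmem
    have h1 : i' ≤ i := hle.1
    have h2 : c' ≤ c := hle.2
    simp only [Finset.coe_product, Finset.coe_singleton, Finset.coe_range, Set.mem_prod,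
      Set.mem_singleton_iff, Set.mem_Iio] at hmem ⊢
    omega

/-- The bipartition `((a), (b))`. -/
def twoRow (a b : ℕ) : Bipartition := ![oneRow a, oneRow b]

end Bipartition

namespace BiNode

/-- `A.Above B`: the node `A` is above the node `B`. -/
def Above (A B : BiNode) : Prop :=
  A.comp < B.comp ∨ (A.comp = B.comp ∧ A.row < B.row)

/-- The residue `κ_m + column - row` of a node in component `m`. -/
def res {e : ℕ} (κ : Fin 2 → ZMod e) (A : BiNode) : ZMod e :=
  κ A.comp + (A.col : ZMod e) - (A.row : ZMod e)

/-- `A` is an addable node of the set of nodes `S` (the diagram of a bipartition). -/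
def Addable (S : Set BiNode) (A : BiNode) : Prop :=
  A ∉ S ∧ ∃ lam : Bipartition, lam.nodes = insert A S

/-- `A` is a removable node of the set of nodes `S` (the diagram of a bipartition). -/
def Removable (S : Set BiNode) (A : BiNode) : Prop :=
  A ∈ S ∧ ∃ lam : Bipartition, lam.nodes = S \ {A}

/-- `d^A(S)`: the number of addable nodes of `S` above `A` of the same residue as `A`, minus the
number of removable nodes of `S` above `A` of the same residue as `A`. -/
noncomputable def dAbove {e : ℕ} (κ : Fin 2 → ZMod e) (S : Set BiNode) (A : BiNode) : ℤ :=
  (Set.ncard {B | Addable S B ∧ B.res κ = A.res κ ∧ B.Above A} : ℤ)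
    - (Set.ncard {B | Removable S B ∧ B.res κ = A.res κ ∧ B.Above A} : ℤ)

end BiNode

/-- A tableau of shape `lam` with `n` entries; `node r` is the node that contains the entry
`r + 1`. -/
structure BiTableau (n : ℕ) (lam : Bipartition) where
  node : Fin n → BiNode
  injective : Function.Injective node
  range_eq : Set.range node = lam.nodes

namespace BiTableau

/-- The residue sequence of a tableau. -/
def resSeq {n e : ℕ} {lam : Bipartition} (κ : Fin 2 → ZMod e) (t : BiTableau n lam) :
    Fin n → ZMod e :=
  fun r => (t.node r).res κ

/-- The codegree of a (standard) tableau: the recursion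
`codeg t = d^A(lam) + codeg (t with its largest entry, in the node A, removed)`, unrolled. -/
noncomputable def codeg {n e : ℕ} {lam : Bipartition} (κ : Fin 2 → ZMod e)
    (t : BiTableau n lam) : ℤ :=
  ∑ r : Fin n, BiNode.dAbove κ (t.node '' Set.Iic r) (t.node r)

/-- The column-initial tableau of `((a), (b))`: the entries `1, …, b` fill the second component
from left to right, then `b + 1, …, b + a` fill the first component from left to right. -/
def colInitial (n a b : ℕ) (h : a + b = n) : BiTableau n (Bipartition.twoRow a b) where
  node r := if r.1 < b then ⟨0, r.1, 1⟩ else ⟨0, r.1 - b, 0⟩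
  injective := by
    intro r s hrs
    apply Fin.ext
    by_cases h1 : r.1 < b <;> by_cases h2 : s.1 < b <;> simp [h1, h2] at hrs <;> omega
  range_eq := by
    ext ⟨i, c, m⟩
    constructor
    · rintro ⟨r, hr⟩
      have hr2 := r.2
      by_cases h1 : r.1 < b <;> simp only [h1, if_true, if_false, BiNode.mk.injEq] at hr <;>
        obtain ⟨rfl, rfl, rfl⟩ := hr <;>
        simp [Bipartition.nodes, Bipartition.twoRow, Bipartition.oneRow,
          ← YoungDiagram.mem_cells] <;> omega
    · intro hA
      fin_cases m <;>
        simp [Bipartition.nodes, Bipartition.twoRow, Bipartition.oneRow,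
          ← YoungDiagram.mem_cells] at hA <;> obtain ⟨hc, rfl⟩ := hA
      · exact ⟨⟨c + b, by omega⟩, by simp⟩
      · exact ⟨⟨c, by omega⟩, by simp [hc]⟩

end BiTableau

/-! ## Cyclotomic KLR algebras of type `A^{(1)}_{e-1}` and level two -/

/-- Generators: `idem i` is `e(i)`, `y r` is `y_{r+1}`, and `psi r` is `ψ_{r+1}`
(positions in residue sequences are counted from `0`). -/
inductive KLRGen (e n : ℕ) : Type
  | idem (i : Fin n → ZMod e) : KLRGen e n
  | y (r : Fin n) : KLRGen e n
  | psi (r : ℕ) (h : r + 1 < n) : KLRGen e n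

namespace KLR

section Free

variable (F : Type*) [Field F] {e n : ℕ}

/-- The generator `e(i)` in the free algebra. -/
abbrev fE (i : Fin n → ZMod e) : FreeAlgebra F (KLRGen e n) := FreeAlgebra.ι F (.idem i)

/-- The generator `y_{r+1}` in the free algebra. -/
abbrev fY (r : ℕ) (h : r < n) : FreeAlgebra F (KLRGen e n) := FreeAlgebra.ι F (.y ⟨r, h⟩)

/-- The generator `ψ_{r+1}` in the free algebra. -/
abbrev fP (r : ℕ) (h : r + 1 < n) : FreeAlgebra F (KLRGen e n) := FreeAlgebra.ι F (.psi r h)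

end Free

/-- The residue sequence with the entries in positions `r` and `r + 1` swapped. -/
def swapSeq {e n : ℕ} (r : ℕ) (h : r + 1 < n) (i : Fin n → ZMod e) : Fin n → ZMod e :=
  i ∘ Equiv.swap ⟨r, by omega⟩ ⟨r + 1, h⟩

/-- `(Λ_κ, α_a)` for `Λ_κ = Λ_{κ_1} + Λ_{κ_2}`. -/
def weightPairing {e : ℕ} (κ : Fin 2 → ZMod e) (a : ZMod e) : ℕ :=
  ∑ m : Fin 2, if κ m = a then 1 else 0

/-- The Cartan integer `a_{ab} = 2δ_{a,b} - δ_{a,b+1} - δ_{a,b-1}`. -/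
def cartan {e : ℕ} (a b : ZMod e) : ℤ :=
  2 * (if a = b then 1 else 0) - (if a = b + 1 then 1 else 0) - (if a = b - 1 then 1 else 0)

/-- The defining relations of the cyclotomic KLR algebra. -/
inductive Rel (F : Type*) [Field F] {e : ℕ} [NeZero e] (κ : Fin 2 → ZMod e) (n : ℕ) :
    FreeAlgebra F (KLRGen e n) → FreeAlgebra F (KLRGen e n) → Prop
  | idem_mul_self (i : Fin n → ZMod e) : Rel F κ n (fE F i * fE F i) (fE F i)
  | idem_mul_of_ne (i i' : Fin n → ZMod e) (hne : i ≠ i') : Rel F κ n (fE F i * fE F i') 0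
  | sum_idem : Rel F κ n (∑ i : Fin n → ZMod e, fE F i) 1
  | y_idem (r : ℕ) (h : r < n) (i : Fin n → ZMod e) :
      Rel F κ n (fY F r h * fE F i) (fE F i * fY F r h)
  | psi_idem (r : ℕ) (h : r + 1 < n) (i : Fin n → ZMod e) :
      Rel F κ n (fP F r h * fE F i) (fE F (swapSeq r h i) * fP F r h)
  | y_comm (r s : ℕ) (hr : r < n) (hs : s < n) :
      Rel F κ n (fY F r hr * fY F s hs) (fY F s hs * fY F r hr)
  | psi_y_comm (r s : ℕ) (hr : r + 1 < n) (hs : s < n) (h1 : s ≠ r) (h2 : s ≠ r + 1) :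
      Rel F κ n (fP F r hr * fY F s hs) (fY F s hs * fP F r hr)
  | psi_comm (r s : ℕ) (hr : r + 1 < n) (hs : s + 1 < n) (hrs : r + 1 < s ∨ s + 1 < r) :
      Rel F κ n (fP F r hr * fP F s hs) (fP F s hs * fP F r hr)
  | y_psi (r : ℕ) (h : r + 1 < n) (i : Fin n → ZMod e) :
      Rel F κ n (fY F r (by omega) * fP F r h * fE F i)
        ((fP F r h * fY F (r + 1) h
          - (if i ⟨r, by omega⟩ = i ⟨r + 1, h⟩ then 1 else 0)) * fE F i)
  | y_succ_psi (r : ℕ) (h : r + 1 < n) (i : Fin n → ZMod e) :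
      Rel F κ n (fY F (r + 1) h * fP F r h * fE F i)
        ((fP F r h * fY F r (by omega)
          + (if i ⟨r, by omega⟩ = i ⟨r + 1, h⟩ then 1 else 0)) * fE F i)
  | psi_sq_eq (r : ℕ) (h : r + 1 < n) (i : Fin n → ZMod e)
      (hi : i ⟨r, by omega⟩ = i ⟨r + 1, h⟩) :
      Rel F κ n (fP F r h * fP F r h * fE F i) 0
  | psi_sq_far (r : ℕ) (h : r + 1 < n) (i : Fin n → ZMod e)
      (h0 : i ⟨r + 1, h⟩ ≠ i ⟨r, by omega⟩)
      (h1 : i ⟨r + 1, h⟩ ≠ i ⟨r, by omega⟩ + 1)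
      (h2 : i ⟨r + 1, h⟩ ≠ i ⟨r, by omega⟩ - 1) :
      Rel F κ n (fP F r h * fP F r h * fE F i) (fE F i)
  | psi_sq_add (he : e ≠ 2) (r : ℕ) (h : r + 1 < n) (i : Fin n → ZMod e)
      (hi : i ⟨r, by omega⟩ = i ⟨r + 1, h⟩ + 1) :
      Rel F κ n (fP F r h * fP F r h * fE F i)
        ((fY F (r + 1) h - fY F r (by omega)) * fE F i)
  | psi_sq_sub (he : e ≠ 2) (r : ℕ) (h : r + 1 < n) (i : Fin n → ZMod e)
      (hi : i ⟨r, by omega⟩ = i ⟨r + 1, h⟩ - 1) :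
      Rel F κ n (fP F r h * fP F r h * fE F i)
        ((fY F r (by omega) - fY F (r + 1) h) * fE F i)
  | psi_sq_two (he : e = 2) (r : ℕ) (h : r + 1 < n) (i : Fin n → ZMod e)
      (hi : i ⟨r, by omega⟩ ≠ i ⟨r + 1, h⟩) :
      Rel F κ n (fP F r h * fP F r h * fE F i)
        ((fY F (r + 1) h - fY F r (by omega)) * (fY F r (by omega) - fY F (r + 1) h) * fE F i)
  | braid_add (he : e ≠ 2) (r : ℕ) (h : r + 2 < n) (i : Fin n → ZMod e)
      (h1 : i ⟨r + 2, h⟩ = i ⟨r, by omega⟩)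
      (h2 : i ⟨r, by omega⟩ = i ⟨r + 1, by omega⟩ + 1) :
      Rel F κ n (fP F r (by omega) * fP F (r + 1) h * fP F r (by omega) * fE F i)
        ((fP F (r + 1) h * fP F r (by omega) * fP F (r + 1) h + 1) * fE F i)
  | braid_sub (he : e ≠ 2) (r : ℕ) (h : r + 2 < n) (i : Fin n → ZMod e)
      (h1 : i ⟨r + 2, h⟩ = i ⟨r, by omega⟩)
      (h2 : i ⟨r, by omega⟩ = i ⟨r + 1, by omega⟩ - 1) :
      Rel F κ n (fP F r (by omega) * fP F (r + 1) h * fP F r (by omega) * fE F i)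
        ((fP F (r + 1) h * fP F r (by omega) * fP F (r + 1) h - 1) * fE F i)
  | braid_two (he : e = 2) (r : ℕ) (h : r + 2 < n) (i : Fin n → ZMod e)
      (h1 : i ⟨r + 2, h⟩ = i ⟨r, by omega⟩)
      (h2 : i ⟨r, by omega⟩ ≠ i ⟨r + 1, by omega⟩) :
      Rel F κ n (fP F r (by omega) * fP F (r + 1) h * fP F r (by omega) * fE F i)
        ((fP F (r + 1) h * fP F r (by omega) * fP F (r + 1) h
          + fY F r (by omega) - 2 * fY F (r + 1) (by omega) + fY F (r + 2) h) * fE F i)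
  | braid_far (r : ℕ) (h : r + 2 < n) (i : Fin n → ZMod e)
      (hi : i ⟨r + 2, h⟩ ≠ i ⟨r, by omega⟩ ∨
        (i ⟨r, by omega⟩ ≠ i ⟨r + 1, by omega⟩ + 1 ∧
          i ⟨r, by omega⟩ ≠ i ⟨r + 1, by omega⟩ - 1)) :
      Rel F κ n (fP F r (by omega) * fP F (r + 1) h * fP F r (by omega) * fE F i)
        (fP F (r + 1) h * fP F r (by omega) * fP F (r + 1) h * fE F i)
  | cyclotomic (h : 0 < n) (i : Fin n → ZMod e) :
      Rel F κ n (fY F 0 h ^ weightPairing κ (i ⟨0, h⟩) * fE F i) 0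

end KLR

/-- The cyclotomic KLR algebra `R_n^Λ` with `Λ = Λ_κ`. The idempotents `e(i)` run over all
`i ∈ I^n`, so this is the direct sum of the blocks `R_α^Λ` over all `α` of height `n`. -/
abbrev KLRAlgebra (F : Type*) [Field F] {e : ℕ} [NeZero e] (κ : Fin 2 → ZMod e) (n : ℕ) :
    Type _ :=
  RingQuot (KLR.Rel F κ n)

namespace KLR

variable (F : Type*) [Field F] {e : ℕ} [NeZero e] (κ : Fin 2 → ZMod e) (n : ℕ)

/-- The idempotent `e(i)`. -/
noncomputable def idem (i : Fin n → ZMod e) : KLRAlgebra F κ n :=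
  RingQuot.mkAlgHom F (Rel F κ n) (FreeAlgebra.ι F (.idem i))

/-- The element `y_r`, for `1 ≤ r ≤ n` (and `0` for other `r`). -/
noncomputable def y (r : ℕ) : KLRAlgebra F κ n :=
  if h : 1 ≤ r ∧ r ≤ n then
    RingQuot.mkAlgHom F (Rel F κ n) (FreeAlgebra.ι F (.y ⟨r - 1, by omega⟩))
  else 0

/-- The element `ψ_r`, for `1 ≤ r ≤ n - 1` (and `0` for other `r`). -/
noncomputable def psi (r : ℕ) : KLRAlgebra F κ n :=
  if h : 1 ≤ r ∧ r < n then
    RingQuot.mkAlgHom F (Rel F κ n) (FreeAlgebra.ι F (.psi (r - 1) (by omega)))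
  else 0

/-- `HasDegree x d`: `x` is a product of generators `e(i)` (of degree `0`), `y_r` (of degree `2`)
and `ψ_r e(i)` (of degree `-a_{i_r, i_{r+1}}`), of total degree `d`. -/
inductive HasDegree : KLRAlgebra F κ n → ℤ → Prop
  | idem (i : Fin n → ZMod e) : HasDegree (idem F κ n i) 0
  | y (r : ℕ) (h1 : 1 ≤ r) (h2 : r ≤ n) : HasDegree (y F κ n r) 2
  | psi (r : ℕ) (h1 : 1 ≤ r) (h2 : r < n) (i : Fin n → ZMod e) :
      HasDegree (psi F κ n r * idem F κ n i)
        (- cartan (i ⟨r - 1, by omega⟩) (i ⟨r, h2⟩))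
  | mul (x x' : KLRAlgebra F κ n) (d d' : ℤ) (hx : HasDegree x d) (hx' : HasDegree x' d') :
      HasDegree (x * x') (d + d')

/-- The component of degree `d` of the `ℤ`-grading of `R_n^Λ` in which the generators have the
degrees above. -/
def degreePart (d : ℤ) : Submodule F (KLRAlgebra F κ n) :=
  Submodule.span F {x | HasDegree F κ n x d}

/-- The descending product `f x * f (x - 1) * ⋯ * f y`, which is `1` if `x < y`. -/
def descProd {A : Type*} [Monoid A] (f : ℕ → A) (x y : ℕ) : A :=
  ((List.range (x + 1 - y)).map fun t => f (x - t)).prod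

/-- The brick transposition
`Ψ_r = (ψ_{re} ⋯ ψ_{(r-1)e+1}) (ψ_{re+1} ⋯ ψ_{(r-1)e+2}) ⋯ (ψ_{(r+1)e-1} ⋯ ψ_{re})`. -/
noncomputable def brick (r : ℕ) : KLRAlgebra F κ n :=
  ((List.range e).map fun t =>
    descProd (psi F κ n) (r * e + t) ((r - 1) * e + 1 + t)).prod

end KLR

/-! ## The Specht modules `S^{((ke),(je))}` -/

section Specht

variable (F : Type*) [Field F] {e : ℕ} [NeZero e] (κ : Fin 2 → ZMod e) (n k j : ℕ)
  (h : k * e + j * e = n)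

/-- The left ideal of `R_n^Λ` generated by the elements that the defining relations of
`S^{((ke),(je))}` require to annihilate the generator. -/
def spechtIdeal : Submodule (KLRAlgebra F κ n) (KLRAlgebra F κ n) :=
  Submodule.span (KLRAlgebra F κ n)
    ({KLR.idem F κ n ((BiTableau.colInitial n (k * e) (j * e) h).resSeq κ) - 1}
      ∪ {x | ∃ r : ℕ, 1 ≤ r ∧ r ≤ n ∧ x = KLR.y F κ n r}
      ∪ {x | ∃ r : ℕ, 1 ≤ r ∧ r < n ∧ r ≠ j * e ∧ x = KLR.psi F κ n r})

/-- The (column) Specht module `S^{((ke),(je))}`. -/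
abbrev SpechtModule : Type _ := KLRAlgebra F κ n ⧸ spechtIdeal F κ n k j h

/-- The generator `z` of `S^{((ke),(je))}`. -/
def spechtGen : SpechtModule F κ n k j h := (spechtIdeal F κ n k j h).mkQ 1

/-- The component of degree `d` of the graded module `S^{((ke),(je))}`, whose generator `z` has
degree the codegree of the column-initial tableau. -/
noncomputable def spechtDegreePart (d : ℤ) : Submodule F (SpechtModule F κ n k j h) :=
  (KLR.degreePart F κ n
      (d - (BiTableau.colInitial n (k * e) (j * e) h).codeg κ)).map
    ((spechtIdeal F κ n k j h).mkQ.restrictScalars F)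

end Specht

/-- The bipartitions `((ke + e), (je - e))` and `((ke), (je))` have the same size. -/
theorem specht_size_shift {e n k j : ℕ} (hj : 1 ≤ j) (h : k * e + j * e = n) :
    (k + 1) * e + (j - 1) * e = n := by
  obtain ⟨m, rfl⟩ := Nat.exists_eq_add_of_le hj
  rw [Nat.add_sub_cancel_left, ← h]
  ring

/-! A homomorphism out of the cyclic module S^{((ke+e),(je-e))} is the same as a vector w of
S^{((ke),(je))} that satisfies the relations of its generator. Each component is a whole number of
bricks (a brick is e consecutive strands of residues 0, …, e-1), so both column-initial tableaux
have the residue sequence 0, 1, 2, … modulo e (`stdSeq`). Hence w must have this weight and be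
killed by every y_r and by every ψ_r with r ≠ (j-1)e.

Call a vector of weight `stdSeq` a brick vector if all y_r and all ψ_r with e ∤ r kill it. The
generator z is one, and brick transpositions preserve brick vectors (`isBrickVector_brickOp`). For a
brick vector v, ψ_{re} Ψ_r v = -2 ψ_{re} v (`P_brickOp`) and ψ_{re} Ψ_{r+1} Ψ_r v = ψ_{re} v
(`P_brickOp_brickOp`). Put v_i = Ψ_{j+i-1} ⋯ Ψ_j z. If r = j + m with 0 ≤ m < k, then ψ_{re} kills
v_i except for i = m, m+1, m+2, where the results are x, -2x, x. So ∑ c_i v_i is killed when the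
second differences of c vanish and c_{k+1} = 0; the coefficients c_i = k+1-i do this
(`P_sum_brickVec`).

The two identities come from strand diagrams. Most unwanted terms vanish because every weight of the
Specht module is the residue sequence of a shuffle of two strings 0, 1, 2, … (`specht_eq_zero`); for
this a spanning set suffices, not a basis (`reach_stable`). The diagram calculus uses only the
relations collected in `KLRAction`. For e = 2 the relations are quadratic in the dots y_r, so that
case is computed separately.

As for degrees, a strand that passes a whole brick meets every residue once, and the rows of the
Cartan matrix sum to 0. So bricks have degree 0, and the degree 1 is the difference of the codegrees
j and j-1 of the two generators. -/

/-! ## Moving strands past each other -/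

namespace KLR

/-- The entries `r` and `r + 1` of a sequence swapped. -/
def sw {α : Type*} (r : ℕ) (i : ℕ → α) : ℕ → α :=
  fun t => if t = r then i (r + 1) else if t = r + 1 then i r else i t

section Monoid

variable {A : Type*} [Monoid A] (f : ℕ → A)

/-- `f (p + l - 1) * ⋯ * f p`: the strand at `p` moves right past `l` strands. -/
def moveRight (p : ℕ) : ℕ → A
  | 0 => 1
  | l + 1 => f (p + l) * moveRight p l

/-- `f p * ⋯ * f (p + l - 1)`: the strand at `p + l` moves left past `l` strands. -/
def moveLeft (p : ℕ) : ℕ → A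
  | 0 => 1
  | l + 1 => moveLeft p l * f (p + l)

/-- The `m` strands at `p, …, p + m - 1` move right past `l` strands. -/
def moveBlock (p : ℕ) : ℕ → ℕ → A
  | 0, _ => 1
  | m + 1, l => moveBlock p m l * moveRight f (p + m) l

@[simp] theorem moveRight_zero (p : ℕ) : moveRight f p 0 = 1 := rfl

@[simp] theorem moveLeft_zero (p : ℕ) : moveLeft f p 0 = 1 := rfl

@[simp] theorem moveBlock_zero (p l : ℕ) : moveBlock f p 0 l = 1 := rfl

theorem moveRight_succ (p l : ℕ) : moveRight f p (l + 1) = f (p + l) * moveRight f p l := rfl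

theorem moveLeft_succ (p l : ℕ) : moveLeft f p (l + 1) = moveLeft f p l * f (p + l) := rfl

theorem moveBlock_succ (p m l : ℕ) :
    moveBlock f p (m + 1) l = moveBlock f p m l * moveRight f (p + m) l := rfl

theorem moveRight_add (p l m : ℕ) :
    moveRight f p (l + m) = moveRight f (p + l) m * moveRight f p l := by
  induction m with
  | zero => simp
  | succ m ih => rw [← add_assoc, moveRight_succ, moveRight_succ, ih, mul_assoc, add_assoc]

theorem moveRight_one (p : ℕ) : moveRight f p 1 = f p := by
  simp [moveRight]

theorem moveRight_succ' (p l : ℕ) : moveRight f p (l + 1) = moveRight f (p + 1) l * f p := by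
  rw [add_comm l, moveRight_add, moveRight_one]

theorem moveLeft_succ' (p l : ℕ) : moveLeft f p (l + 1) = f p * moveLeft f (p + 1) l := by
  induction l with
  | zero => simp [moveLeft]
  | succ l ih =>
    rw [moveLeft_succ, ih, moveLeft_succ, mul_assoc]
    congr 3; omega

theorem moveBlock_succ' (p m l : ℕ) :
    moveBlock f p (m + 1) l = moveRight f p l * moveBlock f (p + 1) m l := by
  induction m with
  | zero => simp [moveBlock]
  | succ m ih =>
    rw [moveBlock_succ, ih, moveBlock_succ, mul_assoc]
    congr 3; omega

@[simp] theorem moveBlock_right_zero (p m : ℕ) : moveBlock f p m 0 = 1 := by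
  induction m with
  | zero => rfl
  | succ m ih => rw [moveBlock_succ, ih]; simp

theorem map_moveRight {B : Type*} [Monoid B] (φ : A →* B) (p l : ℕ) :
    φ (moveRight f p l) = moveRight (fun r => φ (f r)) p l := by
  induction l with
  | zero => simp
  | succ l ih => rw [moveRight_succ, map_mul, ih, moveRight_succ]

theorem map_moveBlock {B : Type*} [Monoid B] (φ : A →* B) (p m l : ℕ) :
    φ (moveBlock f p m l) = moveBlock (fun r => φ (f r)) p m l := by
  induction m with
  | zero => simp
  | succ m ih => rw [moveBlock_succ, map_mul, ih, moveBlock_succ, map_moveRight]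

variable {f}

theorem commute_moveRight {x : A} {p l : ℕ} (h : ∀ t, p ≤ t → t < p + l → Commute x (f t)) :
    Commute x (moveRight f p l) := by
  induction l with
  | zero => exact Commute.one_right x
  | succ l ih =>
    exact (h _ (by omega) (by omega)).mul_right (ih fun t h1 h2 => h t h1 (by omega))

theorem commute_moveLeft {x : A} {p l : ℕ} (h : ∀ t, p ≤ t → t < p + l → Commute x (f t)) :
    Commute x (moveLeft f p l) := by
  induction l with
  | zero => exact Commute.one_right x
  | succ l ih =>
    exact (ih fun t h1 h2 => h t h1 (by omega)).mul_right (h _ (by omega) (by omega))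

theorem commute_moveBlock {x : A} {p m l : ℕ}
    (h : ∀ t, p ≤ t → t + 1 < p + m + l → Commute x (f t)) :
    Commute x (moveBlock f p m l) := by
  induction m with
  | zero => exact Commute.one_right x
  | succ m ih =>
    exact (ih fun t h1 h2 => h t h1 (by omega)).mul_right
      (commute_moveRight fun t h1 h2 => h t (by omega) (by omega))

/-- The crossing of two groups of strands can be built strand by strand from either group. Here the
last of the passed strands is peeled off as the final factor to act; in
`moveBlock_succ_eq_mul_moveLeft` the first one is peeled off as the first factor to act. -/
theorem moveBlock_succ_eq_moveLeft_mul (hf : ∀ r s, r + 1 < s → Commute (f r) (f s))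
    (p m l : ℕ) :
    moveBlock f p m (l + 1) = moveLeft f (p + l) m * moveBlock f p m l := by
  induction m with
  | zero => simp
  | succ m ih =>
    have hc : Commute (f (p + m + l)) (moveBlock f p m l) :=
      commute_moveBlock fun t _ h2 => (hf t _ (by omega)).symm
    rw [moveBlock_succ, ih, moveRight_succ, moveBlock_succ, moveLeft_succ,
      show p + l + m = p + m + l by omega]
    simp only [mul_assoc]
    rw [← mul_assoc (moveBlock f p m l), ← hc.eq, mul_assoc]

theorem moveBlock_succ_eq_mul_moveLeft (hf : ∀ r s, r + 1 < s → Commute (f r) (f s))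
    (p m l : ℕ) :
    moveBlock f p m (l + 1) = moveBlock f (p + 1) m l * moveLeft f p m := by
  induction m generalizing p with
  | zero => simp
  | succ m ih =>
    have hc : Commute (f p) (moveBlock f (p + 1 + 1) m l) :=
      commute_moveBlock fun t h1 _ => hf p t (by omega)
    rw [moveBlock_succ', ih, moveRight_succ', moveBlock_succ', moveLeft_succ']
    simp only [mul_assoc]
    rw [← mul_assoc (f p), hc.eq, mul_assoc]

end Monoid

/-- The sequence after the entry at `p` has moved right past `l` entries. -/
def seqRight {α : Type*} (p l : ℕ) (i : ℕ → α) : ℕ → α :=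
  fun t => if t < p then i t else if t < p + l then i (t + 1) else if t = p + l then i p else i t

/-- The sequence after the entries at `p, …, p + m - 1` have moved right past `l` entries. -/
def seqBlock {α : Type*} (p m l : ℕ) (i : ℕ → α) : ℕ → α :=
  fun t => if t < p then i t else if t < p + l then i (t + m)
    else if t < p + l + m then i (t - l) else i t

theorem seqRight_zero {α : Type*} (p : ℕ) (i : ℕ → α) : seqRight p 0 i = i := by
  funext t
  simp only [seqRight]
  split_ifs <;> first | rfl | (congr 1; omega)

theorem sw_seqRight {α : Type*} (p l : ℕ) (i : ℕ → α) :
    sw (p + l) (seqRight p l i) = seqRight p (l + 1) i := by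
  funext t
  simp only [seqRight, sw]
  split_ifs <;> first | rfl | omega | (congr 1; omega)

theorem seqBlock_zero {α : Type*} (p l : ℕ) (i : ℕ → α) : seqBlock p 0 l i = i := by
  funext t
  simp only [seqBlock]
  split_ifs <;> first | rfl | omega

theorem seqRight_seqBlock {α : Type*} (p m l : ℕ) (i : ℕ → α) :
    seqRight p l (seqBlock (p + 1) m l i) = seqBlock p (m + 1) l i := by
  funext t
  simp only [seqRight, seqBlock]
  split_ifs <;> first | rfl | omega | (congr 1; omega)

/-- Operators `P r`, `Y r` on a vector space and a notion `W i v` of `v` having weight `i` that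
satisfy the relations of the KLR algebra on `n` strands. -/
structure KLRAction (e n : ℕ) {F M : Type*} [Field F] [AddCommGroup M] [Module F M]
    (P Y : ℕ → Module.End F M) (W : (ℕ → ZMod e) → M → Prop) : Prop where
  P_comm : ∀ r s, r + 1 < s → Commute (P r) (P s)
  Y_P_comm : ∀ r s, s ≠ r → s ≠ r + 1 → Commute (Y s) (P r)
  W_congr : ∀ i i' v, (∀ t, 1 ≤ t → t ≤ n → i t = i' t) → W i v → W i' v
  W_P : ∀ i v r, 1 ≤ r → r < n → W i v → W (sw r i) (P r v)
  Y_P : ∀ i v r, 1 ≤ r → r < n → W i v →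
    Y r (P r v) = P r (Y (r + 1) v) - (if i r = i (r + 1) then v else 0)
  Y_succ_P : ∀ i v r, 1 ≤ r → r < n → W i v →
    Y (r + 1) (P r v) = P r (Y r v) + (if i r = i (r + 1) then v else 0)
  sq_eq : ∀ i v r, 1 ≤ r → r < n → W i v → i r = i (r + 1) → P r (P r v) = 0
  sq_far : ∀ i v r, 1 ≤ r → r < n → W i v → i (r + 1) ≠ i r → i (r + 1) ≠ i r + 1 →
    i (r + 1) ≠ i r - 1 → P r (P r v) = v
  sq_add : e ≠ 2 → ∀ i v r, 1 ≤ r → r < n → W i v → i r = i (r + 1) + 1 →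
    P r (P r v) = Y (r + 1) v - Y r v
  sq_sub : e ≠ 2 → ∀ i v r, 1 ≤ r → r < n → W i v → i r = i (r + 1) - 1 →
    P r (P r v) = Y r v - Y (r + 1) v
  sq_two : e = 2 → ∀ i v r, 1 ≤ r → r < n → W i v → i r ≠ i (r + 1) →
    P r (P r v) = Y (r + 1) (Y r v - Y (r + 1) v) - Y r (Y r v - Y (r + 1) v)
  braid_add : e ≠ 2 → ∀ i v r, 1 ≤ r → r + 1 < n → W i v → i (r + 2) = i r → i r = i (r + 1) + 1 →
    P r (P (r + 1) (P r v)) = P (r + 1) (P r (P (r + 1) v)) + v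
  braid_sub : e ≠ 2 → ∀ i v r, 1 ≤ r → r + 1 < n → W i v → i (r + 2) = i r → i r = i (r + 1) - 1 →
    P r (P (r + 1) (P r v)) = P (r + 1) (P r (P (r + 1) v)) - v
  braid_two : e = 2 → ∀ i v r, 1 ≤ r → r + 1 < n → W i v → i (r + 2) = i r → i r ≠ i (r + 1) →
    P r (P (r + 1) (P r v)) =
      P (r + 1) (P r (P (r + 1) v)) + Y r v - (2 : F) • Y (r + 1) v + Y (r + 2) v
  braid_far : ∀ i v r, 1 ≤ r → r + 1 < n → W i v →
    (i (r + 2) ≠ i r ∨ (i r ≠ i (r + 1) + 1 ∧ i r ≠ i (r + 1) - 1)) →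
    P r (P (r + 1) (P r v)) = P (r + 1) (P r (P (r + 1) v))

theorem natCast_zmod_ne {e a b : ℕ} (h1 : a < b) (h2 : b < a + e) : (a : ZMod e) ≠ b := by
  intro h
  rw [ZMod.natCast_eq_natCast_iff] at h
  have := (Nat.modEq_iff_dvd' h1.le).1 h
  have := Nat.le_of_dvd (by omega) this
  omega

end KLR

/-! ### Sliding dots and crossings along moving strands. -/

namespace KLR
namespace KLRAction

theorem commute_apply {F M : Type*} [Field F] [AddCommGroup M] [Module F M]
    {a b : Module.End F M} (h : Commute a b) (v : M) : a (b v) = b (a v) := by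
  rw [← Module.End.mul_apply, h.eq, Module.End.mul_apply]

variable {e n : ℕ} {F M : Type*} [Field F] [AddCommGroup M] [Module F M]
  {P Y : ℕ → Module.End F M} {W : (ℕ → ZMod e) → M → Prop}

theorem P_comm' (H : KLRAction e n P Y W) (r s : ℕ) (h : r + 1 < s ∨ s + 1 < r) :
    Commute (P r) (P s) :=
  h.elim (H.P_comm r s) fun h => (H.P_comm s r h).symm

theorem P_moveRight (H : KLRAction e n P Y W) {r p l : ℕ} (h : r + 1 < p ∨ p + l < r) :
    Commute (P r) (moveRight P p l) :=
  commute_moveRight fun t _ _ => H.P_comm' r t (by omega)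

theorem P_moveLeft (H : KLRAction e n P Y W) {r p l : ℕ} (h : r + 1 < p ∨ p + l < r) :
    Commute (P r) (moveLeft P p l) :=
  commute_moveLeft fun t _ _ => H.P_comm' r t (by omega)

theorem P_moveBlock (H : KLRAction e n P Y W) {r p m l : ℕ} (h : r + 1 < p ∨ p + m + l ≤ r) :
    Commute (P r) (moveBlock P p m l) :=
  commute_moveBlock fun t _ _ => H.P_comm' r t (by omega)

theorem Y_moveRight (H : KLRAction e n P Y W) {s p l : ℕ} (h : s < p ∨ p + l < s) :
    Commute (Y s) (moveRight P p l) :=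
  commute_moveRight fun t _ _ => H.Y_P_comm t s (by omega) (by omega)

theorem Y_moveBlock (H : KLRAction e n P Y W) {s p m l : ℕ} (h : s < p ∨ p + m + l ≤ s) :
    Commute (Y s) (moveBlock P p m l) :=
  commute_moveBlock fun t _ _ => H.Y_P_comm t s (by omega) (by omega)

theorem W_moveRight (H : KLRAction e n P Y W) {i : ℕ → ZMod e} {v : M} {p l : ℕ}
    (hp : 1 ≤ p) (hn : p + l ≤ n) (hv : W i v) : W (seqRight p l i) (moveRight P p l v) := by
  induction l with
  | zero => simpa [seqRight_zero] using hv
  | succ l ih =>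
    rw [← sw_seqRight, moveRight_succ, Module.End.mul_apply]
    exact H.W_P _ _ _ (by omega) (by omega) (ih (by omega))

theorem W_moveBlock (H : KLRAction e n P Y W) {i : ℕ → ZMod e} {v : M} {p m l : ℕ}
    (hp : 1 ≤ p) (hn : p + m + l ≤ n + 1) (hv : W i v) :
    W (seqBlock p m l i) (moveBlock P p m l v) := by
  induction m generalizing p with
  | zero => simpa [seqBlock_zero] using hv
  | succ m ih =>
    rw [← seqRight_seqBlock, moveBlock_succ', Module.End.mul_apply]
    rcases m with _ | m
    · simpa [seqBlock_zero] using H.W_moveRight hp (by omega) hv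
    · exact H.W_moveRight hp (by omega) (ih (by omega) (by omega))

/-- A dot slides along the strand that moves right. -/
theorem Y_strand (H : KLRAction e n P Y W) {i : ℕ → ZMod e} {v : M} {p l : ℕ}
    (hp : 1 ≤ p) (hn : p + l ≤ n) (hv : W i v) (h : ∀ t, 1 ≤ t → t ≤ l → i p ≠ i (p + t)) :
    Y (p + l) (moveRight P p l v) = moveRight P p l (Y p v) := by
  induction l with
  | zero => simp
  | succ l ih =>
    have hw := H.W_moveRight (l := l) hp (by omega) hv
    rw [moveRight_succ, Module.End.mul_apply, ← add_assoc,
      H.Y_succ_P _ _ _ (by omega) (by omega) hw, if_neg, ih (by omega) fun t h1 h2 => h t h1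
        (by omega), add_zero, Module.End.mul_apply]
    simpa [seqRight, add_assoc] using h (l + 1) (by omega) le_rfl

theorem moveRight_split (p t s : ℕ) (v : M) :
    moveRight P p (t + 1 + s) v = moveRight P (p + t + 1) s (P (p + t) (moveRight P p t v)) := by
  rw [moveRight_add, moveRight_succ]; rfl

/-- A dot slides along a strand that is passed by a strand of another residue. -/
theorem Y_cross (H : KLRAction e n P Y W) {i : ℕ → ZMod e} {v : M} {p l t : ℕ}
    (hp : 1 ≤ p) (hn : p + l ≤ n) (hv : W i v) (ht : t < l) (h : i p ≠ i (p + t + 1)) :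
    Y (p + t) (moveRight P p l v) = moveRight P p l (Y (p + t + 1) v) := by
  obtain ⟨s, rfl⟩ := Nat.exists_eq_add_of_le (Nat.succ_le_of_lt ht)
  have hw := H.W_moveRight (l := t) hp (by omega) hv
  rw [Nat.succ_eq_add_one, moveRight_split, moveRight_split,
    commute_apply (H.Y_moveRight (by omega)), H.Y_P _ _ _ (by omega) (by omega) hw, if_neg,
    sub_zero, commute_apply (H.Y_moveRight (by omega))]
  simpa [seqRight] using h

/-- A pair of dots slides through the crossing of two strands of the same residue. -/
theorem Y_cross_eq (H : KLRAction e n P Y W) {i : ℕ → ZMod e} {v : M} {p l t : ℕ}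
    (hp : 1 ≤ p) (hn : p + l ≤ n) (hv : W i v) (ht : t < l)
    (h : ∀ s, 1 ≤ s → s ≤ l → s ≠ t + 1 → i p ≠ i (p + s)) :
    Y (p + t) (moveRight P p l v) + Y (p + l) (moveRight P p l v) =
      moveRight P p l (Y (p + t + 1) v + Y p v) := by
  obtain ⟨s, rfl⟩ := Nat.exists_eq_add_of_le (Nat.succ_le_of_lt ht)
  rw [Nat.succ_eq_add_one]
  have hw := H.W_moveRight (l := t) hp (by omega) hv
  have hw' := H.W_P _ _ (p + t) (by omega) (by omega) hw
  rw [moveRight_split, moveRight_split, commute_apply (H.Y_moveRight (by omega)),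
    show p + (t + 1 + s) = p + t + 1 + s by omega, H.Y_strand (by omega) (by omega) hw',
    H.Y_P _ _ _ (by omega) (by omega) hw, H.Y_succ_P _ _ _ (by omega) (by omega) hw,
    commute_apply (H.Y_moveRight (s := p + t + 1) (by omega)),
    H.Y_strand hp (by omega) hv fun u h1 h2 => h u h1 (by omega) (by omega)]
  · simp only [map_add, map_sub]; abel
  · intro u h1 h2
    have := h (t + 1 + u) (by omega) (by omega) (by omega)
    simp (disch := omega) only [sw, seqRight, if_pos, if_neg]
    rwa [← add_assoc, ← add_assoc] at this

/-- A crossing slides through a strand that moves right. -/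
theorem P_cross (H : KLRAction e n P Y W) {i : ℕ → ZMod e} {v : M} {p l t : ℕ}
    (hp : 1 ≤ p) (hn : p + l ≤ n) (hv : W i v) (ht : t + 2 ≤ l) (h : i p ≠ i (p + t + 2)) :
    P (p + t) (moveRight P p l v) = moveRight P p l (P (p + t + 1) v) := by
  obtain ⟨s, rfl⟩ := Nat.exists_eq_add_of_le ht
  have hw := H.W_moveRight (l := t) hp (by omega) hv
  have key : ∀ w, moveRight P p (t + 2 + s) w =
      moveRight P (p + t + 2) s (P (p + t + 1) (P (p + t) (moveRight P p t w))) := by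
    intro w
    rw [moveRight_add, moveRight_succ, moveRight_succ]; rfl
  rw [key, key, commute_apply (H.P_moveRight (by omega)), H.braid_far _ _ _ (by omega) (by omega) hw,
    commute_apply (H.P_moveRight (by omega))]
  left
  simpa [seqRight] using h.symm

/-- The braid relation has no correction term when its two outer strands have different residues. So
only the right-hand strand of the crossing has to be compared with the strands of the block. -/
theorem P_cross_block (H : KLRAction e n P Y W) {i : ℕ → ZMod e} {v : M} {p m l t : ℕ}
    (hp : 1 ≤ p) (hn : p + m + l ≤ n + 1) (hv : W i v) (ht : t + 2 ≤ l)
    (h : ∀ s < m, i (p + s) ≠ i (p + m + t + 1)) :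
    P (p + t) (moveBlock P p m l v) = moveBlock P p m l (P (p + m + t) v) := by
  induction m generalizing p with
  | zero => simp
  | succ m ih =>
    rw [moveBlock_succ', Module.End.mul_apply, Module.End.mul_apply]
    rcases m with _ | m
    · simpa [add_right_comm] using
        H.P_cross hp (by omega) hv ht (by simpa [add_right_comm] using h 0 (by omega))
    have hw := H.W_moveBlock (p := p + 1) (m := m + 1) (l := l) (by omega) (by omega) hv
    rw [H.P_cross hp (by omega) hw ht, show p + t + 1 = p + 1 + t by omega,
      ih (by omega) (by omega)]
    · congr 4; omega
    · intro s hs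
      have := h (s + 1) (by omega)
      rwa [show p + (s + 1) = p + 1 + s by omega,
        show p + (m + 1 + 1) + t + 1 = p + 1 + (m + 1) + t + 1 by omega] at this
    · have := h 0 (by omega)
      simp (disch := omega) only [seqBlock, if_pos, if_neg]
      rwa [show p + (m + 1 + 1) + t + 1 = p + t + 2 + (m + 1) by omega] at this

/-- Each braid relation used has the left strand of the pair and a passed strand as its outer
strands, so the residue of the right strand of the pair is irrelevant. -/
theorem P_pair (H : KLRAction e n P Y W) {i : ℕ → ZMod e} {v : M} {p l : ℕ}
    (hp : 1 ≤ p) (hn : p + 1 + l ≤ n) (hv : W i v) (h : ∀ t < l, i (p + 2 + t) ≠ i p) :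
    P (p + l) (moveRight P p l (moveRight P (p + 1) l v)) =
      moveRight P p l (moveRight P (p + 1) l (P p v)) := by
  induction l with
  | zero => simp
  | succ l ih =>
    have hw := H.W_moveRight (p := p) (l := l) (by omega) (by omega)
      (H.W_moveRight (p := p + 1) (l := l) (by omega) (by omega) hv)
    have key : ∀ w, moveRight P p (l + 1) (moveRight P (p + 1) (l + 1) w) =
      P (p + l) (P (p + l + 1) (moveRight P p l (moveRight P (p + 1) l w))) := by
      intro w
      rw [moveRight_succ, moveRight_succ, Module.End.mul_apply, Module.End.mul_apply,
        ← commute_apply (H.P_moveRight (by omega)), add_right_comm]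
    rw [key, key, ← add_assoc, ← H.braid_far _ _ _ (by omega) (by omega) hw,
      ih (by omega) fun t ht => h t (by omega)]
    left
    have := h l (by omega)
    simp (disch := omega) only [seqRight, if_pos, if_neg]
    rwa [show p + l + 2 = p + 2 + l by omega]

/-- Two strands of residues `a`, `a + 1` that do not cross below, followed by a crossing. -/
theorem P_pair_succ (H : KLRAction e n P Y W) (he : e ≠ 2) {i : ℕ → ZMod e} {v : M} {p l : ℕ}
    (hp : 1 ≤ p) (hn : p + 2 + l ≤ n) (hv : W i v) (h : ∀ t < l, i (p + 2 + t) ≠ i p)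
    (h1 : i (p + 2 + l) = i p) (h2 : i p = i (p + 1) - 1) (h0 : P p v = 0) :
    P (p + l + 1) (moveRight P p (l + 1) (moveRight P (p + 1) (l + 1) v)) =
      moveRight P p l (moveRight P (p + 1) l v) := by
  have hw := H.W_moveRight (p := p) (l := l) (by omega) (by omega)
    (H.W_moveRight (p := p + 1) (l := l) (by omega) (by omega) hv)
  have key : moveRight P p (l + 1) (moveRight P (p + 1) (l + 1) v) =
      P (p + l) (P (p + l + 1) (moveRight P p l (moveRight P (p + 1) l v))) := by
    rw [moveRight_succ, moveRight_succ, Module.End.mul_apply, Module.End.mul_apply,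
      ← commute_apply (H.P_moveRight (by omega)), add_right_comm]
  have h3 := H.braid_sub he _ _ (p + l) (by omega) (by omega) hw (by
      simp (disch := omega) only [seqRight, if_pos, if_neg]
      rwa [show p + l + 2 = p + 2 + l by omega]) (by
      simp (disch := omega) only [seqRight, if_pos, if_neg]
      exact h2)
  rw [H.P_pair hp (by omega) hv h, h0] at h3
  rw [key]
  simpa [sub_eq_zero] using h3.symm

/-- A strand that moves right past strands of distant residues and then back. -/
theorem moveLeft_moveRight (H : KLRAction e n P Y W) {i : ℕ → ZMod e} {v : M} {p l : ℕ}
    (hp : 1 ≤ p) (hn : p + l ≤ n) (hv : W i v)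
    (h : ∀ t, 1 ≤ t → t ≤ l → i (p + t) ≠ i p ∧ i (p + t) ≠ i p + 1 ∧ i (p + t) ≠ i p - 1) :
    moveLeft P p l (moveRight P p l v) = v := by
  induction l with
  | zero => simp
  | succ l ih =>
    have hw := H.W_moveRight (p := p) (l := l) (by omega) (by omega) hv
    have h' := h (l + 1) (by omega) le_rfl
    rw [moveLeft_succ, moveRight_succ, Module.End.mul_apply, Module.End.mul_apply,
      H.sq_far _ _ _ (by omega) (by omega) hw, ih (by omega) fun t h1 h2 => h t h1 (by omega)]
    all_goals simp [seqRight, add_assoc, h']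

end KLRAction
end KLR

/-! ### Crossings of two strings of consecutive residues. -/

namespace KLR
namespace KLRAction

variable {e n : ℕ} {F M : Type*} [Field F] [AddCommGroup M] [Module F M]
  {P Y : ℕ → Module.End F M} {W : (ℕ → ZMod e) → M → Prop}

theorem natCast_far {e a b : ℕ} (h1 : a + 1 < b) (h2 : b + 1 < a + e) :
    ((a : ZMod e) ≠ b ∧ (a : ZMod e) ≠ (b : ZMod e) + 1 ∧ (a : ZMod e) ≠ (b : ZMod e) - 1) := by
  refine ⟨natCast_zmod_ne (by omega) (by omega), ?_, ?_⟩
  · have := natCast_zmod_ne (e := e) (a := a) (b := b + 1) (by omega) (by omega)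
    simpa using this
  · have := natCast_zmod_ne (e := e) (a := a + 1) (b := b) (by omega) (by omega)
    rw [Ne, eq_sub_iff_add_eq]
    simpa using this

/-- The crossing of two strings `0, …, m` in which the last two strands avoid each other and the
first strand stops before the last one, given the case of shorter strings. -/
theorem grid_aux (H : KLRAction e n P Y W) (m p : ℕ) (hm : m + 3 ≤ e) (hp : 1 ≤ p)
    (hn : p + 2 * m + 4 ≤ n)
    (hG : ∀ (i : ℕ → ZMod e) (v : M), W i v → (∀ t ≤ m + 1, i (p + t) = t) →
      (∀ t ≤ m, i (p + m + 2 + t) = t) → (∀ t ≤ m, P (p + t) v = 0) →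
      moveBlock P p (m + 1) (m + 2) (moveRight P (p + m + 1) (m + 1) v) = v)
    (i : ℕ → ZMod e) (v : M) (hv : W i v) (h1 : ∀ t ≤ m + 2, i (p + t) = t)
    (h2 : ∀ t ≤ m + 1, i (p + m + 3 + t) = t) (h0 : ∀ t ≤ m + 1, P (p + t) v = 0) :
    moveRight P p (m + 2) (moveBlock P (p + 1) (m + 1) (m + 3)
      (moveRight P (p + m + 2) (m + 2) v)) = P (p + m + 2) v := by
  have e1 : i (p + m + 1) = (m + 1 : ℕ) := h1 (m + 1) (by omega)
  have e2 : i (p + m + 2) = (m + 2 : ℕ) := h1 (m + 2) (by omega)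
  -- The strands of residues m+1 and m+2 meet the strand m+1 of the second string. Since ψ kills
  -- `v`, only the correction term of that braid relation survives, and in it both strands stop
  -- before the strand m+1.
  have hpair := H.P_pair_succ (p := p + m + 1) (l := m + 1) (by omega) (by omega) (by omega) hv
    (by
      intro t ht
      rw [e1, show p + m + 1 + 2 + t = p + m + 3 + t by omega, h2 t (by omega)]
      exact natCast_zmod_ne (by omega) (by omega))
    (by rw [e1, show p + m + 1 + 2 + (m + 1) = p + m + 3 + (m + 1) by omega, h2 _ le_rfl])
    (by rw [e1, e2]; push_cast; ring) (h0 (m + 1) le_rfl)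
  rw [show p + m + 1 + 1 = p + m + 2 by omega] at hpair
  have hs : moveBlock P (p + 1) (m + 1) (m + 3) (moveRight P (p + m + 2) (m + 2) v) =
      moveBlock P (p + 1) m (m + 3) (moveRight P (p + m + 1) (m + 1)
        (moveRight P (p + m + 2) (m + 1) v)) := by
    rw [moveBlock_succ, Module.End.mul_apply, show p + 1 + m = p + m + 1 by omega,
      moveRight_succ P _ (m + 2), Module.End.mul_apply, ← hpair]
    rfl
  set u := moveRight P (p + m + 2) (m + 1) v with hu
  have hwu := H.W_moveRight (p := p + m + 2) (l := m + 1) (by omega) (by omega) hv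
  have hc : Commute (moveRight P p (m + 2)) (moveLeft P (p + 1 + (m + 2)) m) :=
    commute_moveLeft fun t _ _ => (H.P_moveRight (by omega)).symm
  have hGu := hG _ u hwu
    (by
      intro t ht
      simp (disch := omega) only [seqRight, if_pos]
      exact h1 t (by omega))
    (by
      intro t ht
      simp (disch := omega) only [seqRight, if_pos, if_neg]
      rw [show p + m + 2 + t + 1 = p + m + 3 + t by omega]
      exact h2 t (by omega))
    (by
      intro t ht
      rw [commute_apply (H.P_moveRight (by omega)), h0 t (by omega), map_zero])
  rw [moveBlock_succ', Module.End.mul_apply] at hGu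
  rw [hs, moveBlock_succ_eq_moveLeft_mul H.P_comm, Module.End.mul_apply, commute_apply hc, hGu, hu,
    moveRight_succ', Module.End.mul_apply]
  -- With the shorter grid removed, the strand m+2 passes 0, …, m and comes back past m, …, 1. These
  -- residues are far from m+2, so only its crossing with 0 remains.
  have hwP := H.W_P _ _ (p + m + 2) (by omega) (by omega) hv
  rw [show p + 1 + (m + 2) = p + m + 2 + 1 by omega]
  exact H.moveLeft_moveRight (by omega) (by omega) hwP (by
    intro t ht1 ht2
    simp (disch := omega) only [sw, if_neg]
    rw [e2, show p + m + 2 + 1 + t = p + m + 3 + t by omega, h2 t (by omega)]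
    exact natCast_far (by omega) (by omega))

/-- Induction on the length of the strings. For m = 0 this is one braid relation, whose other cubic
term dies on `v`. -/
theorem grid_eq_self (H : KLRAction e n P Y W) (m p : ℕ) (hm : m + 3 ≤ e) (hp : 1 ≤ p)
    (hn : p + 2 * m + 2 ≤ n) (i : ℕ → ZMod e) (v : M) (hv : W i v)
    (h1 : ∀ t ≤ m + 1, i (p + t) = t) (h2 : ∀ t ≤ m, i (p + m + 2 + t) = t)
    (h0 : ∀ t ≤ m, P (p + t) v = 0) :
    moveBlock P p (m + 1) (m + 2) (moveRight P (p + m + 1) (m + 1) v) = v := by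
  induction m generalizing i v with
  | zero =>
    have hb := H.braid_sub (by omega) i v p hp (by omega) hv
      (by simpa using (h2 0 le_rfl).trans (h1 0 (by omega)).symm)
      (by simpa using (h1 0 (by omega)).trans (by rw [h1 1 (by omega)]; simp))
    rw [show P p v = 0 from h0 0 le_rfl, map_zero, map_zero] at hb
    simpa [moveBlock, moveRight] using (sub_eq_zero.1 hb.symm)
  | succ m ih =>
    have hg := H.grid_aux m p (by omega) hp (by omega)
      (fun i v hv h1 h2 h0 => ih (by omega) (by omega) i v hv h1 h2 h0) i v hv h1
      (fun t ht => by
        rw [show p + m + 3 + t = p + (m + 1) + 2 + t by omega]; exact h2 t ht) h0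
    rw [moveBlock_succ', moveRight_succ P p, Module.End.mul_apply, Module.End.mul_apply]
    rw [show p + (m + 1) + 1 = p + m + 2 by omega]
    erw [hg]
    rw [show p + (m + 1 + 1) = p + m + 2 by omega]
    have e2 : i (p + m + 2) = (m + 2 : ℕ) := h1 (m + 2) (by omega)
    have e3 : i (p + m + 2 + 1) = (0 : ℕ) := h2 0 (by omega)
    -- `grid_aux` leaves one crossing of residues m+2 and 0, which the last crossing of the grid
    -- doubles. As m + 4 ≤ e here, these residues are not neighbours and the double crossing is the
    -- identity.
    have hf := natCast_far (e := e) (a := 0) (b := m + 2) (by omega) (by omega)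
    rw [← e2, ← e3] at hf
    exact H.sq_far i v _ (by omega) (by omega) hv hf.1 hf.2.1 hf.2.2

/-- For m + 3 = e this evaluates the crossing of two bricks from which the topmost crossing and the
crossing of the two last strands have been removed. -/
theorem grid_eq_cross (H : KLRAction e n P Y W) (m p : ℕ) (hm : m + 3 ≤ e) (hp : 1 ≤ p)
    (hn : p + 2 * m + 4 ≤ n) (i : ℕ → ZMod e) (v : M) (hv : W i v)
    (h1 : ∀ t ≤ m + 2, i (p + t) = t) (h2 : ∀ t ≤ m + 1, i (p + m + 3 + t) = t)
    (h0 : ∀ t ≤ m + 1, P (p + t) v = 0) :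
    moveRight P p (m + 2) (moveBlock P (p + 1) (m + 1) (m + 3)
      (moveRight P (p + m + 2) (m + 2) v)) = P (p + m + 2) v :=
  H.grid_aux m p hm hp hn (fun i v hv h1 h2 h0 =>
    H.grid_eq_self m p hm hp (by omega) i v hv h1 h2 h0) i v hv h1 h2 h0

end KLRAction
end KLR

/-! ### Residue sequences that are not shuffles of two strings. -/

namespace KLR

/-- The residue sequence `0, 1, 2, …`, with positions counted from `1`. -/
def stdSeq (e : ℕ) : ℕ → ZMod e := fun t => (t : ZMod e) - 1

section Shuffle

variable {e : ℕ}

/-- The number, in `ℤ/eℤ`, of letters `b` of `T` in positions `1, …, r - 1`. -/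
def letterCount (e : ℕ) (T : ℕ → Bool) (b : Bool) (r : ℕ) : ZMod e :=
  ∑ s ∈ Finset.Ico 1 r, if T s = b then 1 else 0

/-- The residue sequence of the shuffle `T` of two strings `0, 1, 2, …`. -/
def shuffleSeq (e : ℕ) (T : ℕ → Bool) : ℕ → ZMod e := fun r => letterCount e T (T r) r

/-- `i` is not the residue sequence of a shuffle of two strings `0, 1, 2, …`. -/
def NotShuffle (n : ℕ) (i : ℕ → ZMod e) : Prop :=
  ∀ T : ℕ → Bool, ∃ t, 1 ≤ t ∧ t ≤ n ∧ shuffleSeq e T t ≠ i t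

theorem letterCount_succ (T : ℕ → Bool) (b : Bool) {r : ℕ} (hr : 1 ≤ r) :
    letterCount e T b (r + 1) = letterCount e T b r + if T r = b then 1 else 0 := by
  rw [letterCount, Finset.sum_Ico_succ_top hr]; rfl

theorem letterCount_one (T : ℕ → Bool) (b : Bool) : letterCount e T b 1 = 0 := by
  simp [letterCount]

/-- While a shuffle reads 0, 1, 2, … modulo e, one string has count r-1 and the other count 0 modulo
e. The other string can supply the next letter only if both counts are 0, and then the roles are
exchanged. Consequently the next residue of a shuffle is `stdSeq e r` or 0. -/
theorem shuffle_step (T : ℕ → Bool) {r : ℕ} (hr : 1 ≤ r) (hT : shuffleSeq e T r = stdSeq e r)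
    (h : ∃ b, letterCount e T b r = stdSeq e r ∧ letterCount e T (!b) r = 0) :
    ∃ b, letterCount e T b (r + 1) = stdSeq e (r + 1) ∧ letterCount e T (!b) (r + 1) = 0 := by
  have hs : stdSeq e (r + 1) = stdSeq e r + 1 := by simp [stdSeq]
  obtain ⟨b, h1, h2⟩ := h
  simp only [shuffleSeq] at hT
  by_cases hb : T r = b
  · refine ⟨b, ?_, ?_⟩ <;> rw [letterCount_succ _ _ hr]
    · rw [h1, if_pos hb, hs]
    · rw [h2, if_neg (by simp [hb]), add_zero]
  · have hb' : T r = !b := by cases b <;> simpa using hb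
    rw [hb', h2] at hT
    refine ⟨!b, ?_, ?_⟩ <;> rw [letterCount_succ _ _ hr]
    · rw [h2, if_pos hb', hs, ← hT]
    · rw [Bool.not_not, h1, if_neg hb, ← hT, add_zero]

theorem shuffle_inv (T : ℕ → Bool) {q r : ℕ} (hq : 1 ≤ q) (hqr : q ≤ r)
    (hT : ∀ t, q ≤ t → t < r → shuffleSeq e T t = stdSeq e t)
    (h : ∃ b, letterCount e T b q = stdSeq e q ∧ letterCount e T (!b) q = 0) :
    ∃ b, letterCount e T b r = stdSeq e r ∧ letterCount e T (!b) r = 0 := by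
  induction r, hqr using Nat.le_induction with
  | base => exact h
  | succ r hr ih =>
    exact shuffle_step T (hq.trans hr) (hT r hr (by omega)) (ih fun t h1 h2 => hT t h1 (by omega))

theorem shuffle_mem (T : ℕ → Bool) {r : ℕ}
    (h : ∃ b, letterCount e T b r = stdSeq e r ∧ letterCount e T (!b) r = 0) :
    shuffleSeq e T r = stdSeq e r ∨ shuffleSeq e T r = 0 := by
  obtain ⟨b, h1, h2⟩ := h
  by_cases hb : T r = b
  · exact Or.inl (by rw [shuffleSeq, hb, h1])
  · exact Or.inr (by rw [shuffleSeq, show T r = !b by cases b <;> simpa using hb, h2])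

theorem shuffle_inv_one (T : ℕ → Bool) :
    ∃ b, letterCount e T b 1 = stdSeq e 1 ∧ letterCount e T (!b) 1 = 0 :=
  ⟨true, by simp [letterCount_one, stdSeq], by simp [letterCount_one]⟩

theorem notShuffle_of_prefix {n r : ℕ} {i : ℕ → ZMod e} (hr : 1 ≤ r) (hn : r ≤ n)
    (h : ∀ t, 1 ≤ t → t < r → i t = stdSeq e t) (h1 : i r ≠ stdSeq e r) (h2 : i r ≠ 0) :
    NotShuffle n i := by
  intro T
  by_contra! hT
  have := shuffle_mem T (shuffle_inv T le_rfl hr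
    (fun t ht1 ht2 => (hT t ht1 (by omega)).trans (h t ht1 ht2)) (shuffle_inv_one T))
  rw [hT r hr hn] at this
  tauto

theorem shuffle_after_zero (T : ℕ → Bool) (he : 2 ≤ e) {q : ℕ} (hq : 1 ≤ q) (hqe : (q : ZMod e) = 0)
    (hT : ∀ t, 1 ≤ t → t < q → shuffleSeq e T t = stdSeq e t) (h0 : shuffleSeq e T q = 0) :
    ∃ b, letterCount e T b (q + 1) = -1 ∧ letterCount e T (!b) (q + 1) = 1 := by
  obtain ⟨b, h1, h2⟩ := shuffle_inv T le_rfl hq hT (shuffle_inv_one T)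
  have hne : (0 : ZMod e) ≠ 1 := by
    simpa using natCast_zmod_ne (e := e) (a := 0) (b := 1) (by omega) (by omega)
  rw [stdSeq, hqe, zero_sub] at h1
  have hb : T q ≠ b := by
    rintro rfl
    rw [shuffleSeq, h1, neg_eq_zero] at h0
    exact hne h0.symm
  have hb' : T q = !b := by cases b <;> simpa using hb
  refine ⟨b, ?_, ?_⟩ <;> rw [letterCount_succ _ _ hq]
  · rw [h1, if_neg hb, add_zero]
  · rw [h2, if_pos hb', zero_add]

/-- Just before position q the counts are -1 and 0. The letter 0 turns them into -1 and 1, and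
neither is 0. -/
theorem notShuffle_of_zero_zero {n q : ℕ} {i : ℕ → ZMod e} (he : 2 ≤ e) (hq : 1 ≤ q)
    (hqe : (q : ZMod e) = 0) (hn : q + 1 ≤ n) (h : ∀ t, 1 ≤ t → t < q → i t = stdSeq e t)
    (h1 : i q = 0) (h2 : i (q + 1) = 0) : NotShuffle n i := by
  intro T
  by_contra! hT
  have hne : (0 : ZMod e) ≠ 1 := by
    simpa using natCast_zmod_ne (e := e) (a := 0) (b := 1) (by omega) (by omega)
  obtain ⟨b, h3, h4⟩ := shuffle_after_zero T he hq hqe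
    (fun t ht1 ht2 => (hT t ht1 (by omega)).trans (h t ht1 ht2)) ((hT q hq (by omega)).trans h1)
  have h5 := (hT (q + 1) (by omega) hn).trans h2
  by_cases hb : T (q + 1) = b
  · rw [shuffleSeq, hb, h3, neg_eq_zero] at h5
    exact hne h5.symm
  · rw [shuffleSeq, show T (q + 1) = !b by cases b <;> simpa using hb, h4] at h5
    exact hne h5.symm

/-- The letters 0, -1 in place of -1, 0 lead to the same counts 0 and 1, so from q+2 on the
invariant of `shuffle_step` holds again. For e = 2 the residues 1 and -1 agree and the string that
supplies the letter -1 would not be determined. -/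
theorem notShuffle_of_swapped_prefix {n q r : ℕ} {i : ℕ → ZMod e} (he : 3 ≤ e) (hq : 1 ≤ q)
    (hqe : (q : ZMod e) = 0) (hqr : q + 2 ≤ r) (hn : r ≤ n)
    (h : ∀ t, 1 ≤ t → t < q → i t = stdSeq e t) (h1 : i q = 0) (h2 : i (q + 1) = -1)
    (h3 : ∀ t, q + 2 ≤ t → t < r → i t = stdSeq e t) (h4 : i r ≠ stdSeq e r) (h5 : i r ≠ 0) :
    NotShuffle n i := by
  intro T
  by_contra! hT
  obtain ⟨b, h6, h7⟩ := shuffle_after_zero T (by omega) hq hqe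
    (fun t ht1 ht2 => (hT t ht1 (by omega)).trans (h t ht1 ht2)) ((hT q hq (by omega)).trans h1)
  have h8 := (hT (q + 1) (by omega) (by omega)).trans h2
  have hne : (1 : ZMod e) ≠ -1 := by
    rw [Ne, eq_neg_iff_add_eq_zero]
    have := natCast_zmod_ne (e := e) (a := 0) (b := 2) (by omega) (by omega)
    intro h
    apply this
    push_cast
    rw [← h]; ring
  have hb : T (q + 1) = b := by
    by_contra hb
    rw [shuffleSeq, show T (q + 1) = !b by cases b <;> simpa using hb, h7] at h8
    exact hne h8
  have hinv : ∃ b, letterCount e T b (q + 2) = stdSeq e (q + 2) ∧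
      letterCount e T (!b) (q + 2) = 0 := by
    refine ⟨!b, ?_, ?_⟩ <;> rw [letterCount_succ _ _ (by omega : 1 ≤ q + 1)]
    · rw [h7, if_neg (by simp [hb]), stdSeq]
      push_cast
      rw [hqe]; ring
    · rw [Bool.not_not, h6, if_pos hb, neg_add_cancel]
  have := shuffle_mem T (shuffle_inv T (by omega) hqr
    (fun t ht1 ht2 => (hT t (by omega) (by omega)).trans (h3 t ht1 ht2)) hinv)
  rw [hT r (by omega) hn] at this
  tauto

end Shuffle

/-! ### Brick vectors and dots on partial crossings of two bricks. -/

/-- A vector of weight `stdSeq` that is killed by all dots and by all crossings inside bricks. -/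
structure IsBrickVector {e : ℕ} (n : ℕ) {F M : Type*} [Field F] [AddCommGroup M] [Module F M]
    (P Y : ℕ → Module.End F M) (W : (ℕ → ZMod e) → M → Prop) (v : M) : Prop where
  weight : W (stdSeq e) v
  Y_eq : ∀ s, 1 ≤ s → s ≤ n → Y s v = 0
  P_eq : ∀ r, 1 ≤ r → r < n → (r : ZMod e) ≠ 0 → P r v = 0

theorem stdSeq_add {e p : ℕ} (hp : (p : ZMod e) = 1) (t : ℕ) : stdSeq e (p + t) = t := by
  simp [stdSeq, hp]

namespace KLRAction

variable {e n : ℕ} {F M : Type*} [Field F] [AddCommGroup M] [Module F M]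
  {P Y : ℕ → Module.End F M} {W : (ℕ → ZMod e) → M → Prop} {v : M} {g p : ℕ}

/-- The strands that move have residues m, …, e-1 and the dotted strand has residue t < m, so the
dot slides down to `v`. -/
theorem Y_block_right (H : KLRAction e n P Y W) (hv : IsBrickVector n P Y W v)
    (hpe : (p : ZMod e) = 1) (hp : 1 ≤ p) (hn : p + 2 * e ≤ n + 1) (d m t : ℕ)
    (hd : m + d = e) (ht : t < m) : Y (p + m + t) (moveBlock P (p + m) d e v) = 0 := by
  induction d generalizing m t with
  | zero => exact hv.Y_eq _ (by omega) (by omega)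
  | succ d ih =>
    have hw := H.W_moveBlock (p := p + m + 1) (m := d) (l := e) (by omega) (by omega) hv.weight
    rw [moveBlock_succ', Module.End.mul_apply, H.Y_cross (by omega) (by omega) hw (by omega)]
    · rw [show p + m + t + 1 = p + (m + 1) + t by omega, show p + m + 1 = p + (m + 1) by omega,
        ih _ _ (by omega) (by omega), map_zero]
    · simp (disch := omega) only [seqBlock, if_pos, if_neg]
      rw [stdSeq_add hpe, show p + m + t + 1 + d = p + (e + t) by omega, stdSeq_add hpe]
      exact natCast_zmod_ne (by omega) (by omega)

theorem Y_block_left (H : KLRAction e n P Y W) (hv : IsBrickVector n P Y W v)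
    (hp : 1 ≤ p) (hn : p + 2 * e ≤ n + 1) (d m s : ℕ)
    (hd : m + d = e) (hs : s < m) : Y (p + s) (moveBlock P (p + m) d e v) = 0 := by
  rw [commute_apply (H.Y_moveBlock (by omega)), hv.Y_eq _ (by omega) (by omega), map_zero]

/-- The two dots sit on the last strands of the two bricks. Both strands have residue e-1 and cross
each other, and that is the only crossing where a dot leaves a correction term; the terms in which
the dot passes die on `v`. The correction removes the crossing, so the last strand of the first
brick moves past g strands only. -/
theorem Y_block_last (H : KLRAction e n P Y W) (hv : IsBrickVector n P Y W v)
    (hpe : (p : ZMod e) = 1) (hp : 1 ≤ p) (hn : p + 2 * e ≤ n + 1) (he : e = g + 1) (d m : ℕ)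
    (hd : m + d = g) :
    Y (p + m + g) (moveBlock P (p + m) (d + 1) e v) =
        - moveBlock P (p + m) d e (moveRight P (p + g) g v) ∧
      Y (p + 2 * g + 1) (moveBlock P (p + m) (d + 1) e v) =
        moveBlock P (p + m) d e (moveRight P (p + g) g v) := by
  induction d generalizing m with
  | zero =>
    obtain rfl : m = g := by omega
    have hw := H.W_moveRight (p := p + m) (l := m) (by omega) (by omega) hv.weight
    have hi : seqRight (p + m) m (stdSeq e) (p + m + m) =
        seqRight (p + m) m (stdSeq e) (p + m + m + 1) := by
      simp (disch := omega) only [seqRight, if_neg]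
      rw [stdSeq_add hpe, show p + m + m + 1 = p + (e + m) by omega, stdSeq_add hpe]
      simp
    subst he
    rw [moveBlock_succ, moveBlock_zero, one_mul, add_zero, moveRight_succ, Module.End.mul_apply,
      Module.End.one_apply, H.Y_P _ _ _ (by omega) (by omega) hw, if_pos hi,
      commute_apply (H.Y_moveRight (by omega)), hv.Y_eq _ (by omega) (by omega),
      show p + 2 * m + 1 = p + m + m + 1 by omega,
      H.Y_succ_P _ _ _ (by omega) (by omega) hw, if_pos hi,
      H.Y_strand (by omega) (by omega) hv.weight, hv.Y_eq _ (by omega) (by omega)]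
    · simp
    · intro t ht1 ht2
      rw [stdSeq_add hpe, add_assoc, stdSeq_add hpe]
      exact natCast_zmod_ne (by omega) (by omega)
  | succ d ih =>
    have hw := H.W_moveBlock (p := p + m + 1) (m := d + 1) (l := e) (by omega) (by omega)
      hv.weight
    obtain ⟨h1, h2⟩ := ih (m + 1) (by omega)
    rw [moveBlock_succ' P (p + m) (d + 1), moveBlock_succ' P (p + m) d, Module.End.mul_apply,
      Module.End.mul_apply]
    constructor
    · rw [H.Y_cross (by omega) (by omega) hw (by omega),
        show p + m + g + 1 = p + (m + 1) + g by omega, show p + m + 1 = p + (m + 1) by omega, h1,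
        map_neg]
      simp (disch := omega) only [seqBlock, if_pos, if_neg]
      rw [stdSeq_add hpe, show p + m + g + 1 + (d + 1) = p + (e + g) by omega, stdSeq_add hpe,
        Nat.cast_add, ZMod.natCast_self, zero_add]
      exact natCast_zmod_ne (by omega) (by omega)
    · rw [commute_apply (H.Y_moveRight (p := p + m) (l := e) (by omega)),
        show p + m + 1 = p + (m + 1) by omega, h2]

/-- The crossing of two bricks without its topmost crossing. -/
def halfBrick (P : ℕ → Module.End F M) (g p : ℕ) (v : M) : M :=
  moveRight P p g (moveBlock P (p + 1) g (g + 1) v)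

/-- The full crossing exchanges two equal bricks and preserves `stdSeq`; the crossing left out sits
at position p+g. -/
theorem W_halfBrick (H : KLRAction e n P Y W) (hv : IsBrickVector n P Y W v)
    (hp : 1 ≤ p) (hn : p + 2 * e ≤ n + 1) (he : e = g + 1) (hg : 1 ≤ g) :
    W (sw (p + g) (stdSeq e)) (halfBrick P g p v) := by
  have hw := H.W_moveRight (p := p) (l := g) hp (by omega) (H.W_moveBlock (p := p + 1) (m := g)
    (l := g + 1) (by omega) (by omega) hv.weight)
  have hper : ∀ t, stdSeq e (t + (g + 1)) = stdSeq e t := by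
    intro t
    rw [← he]
    simp [stdSeq]
  refine H.W_congr _ _ _ ?_ hw
  intro t _ _
  have h3 : ∀ s, s + 1 + g = t → stdSeq e t = stdSeq e s := by
    rintro s rfl
    rw [← hper s]
    congr 1; omega
  have h4 : stdSeq e (t + 1 + g) = stdSeq e t := by rw [← hper t]; congr 1; omega
  have h5 : stdSeq e (p + g + g + 1) = stdSeq e (p + g) := by
    rw [← hper (p + g)]; congr 1
  have h6 : stdSeq e (p + g + 1) = stdSeq e p := by rw [← hper p]; congr 1
  simp only [seqRight, seqBlock, sw]
  split_ifs <;> first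
    | rfl
    | omega
    | exact h4
    | (subst_vars; exact h6.symm)
    | (subst_vars; rw [← h5]; congr 1; omega)
    | exact (h3 _ (by omega)).symm

end KLRAction
end KLR

/-! ### The crossing of two bricks for e ≥ 3. -/

namespace KLR
namespace KLRAction

variable {e n : ℕ} {F M : Type*} [Field F] [AddCommGroup M] [Module F M]
  {P Y : ℕ → Module.End F M} {W : (ℕ → ZMod e) → M → Prop} {v : M} {g p : ℕ}

theorem sw_sw {α : Type*} (r : ℕ) (i : ℕ → α) : sw r (sw r i) = i := by
  funext t
  simp only [sw]
  split_ifs <;> first | omega | simp_all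

theorem moveBlock_eq_halfBrick (he : e = g + 1) :
    moveBlock P p e e v = P (p + g) (halfBrick P g p v) := by
  subst he
  rw [moveBlock_succ', moveRight_succ]; rfl

/-- ψ_r would bring the residue r to position r, where a shuffle that has read 0, 1, … so far can
only have r-1 or 0. -/
theorem P_eq_zero_of_stdSeq (H : KLRAction e n P Y W)
    (hvan : ∀ i x, W i x → NotShuffle n i → x = 0) (he : 2 ≤ e) (hv : W (stdSeq e) v) {r : ℕ}
    (h1 : 1 ≤ r) (hn : r < n) (hr : (r : ZMod e) ≠ 0) : P r v = 0 := by
  refine hvan _ _ (H.W_P _ _ r h1 hn hv)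
    (notShuffle_of_prefix (r := r) h1 (by omega) (fun t _ h => ?_) ?_ ?_)
  · simp (disch := omega) only [sw, if_neg]
  · simp only [sw, if_pos, stdSeq]
    have := natCast_zmod_ne (e := e) (a := r) (b := r + 1) (by omega) (by omega)
    intro h
    exact this (by simpa using h.symm)
  · simpa [sw, stdSeq] using hr

theorem stdSeq_top (hpe : (p : ZMod e) = 1) (he : e = g + 1) : stdSeq e (p + g) = -1 := by
  rw [stdSeq_add hpe, eq_neg_iff_add_eq_zero]
  subst he
  simp

theorem natCast_top (hpe : (p : ZMod e) = 1) (he : e = g + 1) : ((p + g : ℕ) : ZMod e) = 0 := by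
  have := stdSeq_top hpe he
  simpa [stdSeq, sub_eq_iff_eq_add] using this

theorem stdSeq_succ_top (hpe : (p : ZMod e) = 1) (he : e = g + 1) :
    stdSeq e (p + g + 1) = 0 := by
  have := natCast_top hpe he
  simp only [stdSeq]
  push_cast at this ⊢
  rw [this]; ring

theorem sq_top (H : KLRAction e n P Y W) (hv : IsBrickVector n P Y W v) (he3 : e ≠ 2)
    (hpe : (p : ZMod e) = 1) (hp : 1 ≤ p) (hn : p + 2 * e ≤ n + 1) (he : e = g + 1) :
    P (p + g) (P (p + g) v) = 0 := by
  rw [H.sq_sub he3 _ _ _ (by omega) (by omega) hv.weight, hv.Y_eq _ (by omega) (by omega),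
    hv.Y_eq _ (by omega) (by omega), sub_zero]
  rw [stdSeq_top hpe he, stdSeq_succ_top hpe he, zero_sub]

/-- All the dots reduce, up to sign, to the one that resolves the crossing of the two last strands;
what is left of the diagram is evaluated by `grid_eq_cross`. -/
theorem Y_halfBrick (H : KLRAction e n P Y W) (hvan : ∀ i x, W i x → NotShuffle n i → x = 0)
    (hv : IsBrickVector n P Y W v) (hpe : (p : ZMod e) = 1) (hp : 1 ≤ p)
    (hn : p + 2 * e ≤ n + 1) (he : e = g + 1) (hg : 2 ≤ g) :
    Y (p + g + 1) (halfBrick P g p v) = - P (p + g) v ∧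
      (∀ t, g + 2 ≤ t → t ≤ 2 * g + 1 → Y (p + t) (halfBrick P g p v) = P (p + g) v) ∧
      Y (p + g) (halfBrick P g p v) = P (p + g) v := by
  obtain ⟨m, rfl⟩ := Nat.exists_eq_add_of_le hg
  set g := 2 + m with hgm
  have hwU := H.W_halfBrick hv hp hn he (by omega)
  have hcross := H.grid_eq_cross m p (by omega) hp (by omega) _ v hv.weight
    (fun t _ => stdSeq_add hpe t) (fun t ht => by
      rw [show p + m + 3 + t = p + (e + t) by omega, stdSeq_add hpe, Nat.cast_add,
        ZMod.natCast_self, zero_add])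
    (fun t ht => hv.P_eq _ (by omega) (by omega) (by
      have := natCast_zmod_ne (e := e) (a := 0) (b := t + 1) (by omega) (by omega)
      push_cast at this ⊢
      rw [hpe, add_comm]
      exact this.symm))
  rw [show p + m + 2 = p + g by omega, show m + 3 = e by omega, show m + 2 = g by omega] at hcross
  obtain ⟨hl1, hl2⟩ := H.Y_block_last hv hpe hp hn he (m + 1) 1 (by omega)
  rw [show m + 1 + 1 = g by omega] at hl1 hl2
  have hU : halfBrick P g p v = moveRight P p g (moveBlock P (p + 1) g e v) := by
    rw [halfBrick, he]
  have hB := H.W_moveBlock (p := p + 1) (m := g) (l := e) (by omega) (by omega) hv.weight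
  have a1 : Y (p + g + 1) (halfBrick P g p v) = - P (p + g) v := by
    rw [hU, commute_apply (H.Y_moveRight (by omega)), show p + g + 1 = p + 1 + g by omega, hl1,
      map_neg, hcross]
  have a2 : Y (p + 2 * g + 1) (halfBrick P g p v) = P (p + g) v := by
    rw [hU, commute_apply (H.Y_moveRight (by omega)), hl2, hcross]
  -- Neighbouring dots agree: their difference is ψ_{p+t}² on the half crossing, and ψ_{p+t} leads
  -- to a weight that is not a shuffle.
  have a3 : ∀ d t, t + d = 2 * g + 1 → g + 2 ≤ t → Y (p + t) (halfBrick P g p v) = P (p + g) v := by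
    intro d
    induction d with
    | zero =>
      intro t ht _
      rw [← a2]; congr 2; omega
    | succ d ih =>
      intro t ht ht2
      rw [← ih (t + 1) (by omega) (by omega), ← sub_eq_zero, ← add_assoc,
        ← H.sq_sub (by omega) _ _ (p + t) (by omega) (by omega) hwU, hvan _ (P (p + t) _)
        (H.W_P _ _ (p + t) (by omega) (by omega) hwU), map_zero]
      · refine notShuffle_of_swapped_prefix (q := p + g) (r := p + t) (by omega) (by omega)
          (natCast_top hpe he) (by omega) (by omega) (fun s _ _ => ?_) ?_ ?_ (fun s _ _ => ?_) ?_ ?_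
        · simp (disch := omega) only [sw, if_neg]
        · simp (disch := omega) only [sw, if_neg]
          exact stdSeq_succ_top hpe he
        · simp (disch := omega) only [sw, if_neg]
          exact stdSeq_top hpe he
        · simp (disch := omega) only [sw, if_neg]
        · simp (disch := omega) only [sw, if_neg]
          rw [add_assoc, stdSeq_add hpe, stdSeq_add hpe]
          exact (natCast_zmod_ne (by omega) (by omega)).symm
        · simp (disch := omega) only [sw, if_neg]
          rw [add_assoc, stdSeq_add hpe, ← ZMod.natCast_self e]
          exact (natCast_zmod_ne (by omega) (by omega)).symm
      · simp (disch := omega) only [sw, if_neg]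
        rw [add_assoc, stdSeq_add hpe, stdSeq_add hpe]
        push_cast; ring
  -- The two strands of residue 1 cross each other. The sum of their dots slides through that
  -- crossing and down to `v`, so the two dots are opposite.
  have a4 : Y (p + 1) (halfBrick P g p v) = - P (p + g) v := by
    rw [← a3 (g - 1) (g + 2) (by omega) le_rfl, eq_neg_iff_add_eq_zero, hU]
    have hw1 : seqBlock (p + 1) g e (stdSeq e) p = (0 : ℕ) := by
      simp (disch := omega) only [seqBlock, if_pos]
      simpa using stdSeq_add hpe 0
    have hw2 : ∀ t, t < e → seqBlock (p + 1) g e (stdSeq e) (p + t + 1) = t := by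
      intro t ht
      simp (disch := omega) only [seqBlock, if_pos, if_neg]
      rw [show p + t + 1 + g = p + (e + t) by omega, stdSeq_add hpe]
      simp
    rw [H.Y_cross (t := 1) hp (by omega) hB (by omega),
      commute_apply (H.Y_moveRight (s := p + (g + 2)) (by omega)), ← map_add]
    · have h1 : moveBlock P (p + 1) g e v =
          moveRight P (p + 1) e (moveBlock P (p + 2) (m + 1) e v) := by
        rw [show g = m + 1 + 1 by omega, moveBlock_succ']; rfl
      have hB2 := H.W_moveBlock (p := p + 2) (m := m + 1) (l := e) (by omega) (by omega) hv.weight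
      have h2 := H.Y_cross_eq (t := 1) (p := p + 1) (l := e) (by omega) (by omega) hB2 (by omega) (by
        intro s hs1 hs2 hs3
        have h5 : seqBlock (p + 2) (m + 1) e (stdSeq e) (p + 1) = (1 : ℕ) := by
          simp (disch := omega) only [seqBlock, if_pos]
          exact stdSeq_add hpe 1
        have h6 : seqBlock (p + 2) (m + 1) e (stdSeq e) (p + 1 + s) = (s - 1 : ℕ) := by
          simp (disch := omega) only [seqBlock, if_pos, if_neg]
          rw [show p + 1 + s + (m + 1) = p + (e + (s - 1)) by omega, stdSeq_add hpe]
          simp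
        rw [h5, h6]
        rcases Nat.lt_or_ge s 2 with h | h
        · exact (natCast_zmod_ne (by omega) (by omega)).symm
        · exact natCast_zmod_ne (by omega) (by omega))
      rw [h1, show p + (g + 2) = p + 1 + e by omega, h2,
        H.Y_block_right hv hpe hp hn (m + 1) 2 1 (by omega) (by omega),
        H.Y_block_left hv hp hn (m + 1) 2 1 (by omega) (by omega)]
      simp
    · rw [hw1, hw2 1 (by omega)]
      exact natCast_zmod_ne (by omega) (by omega)
  have a5 : Y p (halfBrick P g p v) = - P (p + g) v := by
    rw [← a4, ← sub_eq_zero, ← H.sq_sub (by omega) _ _ p (by omega) (by omega) hwU,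
      hvan _ (P p _) (H.W_P _ _ p (by omega) (by omega) hwU), map_zero]
    · refine notShuffle_of_prefix (r := p) (by omega) (by omega) (fun s _ _ => ?_) ?_ ?_
      · simp (disch := omega) only [sw, if_neg]
      · simp (disch := omega) only [sw, if_neg]
        rw [stdSeq_add hpe]
        have h0 := stdSeq_add hpe 0
        rw [add_zero] at h0
        rw [h0]
        exact (natCast_zmod_ne (by omega) (by omega)).symm
      · simp (disch := omega) only [sw, if_neg]
        rw [stdSeq_add hpe]
        have := natCast_zmod_ne (e := e) (a := 0) (b := 1) (by omega) (by omega)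
        simpa using this.symm
    · simp (disch := omega) only [sw, if_neg]
      simp [stdSeq]
  -- The same argument as in `a4`, for the two strands of residue 0, which end at the positions p
  -- and p+g.
  have a6 : Y (p + g) (halfBrick P g p v) = P (p + g) v := by
    rw [← sub_eq_zero, sub_eq_add_neg, ← a5, add_comm, hU]
    have h2 := H.Y_cross_eq (t := 0) (p := p) (l := g) (by omega) (by omega) hB (by omega) (by
        intro s hs1 hs2 hs3
        have h5 : seqBlock (p + 1) g e (stdSeq e) p = (0 : ℕ) := by
          simp (disch := omega) only [seqBlock, if_pos]
          simpa using stdSeq_add hpe 0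
        have h6 : seqBlock (p + 1) g e (stdSeq e) (p + s) = (s - 1 : ℕ) := by
          simp (disch := omega) only [seqBlock, if_pos, if_neg]
          rw [show p + s + g = p + (e + (s - 1)) by omega, stdSeq_add hpe]
          simp
        rw [h5, h6]
        exact natCast_zmod_ne (by omega) (by omega))
    have h3 := H.Y_block_right hv hpe hp hn g 1 0 (by omega) (by omega)
    have h4 := H.Y_block_left hv hp hn g 1 0 (by omega) (by omega)
    rw [add_zero] at h2 h3 h4
    rw [h2, h3, h4]
    simp
  exact ⟨a1, fun t h1 h2 => a3 (2 * g + 1 - t) t (by omega) h1, a6⟩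

/-- ψ_{p+g} doubles the topmost crossing. This gives a difference of two dots on the half crossing,
and each of them contributes -ψ_{p+g} v. -/
theorem P_brick (H : KLRAction e n P Y W) (hvan : ∀ i x, W i x → NotShuffle n i → x = 0)
    (hv : IsBrickVector n P Y W v) (hpe : (p : ZMod e) = 1) (hp : 1 ≤ p)
    (hn : p + 2 * e ≤ n + 1) (he : e = g + 1) (hg : 2 ≤ g) :
    P (p + g) (moveBlock P p e e v) = -(2 : F) • P (p + g) v := by
  have hwU := H.W_halfBrick hv hp hn he (by omega)
  obtain ⟨h1, _, h2⟩ := H.Y_halfBrick hvan hv hpe hp hn he hg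
  rw [moveBlock_eq_halfBrick he, H.sq_add (by omega) _ _ _ (by omega) (by omega) hwU, h1, h2]
  · rw [neg_smul, two_smul]; abel
  · simp (disch := omega) only [sw, if_neg]
    simp [stdSeq_top hpe he, stdSeq_succ_top hpe he]

/-- Crossings inside bricks vanish by weight. Therefore their squares vanish, and all dots within
one brick are equal. So it suffices to treat one dot in each brick, at p+g and p+g+1; both yield
multiples of ψ_{p+g}² v = 0. -/
theorem isBrickVector_moveBlock (H : KLRAction e n P Y W)
    (hvan : ∀ i x, W i x → NotShuffle n i → x = 0)
    (hv : IsBrickVector n P Y W v) (hpe : (p : ZMod e) = 1) (hp : 1 ≤ p)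
    (hn : p + 2 * e ≤ n + 1) (he : e = g + 1) (hg : 2 ≤ g) :
    IsBrickVector n P Y W (moveBlock P p e e v) := by
  have hwU := H.W_halfBrick hv hp hn he (by omega)
  obtain ⟨h1, _, h2⟩ := H.Y_halfBrick hvan hv hpe hp hn he hg
  have hw : W (stdSeq e) (moveBlock P p e e v) := by
    have := H.W_P _ _ (p + g) (by omega) (by omega) hwU
    rwa [sw_sw, ← moveBlock_eq_halfBrick he] at this
  have hP : ∀ r, 1 ≤ r → r < n → (r : ZMod e) ≠ 0 → P r (moveBlock P p e e v) = 0 :=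
    fun r h3 h4 h5 => H.P_eq_zero_of_stdSeq hvan (by omega) hw h3 h4 h5
  have hY : ∀ r, 1 ≤ r → r < n → (r : ZMod e) ≠ 0 →
      Y r (moveBlock P p e e v) = Y (r + 1) (moveBlock P p e e v) := by
    intro r h3 h4 h5
    rw [← sub_eq_zero, ← H.sq_sub (by omega) _ _ r h3 h4 hw (by simp [stdSeq]), hP r h3 h4 h5,
      map_zero]
  have hne : sw (p + g) (stdSeq e) (p + g) ≠ sw (p + g) (stdSeq e) (p + g + 1) := by
    simp (disch := omega) only [sw, if_neg]
    rw [stdSeq_succ_top hpe he, stdSeq_add hpe]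
    have := natCast_zmod_ne (e := e) (a := 0) (b := g) (by omega) (by omega)
    simpa using this
  have y1 : Y (p + g) (moveBlock P p e e v) = 0 := by
    rw [moveBlock_eq_halfBrick he, H.Y_P _ _ _ (by omega) (by omega) hwU, if_neg hne, h1, map_neg,
      H.sq_top hv (by omega) hpe hp hn he]
    simp
  have y2 : Y (p + g + 1) (moveBlock P p e e v) = 0 := by
    rw [moveBlock_eq_halfBrick he, H.Y_succ_P _ _ _ (by omega) (by omega) hwU, if_neg hne, h2,
      H.sq_top hv (by omega) hpe hp hn he]
    simp
  have y3 : ∀ d t, t + d = g → Y (p + t) (moveBlock P p e e v) = 0 := by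
    intro d
    induction d with
    | zero => intro t ht; rw [show t = g by omega]; exact y1
    | succ d ih =>
      intro t ht
      rw [hY _ (by omega) (by omega), add_assoc, ih (t + 1) (by omega)]
      have := natCast_zmod_ne (e := e) (a := 0) (b := t + 1) (by omega) (by omega)
      push_cast at this ⊢
      rw [hpe, add_comm]
      exact this.symm
  have y4 : ∀ t, t ≤ g → Y (p + g + 1 + t) (moveBlock P p e e v) = 0 := by
    intro t
    induction t with
    | zero => intro _; exact y2
    | succ t ih =>
      intro ht
      rw [← add_assoc, ← hY _ (by omega) (by omega), ih (by omega)]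
      have := natCast_zmod_ne (e := e) (a := 0) (b := t + 1) (by omega) (by omega)
      rw [show p + g + 1 + t = (p + g) + (t + 1) by omega, Nat.cast_add, natCast_top hpe he,
        zero_add]
      simpa using this.symm
  refine ⟨hw, fun s hs1 hs2 => ?_, hP⟩
  by_cases hs : s < p ∨ p + e + e ≤ s
  · rw [commute_apply (H.Y_moveBlock hs), hv.Y_eq s hs1 hs2, map_zero]
  · rcases Nat.lt_or_ge (p + g) s with h | h
    · obtain ⟨t, rfl⟩ := Nat.exists_eq_add_of_le (Nat.succ_le_of_lt h)
      exact y4 t (by omega)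
    · obtain ⟨t, rfl⟩ := Nat.exists_eq_add_of_le (show p ≤ s by omega)
      exact y3 (g - t) t (by omega)

end KLRAction
end KLR

/-! ### Two successive brick transpositions for e ≥ 3. -/

namespace KLR
namespace KLRAction

variable {e n : ℕ} {F M : Type*} [Field F] [AddCommGroup M] [Module F M]
  {P Y : ℕ → Module.End F M} {W : (ℕ → ZMod e) → M → Prop} {v : M} {g p : ℕ}

theorem P_halfBrick (H : KLRAction e n P Y W) {r : ℕ} (h : p + 2 * g + 2 ≤ r) :
    P r (halfBrick P g p v) = halfBrick P g p (P r v) := by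
  rw [halfBrick, commute_apply (H.P_moveRight (by omega)),
    commute_apply (H.P_moveBlock (by omega))]; rfl

theorem Y_halfBrick_far (H : KLRAction e n P Y W) {r : ℕ} (h : p + 2 * g + 2 ≤ r) :
    Y r (halfBrick P g p v) = halfBrick P g p (Y r v) := by
  rw [halfBrick, commute_apply (H.Y_moveRight (by omega)),
    commute_apply (H.Y_moveBlock (by omega))]; rfl

/-- One step of pulling the crossing of two bricks through a third one. -/
theorem pull_step (H : KLRAction e n P Y W) (hv : IsBrickVector n P Y W v)
    (hpe : (p : ZMod e) = 1) (hp : 1 ≤ p) (hn : p + 3 * e ≤ n + 1) (he : e = g + 1) (hg : 2 ≤ g)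
    {s d r : ℕ} (hs : s + d + 2 = e) (hr : r = p + e + s + 1) :
    moveBlock P r (s + 1) (d + 1) (moveBlock P r (d + 1) e (halfBrick P g p v)) =
      moveBlock P (r + 1) (s + 2) d
        (moveLeft P r s (moveRight P r s (moveBlock P (r + 1) d e (halfBrick P g p v)))) := by
  have hwU := H.W_halfBrick hv hp (by omega) he (by omega)
  have hwu := H.W_moveBlock (p := r + 1) (m := d) (l := e) (by omega) (by omega) hwU
  have hwx := H.W_moveRight (p := r) (l := s) (by omega) (by omega) hwu
  have hU0 : P (r + 1 + d + s) (halfBrick P g p v) = 0 := by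
    rw [H.P_halfBrick (by omega), hv.P_eq _ (by omega) (by omega)]
    · simp [halfBrick]
    · rw [show r + 1 + d + s = (p + g) + (e + (s + 1)) by omega, Nat.cast_add, natCast_top hpe he,
        zero_add, Nat.cast_add, ZMod.natCast_self, zero_add]
      have := natCast_zmod_ne (e := e) (a := 0) (b := s + 1) (by omega) (by omega)
      simpa using this.symm
  have hu0 : P (r + 1 + s) (moveBlock P (r + 1) d e (halfBrick P g p v)) = 0 := by
    rw [H.P_cross_block (by omega) (by omega) hwU (by omega), hU0, map_zero]
    intro c hc
    simp (disch := omega) only [sw, if_neg]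
    rw [show r + 1 + c = p + (e + (s + 2 + c)) by omega, stdSeq_add hpe,
      show r + 1 + d + s + 1 = p + (e + (e + (s + 1))) by omega, stdSeq_add hpe]
    push_cast [ZMod.natCast_self]
    have := natCast_zmod_ne (e := e) (a := s + 1) (b := s + 2 + c) (by omega) (by omega)
    push_cast at this
    simpa using this.symm
  set u := moveBlock P (r + 1) d e (halfBrick P g p v) with hu
  have hval : ∀ t, t < e → seqBlock (r + 1) d e (sw (p + g) (stdSeq e)) (r + 1 + t) = t := by
    intro t ht
    simp (disch := omega) only [seqBlock, sw, if_pos, if_neg]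
    rw [show r + 1 + t + d = p + (e + (e + t)) by omega, stdSeq_add hpe]
    push_cast [ZMod.natCast_self]
    simp
  have hval0 : seqBlock (r + 1) d e (sw (p + g) (stdSeq e)) r = (s + 1 : ℕ) := by
    simp (disch := omega) only [seqBlock, sw, if_pos, if_neg]
    rw [hr, show p + e + s + 1 = p + (e + (s + 1)) by omega, stdSeq_add hpe]
    push_cast [ZMod.natCast_self]
    simp
  -- The three strands are the moving one, of residue s+1, and the strands s, s+1 of the third
  -- brick. The crossing of the latter two kills the vector (`hu0`), so only the correction term 1
  -- survives.
  have hbraid := H.braid_add (by omega) _ _ (r + s) (by omega) (by omega) hwx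
    (by
      simp (disch := omega) only [seqRight, if_neg]
      rw [hval0, show r + s + 2 = r + 1 + (s + 1) by omega, hval _ (by omega)]
      simp)
    (by
      simp (disch := omega) only [seqRight, if_neg]
      rw [hval0, show r + s + 1 = r + 1 + s by omega, hval _ (by omega)]
      simp)
  rw [commute_apply (H.P_moveRight (r := r + s + 1) (by omega)),
    show r + s + 1 = r + 1 + s by omega, hu0, map_zero, map_zero, map_zero, zero_add] at hbraid
  have h1 : ∀ w, moveRight P r e w =
      moveRight P (r + s + 2) d (P (r + s + 1) (P (r + s) (moveRight P r s w))) := by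
    intro w
    rw [show e = s + 2 + d by omega, moveRight_add, moveRight_succ, moveRight_succ]; rfl
  rw [moveBlock_succ' P r d, Module.End.mul_apply, ← hu, h1,
    moveBlock_succ P r s, Module.End.mul_apply, moveRight_succ' P (r + s) d, Module.End.mul_apply,
    commute_apply (H.P_moveRight (by omega)), show r + s + 1 = r + 1 + s by omega, hbraid,
    moveBlock_succ_eq_mul_moveLeft H.P_comm, Module.End.mul_apply]
  have hc : ∀ q, r + s + 1 ≤ q → Commute (moveLeft P r s) (moveRight P q d) := fun q hq =>
    commute_moveRight fun t _ _ => (H.P_moveLeft (by omega)).symm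
  rw [commute_apply (hc (r + 1 + s) (by omega)), commute_apply (hc (r + s + 2) (by omega)),
    moveBlock_succ P (r + 1) (s + 1), Module.End.mul_apply, moveBlock_succ P (r + 1) s,
    Module.End.mul_apply, show r + 1 + (s + 1) = r + s + 2 by omega]

/-- `pull_step` turns the leftmost moving strand into a detour that passes s strands and returns.
Unless d = 0 the residues are far apart, the detour straightens, and the next strand is treated. For
d = 0 the strand has residue e-1 and its double crossing with residue 0 is a difference of dots: the
one on the third brick dies, the other is given by `Y_halfBrick`. -/
theorem pull_last (H : KLRAction e n P Y W) (hvan : ∀ i x, W i x → NotShuffle n i → x = 0)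
    (hv : IsBrickVector n P Y W v)
    (hpe : (p : ZMod e) = 1) (hp : 1 ≤ p) (hn : p + 3 * e ≤ n + 1) (he : e = g + 1) (hg : 2 ≤ g)
    (d : ℕ) : ∀ s r, s + d + 2 = e → r = p + e + s + 1 →
    moveBlock P r (s + 1) (d + 1) (moveBlock P r (d + 1) e (halfBrick P g p v)) =
      P (p + g) v := by
  have hwU := H.W_halfBrick hv hp (by omega) he (by omega)
  induction d with
  | zero =>
    intro s r hs hr
    rw [H.pull_step (d := 0) hv hpe hp hn he hg hs hr, moveBlock_right_zero, moveBlock_zero,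
      Module.End.one_apply, Module.End.one_apply]
    obtain ⟨s, rfl⟩ := Nat.exists_eq_add_of_le (show 1 ≤ s by omega)
    have hwP := H.W_P _ _ r (by omega) (by omega) hwU
    have hr1 : stdSeq e r = (g : ℕ) := by
      rw [hr, show p + e + (1 + s) + 1 = p + (e + g) by omega, stdSeq_add hpe]
      simp
    have hr2 : ∀ t, stdSeq e (r + 1 + t) = t := by
      intro t
      rw [hr, show p + e + (1 + s) + 1 + 1 + t = p + (e + (e + t)) by omega, stdSeq_add hpe]
      push_cast [ZMod.natCast_self]
      simp
    rw [add_comm 1 s, moveLeft_succ', moveRight_succ', Module.End.mul_apply, Module.End.mul_apply,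
      H.moveLeft_moveRight (by omega) (by omega) hwP, H.sq_sub (by omega) _ _ _ (by omega) (by omega)
        hwU, H.Y_halfBrick_far (r := r + 1) (by omega), hv.Y_eq _ (by omega) (by omega), hr]
    · have := (H.Y_halfBrick hvan hv hpe hp (by omega) he hg).2.1 (2 * g + 1) (by omega) le_rfl
      rw [show p + e + (1 + s) + 1 = p + (2 * g + 1) by omega, this]
      simp [halfBrick]
    · simp (disch := omega) only [sw, if_neg]
      have := hr2 0
      rw [add_zero] at this
      rw [hr1, this]
      have := ZMod.natCast_self e
      rw [eq_sub_iff_add_eq]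
      simpa [he] using this
    · intro t ht1 ht2
      simp (disch := omega) only [sw, if_pos, if_neg]
      rw [hr1, hr2]
      exact natCast_far (by omega) (by omega)
  | succ d ih =>
    intro s r hs hr
    have hwu := H.W_moveBlock (p := r + 1) (m := d + 1) (l := e) (by omega) (by omega) hwU
    rw [H.pull_step hv hpe hp hn he hg (by omega) hr, H.moveLeft_moveRight (by omega) (by omega) hwu,
      ih (s + 1) (r + 1) (by omega) (by omega)]
    intro t ht1 ht2
    obtain ⟨t, rfl⟩ := Nat.exists_eq_add_of_le ht1
    simp (disch := omega) only [seqBlock, sw, if_pos, if_neg]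
    rw [show r + (1 + t) + (d + 1) = p + (e + (e + t)) by omega, stdSeq_add hpe,
      show r = p + (e + (s + 1)) by omega, stdSeq_add hpe]
    have := natCast_far (e := e) (a := t) (b := s + 1) (by omega) (by omega)
    push_cast [ZMod.natCast_self] at this ⊢
    simpa using this

/-- Up to commuting factors, ψ_{p+g} meets the lowest remaining crossing of the second transposition
and the topmost one of the first in a braid of residues 0, -1, 0. Its other cubic term contains a
vector of weight …, 0, 0, …, which is not a shuffle. The correction term is evaluated by
`pull_last`. -/
theorem P_brick_brick (H : KLRAction e n P Y W)
    (hvan : ∀ i x, W i x → NotShuffle n i → x = 0) (hv : IsBrickVector n P Y W v)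
    (hpe : (p : ZMod e) = 1) (hp : 1 ≤ p) (hn : p + 3 * e ≤ n + 1) (he : e = g + 1)
    (hg : 2 ≤ g) :
    P (p + g) (moveBlock P (p + e) e e (moveBlock P p e e v)) = P (p + g) v := by
  have hwU := H.W_halfBrick hv hp (by omega) he (by omega)
  have hwC := H.W_moveBlock (p := p + e + 1) (m := g) (l := e) (by omega) (by omega) hwU
  have h1 : moveBlock P (p + e) e e = moveRight P (p + e) e * moveBlock P (p + e + 1) g e := by
    conv_lhs => rw [show moveBlock P (p + e) e e = moveBlock P (p + e) (g + 1) e by rw [← he]]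
    rw [moveBlock_succ']
  have h2 : moveRight P (p + e) e = moveRight P (p + e + 1) g * P (p + e) := by
    conv_lhs => rw [show moveRight P (p + e) e = moveRight P (p + e) (g + 1) by rw [← he]]
    rw [moveRight_succ']
  rw [moveBlock_eq_halfBrick (p := p) he, h1, h2, Module.End.mul_apply, Module.End.mul_apply,
    commute_apply (H.P_moveRight (p := p + e + 1) (by omega)),
    ← commute_apply (H.P_moveBlock (r := p + g) (p := p + e + 1) (by omega)),
    show p + e = p + g + 1 by omega]
  have hv1 : ∀ t, t < e → seqBlock (p + e + 1) g e (sw (p + g) (stdSeq e)) (p + e + 1 + t) = t := by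
    intro t ht
    simp (disch := omega) only [seqBlock, sw, if_pos, if_neg]
    rw [show p + e + 1 + t + g = p + (e + (e + t)) by omega, stdSeq_add hpe]
    push_cast [ZMod.natCast_self]
    simp
  have hv2 : seqBlock (p + e + 1) g e (sw (p + g) (stdSeq e)) (p + g) = 0 := by
    simp (disch := omega) only [seqBlock, sw, if_pos]
    simp [stdSeq_succ_top hpe he]
  have hv3 : seqBlock (p + e + 1) g e (sw (p + g) (stdSeq e)) (p + g + 1) = -1 := by
    simp (disch := omega) only [seqBlock, sw, if_pos, if_neg]
    simp [stdSeq_top hpe he]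
  have hv4 : seqBlock (p + e + 1) g e (sw (p + g) (stdSeq e)) (p + g + 2) = 0 := by
    have := hv1 0 (by omega)
    rw [show p + g + 2 = p + e + 1 + 0 by omega, this, Nat.cast_zero]
  rw [show p + e + 1 = p + g + 1 + 1 by omega] at hwC hv2 hv3 hv4
  rw [H.braid_add (by omega) _ _ _ (by omega) (by omega) hwC (by rw [hv2, hv4])
    (by rw [hv2, hv3, neg_add_cancel])]
  have hz : P (p + g + 1) (moveBlock P (p + g + 1 + 1) g e (halfBrick P g p v)) = 0 := by
    refine hvan _ _ (H.W_P _ _ _ (by omega) (by omega) hwC)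
      (notShuffle_of_zero_zero (q := p + g) (by omega) (by omega) (natCast_top hpe he) (by omega)
        (fun t ht1 ht2 => ?_) ?_ ?_)
    · simp (disch := omega) only [seqBlock, sw, if_pos, if_neg]
    · rw [← hv2]
      simp (disch := omega) only [sw, if_neg]
    · rw [← hv4]
      simp only [sw, if_pos]
  rw [hz, map_zero, map_zero, zero_add]
  obtain ⟨d, rfl⟩ := Nat.exists_eq_add_of_le (show 1 ≤ g by omega)
  have h3 := H.pull_last hvan hv hpe hp hn he hg d 0 (p + (1 + d) + 1 + 1) (by omega) (by omega)
  rwa [moveBlock_succ, moveBlock_zero, one_mul, add_comm d 1] at h3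

end KLRAction
end KLR

/-! ### The case e = 2. -/

namespace KLR
namespace KLRAction

variable {n : ℕ} {F M : Type*} [Field F] [AddCommGroup M] [Module F M]
  {P Y : ℕ → Module.End F M}

section Two

variable {W : (ℕ → ZMod 2) → M → Prop} {v : M} {p : ℕ}

/-- The action of the dots on the partial crossings of two bricks of length two. -/
theorem Y_two (H : KLRAction 2 n P Y W) (hv : IsBrickVector n P Y W v)
    (hpe : (p : ZMod 2) = 1) (hp : 1 ≤ p) (hn : p + 3 ≤ n) :
    (∀ s, 1 ≤ s → s ≤ n → Y s (P (p + 1) v) = 0) ∧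
    (∀ s, 1 ≤ s → s ≤ n → Y s (P p (P (p + 1) v)) =
      (if s = p + 1 then P (p + 1) v else 0) - if s = p then P (p + 1) v else 0) ∧
    (∀ s, 1 ≤ s → s ≤ n → Y s (P (p + 2) (P (p + 1) v)) =
      (if s = p + 3 then P (p + 1) v else 0) - if s = p + 2 then P (p + 1) v else 0) ∧
    (∀ s, 1 ≤ s → s ≤ n → Y s (P p (P (p + 2) (P (p + 1) v))) =
      (if s = p + 1 then P (p + 2) (P (p + 1) v) else 0)
        - (if s = p then P (p + 2) (P (p + 1) v) else 0)
        + (if s = p + 3 then P p (P (p + 1) v) else 0)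
        - (if s = p + 2 then P p (P (p + 1) v) else 0)) := by
  have s0 : stdSeq 2 p = 0 := by simpa using stdSeq_add hpe 0
  have s1 : stdSeq 2 (p + 1) = 1 := by simpa using stdSeq_add hpe 1
  have s2 : stdSeq 2 (p + 2) = 0 := (stdSeq_add hpe 2).trans (by decide)
  have s3 : stdSeq 2 (p + 3) = 1 := (stdSeq_add hpe 3).trans (by decide)
  have hwx := H.W_P _ _ (p + 1) (by omega) (by omega) hv.weight
  have hwa := H.W_P _ _ p (by omega) (by omega) hwx
  have hwb := H.W_P _ _ (p + 2) (by omega) (by omega) hwx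
  have hx : ∀ s, 1 ≤ s → s ≤ n → Y s (P (p + 1) v) = 0 := by
    intro s h1 h2
    by_cases e1 : s = p + 1
    · subst e1
      rw [H.Y_P _ _ _ (by omega) (by omega) hv.weight, hv.Y_eq _ (by omega) (by omega), if_neg]
      · simp
      · rw [s1, s2]; decide
    by_cases e2 : s = p + 2
    · subst e2
      rw [H.Y_succ_P _ _ _ (by omega) (by omega) hv.weight, hv.Y_eq _ (by omega) (by omega), if_neg]
      · simp
      · rw [s1, s2]; decide
    · rw [commute_apply (H.Y_P_comm _ _ e1 (by omega)), hv.Y_eq s h1 h2, map_zero]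
  have ha : ∀ s, 1 ≤ s → s ≤ n → Y s (P p (P (p + 1) v)) =
      (if s = p + 1 then P (p + 1) v else 0) - if s = p then P (p + 1) v else 0 := by
    intro s h1 h2
    by_cases e1 : s = p
    · subst e1
      rw [H.Y_P _ _ _ (by omega) (by omega) hwx, hx _ (by omega) (by omega)]
      simp [sw, add_assoc, s0, s2]
    by_cases e2 : s = p + 1
    · subst e2
      rw [H.Y_succ_P _ _ _ (by omega) (by omega) hwx, hx _ (by omega) (by omega)]
      simp [sw, add_assoc, s0, s2]
    · rw [commute_apply (H.Y_P_comm _ _ e1 e2), hx s h1 h2]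
      simp [e1, e2]
  have hb : ∀ s, 1 ≤ s → s ≤ n → Y s (P (p + 2) (P (p + 1) v)) =
      (if s = p + 3 then P (p + 1) v else 0) - if s = p + 2 then P (p + 1) v else 0 := by
    intro s h1 h2
    by_cases e1 : s = p + 2
    · subst e1
      rw [H.Y_P _ _ _ (by omega) (by omega) hwx, hx _ (by omega) (by omega)]
      simp [sw, add_assoc, s1, s3]
    by_cases e2 : s = p + 3
    · subst e2
      rw [H.Y_succ_P _ _ _ (by omega) (by omega) hwx, hx _ (by omega) (by omega)]
      simp [sw, add_assoc, s1, s3]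
    · rw [commute_apply (H.Y_P_comm _ _ e1 e2), hx s h1 h2]
      simp [e1, e2]
  refine ⟨hx, ha, hb, fun s h1 h2 => ?_⟩
  by_cases e1 : s = p
  · subst e1
    rw [H.Y_P _ _ _ (by omega) (by omega) hwb, hb _ (by omega) (by omega)]
    simp [sw, add_assoc, s0, s2]
  by_cases e2 : s = p + 1
  · subst e2
    rw [H.Y_succ_P _ _ _ (by omega) (by omega) hwb, hb _ (by omega) (by omega)]
    simp [sw, add_assoc, s0, s2]
  rw [commute_apply (H.P_comm p (p + 2) (by omega))]
  by_cases e3 : s = p + 2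
  · subst e3
    rw [H.Y_P _ _ _ (by omega) (by omega) hwa, ha _ (by omega) (by omega)]
    simp [sw, add_assoc, s1, s3]
  by_cases e4 : s = p + 3
  · subst e4
    rw [H.Y_succ_P _ _ _ (by omega) (by omega) hwa, ha _ (by omega) (by omega)]
    simp [sw, add_assoc, s1, s3]
  rw [commute_apply (H.Y_P_comm _ _ e3 e4), ha s h1 h2]
  simp [e1, e2, e3, e4]

theorem moveBlock_two (p : ℕ) (v : M) :
    moveBlock P p 2 2 v = P (p + 1) (P p (P (p + 2) (P (p + 1) v))) := by
  simp [moveBlock, moveRight, add_assoc]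

/-- The double crossing is now a product of two differences of dots. One resolves the crossing at p,
the other the crossing at p+2, in either order, whence the factor 2. -/
theorem P_brick_two (H : KLRAction 2 n P Y W) (hv : IsBrickVector n P Y W v)
    (hpe : (p : ZMod 2) = 1) (hp : 1 ≤ p) (hn : p + 3 ≤ n) :
    P (p + 1) (moveBlock P p 2 2 v) = -(2 : F) • P (p + 1) v := by
  obtain ⟨_, ha, hb, hU⟩ := H.Y_two hv hpe hp hn
  have hwU := H.W_P _ _ p (by omega) (by omega) (H.W_P _ _ (p + 2) (by omega) (by omega)
    (H.W_P _ _ (p + 1) (by omega) (by omega) hv.weight))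
  have s0 : stdSeq 2 p = 0 := by simpa using stdSeq_add hpe 0
  have s3 : stdSeq 2 (p + 3) = 1 := (stdSeq_add hpe 3).trans (by decide)
  rw [moveBlock_two, H.sq_two rfl _ _ (p + 1) (by omega) (by omega) hwU
    (by simp [sw, add_assoc, s0, s3]), show p + 1 + 1 = p + 2 by omega, hU _ (by omega) (by omega),
    hU _ (by omega) (by omega)]
  simp only [map_sub, map_add, show p + 1 ≠ p + 2 by omega, show p + 2 ≠ p + 1 by omega,
    show p + 1 ≠ p by omega, show p + 2 ≠ p by omega, show p + 1 ≠ p + 3 by omega,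
    show p + 2 ≠ p + 3 by omega, if_true, if_false, map_zero, ha (p + 1) (by omega) (by omega),
    ha (p + 2) (by omega) (by omega), hb (p + 1) (by omega) (by omega),
    hb (p + 2) (by omega) (by omega), neg_smul, two_smul]
  abel

/-- Here ψ² is quadratic in the dots and does not show that dots within a brick agree. Instead every
dot reduces to ψ_{p+1}ψ_pψ_{p+1}v or ψ_{p+1}ψ_{p+2}ψ_{p+1}v, and both vanish by braid relations on
`v`. -/
theorem isBrickVector_moveBlock_two (H : KLRAction 2 n P Y W)
    (hvan : ∀ i x, W i x → NotShuffle n i → x = 0) (hv : IsBrickVector n P Y W v)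
    (hpe : (p : ZMod 2) = 1) (hp : 1 ≤ p) (hn : p + 3 ≤ n) :
    IsBrickVector n P Y W (moveBlock P p 2 2 v) := by
  obtain ⟨_, _, _, hU⟩ := H.Y_two hv hpe hp hn
  have hwU := H.W_P _ _ p (by omega) (by omega) (H.W_P _ _ (p + 2) (by omega) (by omega)
    (H.W_P _ _ (p + 1) (by omega) (by omega) hv.weight))
  have s0 : stdSeq 2 p = 0 := by simpa using stdSeq_add hpe 0
  have s1 : stdSeq 2 (p + 1) = 1 := by simpa using stdSeq_add hpe 1
  have s2 : stdSeq 2 (p + 2) = 0 := (stdSeq_add hpe 2).trans (by decide)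
  have s3 : stdSeq 2 (p + 3) = 1 := (stdSeq_add hpe 3).trans (by decide)
  have hw : W (stdSeq 2) (moveBlock P p 2 2 v) := by
    rw [moveBlock_two]
    refine H.W_congr _ _ _ (fun t _ _ => ?_) (H.W_P _ _ (p + 1) (by omega) (by omega) hwU)
    simp only [sw]
    split_ifs <;> first | rfl | omega | (subst_vars; simp [add_assoc, s0, s1, s2, s3])
  have hP : ∀ t, (t = 0 ∨ t = 2) → P (p + t) v = 0 := fun t ht =>
    hv.P_eq _ (by omega) (by omega) (by
      rcases ht with rfl | rfl <;> push_cast <;> rw [hpe] <;> decide)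
  have hP0 : P p v = 0 := hP 0 (Or.inl rfl)
  have ha0 : P (p + 1) (P p (P (p + 1) v)) = 0 := by
    have := H.braid_two rfl _ _ p (by omega) (by omega) hv.weight (by rw [s0, s2])
      (by rw [s0, s1]; decide)
    rw [hP0, hv.Y_eq _ (by omega) (by omega), hv.Y_eq _ (by omega) (by omega),
      hv.Y_eq _ (by omega) (by omega)] at this
    simpa using this.symm
  have hb0 : P (p + 1) (P (p + 2) (P (p + 1) v)) = 0 := by
    have := H.braid_two rfl _ _ (p + 1) (by omega) (by omega) hv.weight (by rw [s1, s3])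
      (by rw [s1, s2]; decide)
    rw [show p + 1 + 1 = p + 2 by omega, hP 2 (Or.inr rfl), hv.Y_eq _ (by omega) (by omega),
      hv.Y_eq _ (by omega) (by omega), hv.Y_eq _ (by omega) (by omega)] at this
    simpa using this
  refine ⟨hw, fun s hs1 hs2 => ?_, fun r h3 h4 h5 =>
    H.P_eq_zero_of_stdSeq hvan le_rfl hw h3 h4 h5⟩
  rw [moveBlock_two]
  have hne : sw p (sw (p + 2) (sw (p + 1) (stdSeq 2))) (p + 1) ≠
      sw p (sw (p + 2) (sw (p + 1) (stdSeq 2))) (p + 1 + 1) := by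
    simp [sw, add_assoc, s0, s3]
  by_cases e1 : s = p + 1
  · subst e1
    rw [H.Y_P _ _ _ (by omega) (by omega) hwU, if_neg hne, show p + 1 + 1 = p + 2 by omega,
      hU _ (by omega) (by omega)]
    simp [ha0]
  by_cases e2 : s = p + 2
  · subst e2
    rw [H.Y_succ_P _ _ (p + 1) (by omega) (by omega) hwU, if_neg hne, hU _ (by omega) (by omega)]
    simp [hb0]
  rw [commute_apply (H.Y_P_comm _ _ e1 e2), hU s hs1 hs2]
  split_ifs <;> simp [ha0, hb0]

theorem W_two (H : KLRAction 2 n P Y W) (hv : W (stdSeq 2) v) (hpe : (p : ZMod 2) = 1)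
    (hp : 1 ≤ p) (hn : p + 3 ≤ n) :
    ∃ i, W i (P p (P (p + 2) (P (p + 1) v))) ∧ (∀ t < p, i t = stdSeq 2 t) ∧ i p = 0 ∧
      i (p + 1) = 0 ∧ i (p + 2) = 1 ∧ i (p + 3) = 1 ∧ i (p + 4) = 0 := by
  have s0 : stdSeq 2 p = 0 := by simpa using stdSeq_add hpe 0
  have s1 : stdSeq 2 (p + 1) = 1 := by simpa using stdSeq_add hpe 1
  have s2 : stdSeq 2 (p + 2) = 0 := (stdSeq_add hpe 2).trans (by decide)
  have s3 : stdSeq 2 (p + 3) = 1 := (stdSeq_add hpe 3).trans (by decide)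
  have s4 : stdSeq 2 (p + 4) = 0 := (stdSeq_add hpe 4).trans (by decide)
  refine ⟨_, H.W_P _ _ p (by omega) (by omega) (H.W_P _ _ (p + 2) (by omega) (by omega)
    (H.W_P _ _ (p + 1) (by omega) (by omega) hv)), fun t ht => ?_, ?_⟩
  · simp (disch := omega) only [sw, if_neg]
  · simp [sw, add_assoc, s0, s1, s2, s3, s4]

theorem P_two_eq_zero (H : KLRAction 2 n P Y W)
    (hvan : ∀ i x, W i x → NotShuffle n i → x = 0) {i : ℕ → ZMod 2} (hv : W i v)
    (hpe : (p : ZMod 2) = 1) (hp : 1 ≤ p) (hn : p + 5 ≤ n) (h0 : ∀ t < p, i t = stdSeq 2 t)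
    (h1 : i p = 0) (h2 : i (p + 1) = 0) (h3 : i (p + 4) = 0) :
    P (p + 2) (P (p + 4) (P (p + 3) v)) = 0 := by
  have s0 : stdSeq 2 p = 0 := by simpa using stdSeq_add hpe 0
  refine hvan _ _ (H.W_P _ _ (p + 2) (by omega) (by omega) (H.W_P _ _ (p + 4) (by omega) (by omega)
    (H.W_P _ _ (p + 3) (by omega) (by omega) hv)))
    (notShuffle_of_zero_zero (q := p + 1) le_rfl (by omega) (by push_cast; rw [hpe]; decide)
      (by omega) (fun t ht1 ht2 => ?_) ?_ ?_)
  · rcases Nat.lt_or_ge t p with h | h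
    · simp (disch := omega) only [sw, if_neg, h0 t h]
    · obtain rfl : t = p := by omega
      simp [sw, add_assoc, s0, h1]
  · simp [sw, add_assoc, h2]
  · simp [sw, add_assoc, h3]

/-- The braid relation at p+1 leaves dots on U = ψ_pψ_{p+2}ψ_{p+1}v. They produce terms in a =
ψ_pψ_{p+1}v and b = ψ_{p+2}ψ_{p+1}v. The braid relation at p+3 then kills the terms in a and turns
the one in b into ψ_{p+1}v. -/
theorem P_brick_brick_two (H : KLRAction 2 n P Y W)
    (hvan : ∀ i x, W i x → NotShuffle n i → x = 0) (hv : IsBrickVector n P Y W v)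
    (hpe : (p : ZMod 2) = 1) (hp : 1 ≤ p) (hn : p + 5 ≤ n) :
    P (p + 1) (moveBlock P (p + 2) 2 2 (moveBlock P p 2 2 v)) = P (p + 1) v := by
  obtain ⟨_, ha, hb, hU⟩ := H.Y_two hv hpe hp (by omega)
  have hwx := H.W_P _ _ (p + 1) (by omega) (by omega) hv.weight
  have hwa := H.W_P _ _ p (by omega) (by omega) hwx
  have hwb := H.W_P _ _ (p + 2) (by omega) (by omega) hwx
  obtain ⟨i, hwU, i0, ip, ip1, ip2, ip3, ip4⟩ := H.W_two hv.weight hpe hp (by omega)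
  have hwC := H.W_P _ _ (p + 4) (by omega) (by omega) (H.W_P _ _ (p + 3) (by omega) (by omega) hwU)
  have hz := H.P_two_eq_zero hvan hwU hpe hp hn i0 ip ip1 ip4
  have s1 : stdSeq 2 (p + 1) = 1 := by simpa using stdSeq_add hpe 1
  have s3 : stdSeq 2 (p + 3) = 1 := (stdSeq_add hpe 3).trans (by decide)
  have s4 : stdSeq 2 (p + 4) = 0 := (stdSeq_add hpe 4).trans (by decide)
  have s5 : stdSeq 2 (p + 5) = 1 := (stdSeq_add hpe 5).trans (by decide)
  have hP4 : P (p + 4) v = 0 := hv.P_eq _ (by omega) (by omega) (by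
    push_cast; rw [hpe]; decide)
  set a := P p (P (p + 1) v) with had
  set b := P (p + 2) (P (p + 1) v) with hbd
  set U := P p b with hUd
  have hPa : P (p + 4) a = 0 := by
    rw [had, commute_apply (H.P_comm' (p + 4) p (by omega)),
      commute_apply (H.P_comm' (p + 4) (p + 1) (by omega)), hP4, map_zero, map_zero]
  have hPb : P (p + 4) b = 0 := by
    rw [hbd, commute_apply (H.P_comm' (p + 4) (p + 2) (by omega)),
      commute_apply (H.P_comm' (p + 4) (p + 1) (by omega)), hP4, map_zero, map_zero]
  have hba := H.braid_two rfl _ _ (p + 3) (by omega) (by omega) hwa (by simp [sw, add_assoc, s3, s5])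
    (by simp [sw, add_assoc, s3, s4])
  have hbb := H.braid_two rfl _ _ (p + 3) (by omega) (by omega) hwb (by simp [sw, add_assoc, s1, s5])
    (by simp [sw, add_assoc, s1, s4])
  have hbC := H.braid_two rfl _ _ (p + 1) (by omega) (by omega) hwC
    (by simp [sw, add_assoc, ip1, ip4]) (by simp [sw, add_assoc, ip1, ip2])
  simp only [show p + 3 + 1 = p + 4 by omega, show p + 3 + 2 = p + 5 by omega,
    show p + 1 + 1 = p + 2 by omega, show p + 1 + 2 = p + 3 by omega] at hba hbb hbC
  rw [hPa, ha _ (by omega) (by omega), ha _ (by omega) (by omega), ha _ (by omega) (by omega)] at hba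
  rw [hPb, hb _ (by omega) (by omega), hb _ (by omega) (by omega), hb _ (by omega) (by omega)] at hbb
  simp at hba hbb
  have h1 : Y (p + 1) (P (p + 4) (P (p + 3) U)) = P (p + 4) (P (p + 3) b) := by
    rw [commute_apply (H.Y_P_comm _ _ (by omega) (by omega)),
      commute_apply (H.Y_P_comm _ _ (by omega) (by omega)), hU _ (by omega) (by omega)]
    simp
  have h2 : Y (p + 2) (P (p + 4) (P (p + 3) U)) = - P (p + 4) (P (p + 3) a) := by
    rw [commute_apply (H.Y_P_comm _ _ (by omega) (by omega)),
      commute_apply (H.Y_P_comm _ _ (by omega) (by omega)), hU _ (by omega) (by omega)]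
    simp
  have h3 : Y (p + 3) (P (p + 4) (P (p + 3) U)) = 0 := by
    rw [commute_apply (H.Y_P_comm _ _ (by omega) (by omega)),
      H.Y_P _ _ _ (by omega) (by omega) hwU, if_neg (by simp [ip3, add_assoc, ip4]),
      hU _ (by omega) (by omega)]
    simp [add_assoc]
  rw [hz, h1, h2, h3] at hbC
  rw [moveBlock_two, moveBlock_two, ← hbd, ← hUd]
  simp only [show p + 2 + 1 = p + 3 by omega, show p + 2 + 2 = p + 4 by omega]
  rw [commute_apply (H.P_comm' (p + 3) (p + 1) (by omega)),
    commute_apply (H.P_comm' (p + 4) (p + 1) (by omega)),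
    commute_apply (H.P_comm' (p + 1) (p + 3) (by omega)), hbC]
  simp [hba, hbb]

end Two

end KLRAction
end KLR

/-! ### A spanning set indexed by shuffles. -/

namespace KLR

/-- The vectors obtained from `z` by crossing, one pair at a time, a strand of the first string
(`false`) with a strand of the second string (`true`) on its right. -/
inductive Reach (n : ℕ) {F M : Type*} [Field F] [AddCommGroup M] [Module F M]
    (P : ℕ → Module.End F M) (T₀ : ℕ → Bool) (z : M) : ℕ → (ℕ → Bool) → M → Prop
  | base : Reach n P T₀ z 0 T₀ z
  | step (l : ℕ) (T : ℕ → Bool) (x : M) (r : ℕ) (h1 : 1 ≤ r) (hn : r < n) (hr : T r = false)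
      (hr' : T (r + 1) = true) (hx : Reach n P T₀ z l T x) :
      Reach n P T₀ z (l + 1) (sw r T) (P r x)

theorem shuffleSeq_sw {e : ℕ} {T : ℕ → Bool} {r : ℕ} (h1 : 1 ≤ r) (hr : T r = false)
    (hr' : T (r + 1) = true) : ∀ t, 1 ≤ t → shuffleSeq e (sw r T) t = sw r (shuffleSeq e T) t := by
  have hlt : ∀ b t, t ≤ r → letterCount e (sw r T) b t = letterCount e T b t := by
    intro b t ht
    refine Finset.sum_congr rfl fun s hs => ?_
    rw [Finset.mem_Ico] at hs
    simp (disch := omega) only [sw, if_neg]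
  have hgt : ∀ b d, letterCount e (sw r T) b (r + 2 + d) = letterCount e T b (r + 2 + d) := by
    intro b d
    induction d with
    | zero =>
      rw [add_zero, letterCount_succ _ _ (by omega : 1 ≤ r + 1), letterCount_succ _ _ h1,
        letterCount_succ _ _ (by omega : 1 ≤ r + 1), letterCount_succ _ _ h1, hlt b r le_rfl]
      simp only [sw, if_true, Nat.succ_ne_self, if_false, add_assoc]
      rw [add_comm (if T (r + 1) = b then _ else _)]
    | succ d ih =>
      rw [← add_assoc, letterCount_succ _ _ (by omega), letterCount_succ _ _ (by omega), ih]
      simp (disch := omega) only [sw, if_neg]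
  intro t ht
  simp only [shuffleSeq]
  rcases lt_trichotomy t r with h | rfl | h
  · rw [show sw r T t = T t by simp (disch := omega) only [sw, if_neg], hlt _ _ h.le]
    simp (disch := omega) only [sw, if_neg, shuffleSeq]
  · simp only [sw, if_true, shuffleSeq]
    rw [hr', letterCount_succ _ _ h1, hr]
    simpa using hlt true t le_rfl
  · obtain rfl | h := Nat.eq_or_lt_of_le (Nat.succ_le_of_lt h)
    · simp only [sw, if_true, Nat.succ_eq_add_one, Nat.succ_ne_self, if_false, shuffleSeq]
      have := hlt false r le_rfl
      rw [hr, letterCount_succ _ _ h1, this]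
      simp [sw, hr']
    · obtain ⟨d, rfl⟩ := Nat.exists_eq_add_of_le (Nat.succ_le_of_lt h)
      have h3 : r.succ.succ + d = r + 2 + d := by omega
      rw [h3, hgt]
      simp (disch := omega) only [sw, if_neg, shuffleSeq]

section

variable {e n : ℕ} {F M : Type*} [Field F] [AddCommGroup M] [Module F M]
  {P Y : ℕ → Module.End F M} {W : (ℕ → ZMod e) → M → Prop} {T₀ : ℕ → Bool} {z : M}

/-- The span of the vectors reached in at most `l` steps. -/
def reachSpan (n : ℕ) (P : ℕ → Module.End F M) (T₀ : ℕ → Bool) (z : M) (l : ℕ) : Submodule F M :=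
  Submodule.span F {x | ∃ l' ≤ l, ∃ T, Reach n P T₀ z l' T x}

theorem reachSpan_mono {l l' : ℕ} (h : l ≤ l') :
    reachSpan n P T₀ z l ≤ reachSpan n P T₀ z l' :=
  Submodule.span_mono fun _ ⟨k, hk, hx⟩ => ⟨k, hk.trans h, hx⟩

theorem Reach.mem_reachSpan {l : ℕ} {T : ℕ → Bool} {x : M} (h : Reach n P T₀ z l T x) :
    x ∈ reachSpan n P T₀ z l :=
  Submodule.subset_span ⟨l, le_rfl, T, h⟩

theorem map_mem_of_reach {l : ℕ} {f : Module.End F M} {N : Submodule F M}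
    (h : ∀ l' ≤ l, ∀ T x, Reach n P T₀ z l' T x → f x ∈ N) {x : M}
    (hx : x ∈ reachSpan n P T₀ z l) : f x ∈ N := by
  have : reachSpan n P T₀ z l ≤ N.comap f :=
    Submodule.span_le.2 fun _ ⟨l', hl', T, hx⟩ => h l' hl' T _ hx
  exact this hx

namespace Reach

theorem weight (H : KLRAction e n P Y W) (hz : W (shuffleSeq e T₀) z) {l : ℕ} {T : ℕ → Bool}
    {x : M} (h : Reach n P T₀ z l T x) : W (shuffleSeq e T) x := by
  induction h with
  | base => exact hz
  | step l T x r h1 hn hr hr' _ ih =>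
    exact H.W_congr _ _ _ (fun t ht _ => (shuffleSeq_sw h1 hr hr' t ht).symm) (H.W_P _ _ r h1 hn ih)

/-- The crossing of adjacent strands that have been crossed may be taken to be the last one. -/
theorem exists_step (H : KLRAction e n P Y W) (hT₀ : ∀ r, T₀ r = true → T₀ (r + 1) = true)
    {l : ℕ} {T : ℕ → Bool} {x : M} (h : Reach n P T₀ z l T x) {r : ℕ} (h1 : 1 ≤ r) (hn : r < n)
    (hr : T r = true) (hr' : T (r + 1) = false) :
    ∃ l' T' x', l = l' + 1 ∧ Reach n P T₀ z l' T' x' ∧ T = sw r T' ∧ x = P r x' := by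
  induction h with
  | base => rw [hT₀ r hr] at hr'; cases hr'
  | step l T x s hs1 hsn hs hs' hx ih =>
    by_cases hsr : s = r
    · subst hsr; exact ⟨l, T, x, rfl, hx, rfl, rfl⟩
    have h2 : s ≠ r + 1 := by rintro rfl; simp [sw, hs'] at hr'
    have h3 : r ≠ s + 1 := by rintro rfl; simp [sw, hs] at hr
    have e1 : T r = true := by rw [← hr]; simp (disch := omega) only [sw, if_neg]
    have e2 : T (r + 1) = false := by rw [← hr']; simp (disch := omega) only [sw, if_neg]
    obtain ⟨l', T', x', rfl, hx', rfl, rfl⟩ := ih e1 e2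
    have e3 : T' s = false := by rw [← hs]; simp (disch := omega) only [sw, if_neg]
    have e4 : T' (s + 1) = true := by rw [← hs']; simp (disch := omega) only [sw, if_neg]
    refine ⟨l' + 1, sw s T', P s x', rfl, .step _ _ _ s hs1 hsn e3 e4 hx', ?_,
      KLRAction.commute_apply (H.P_comm' _ _ (by omega)) _⟩
    funext t
    simp only [sw]
    split_ifs <;> first | rfl | omega

end Reach

/-- In every case the braid defect is a combination of `x` and dots on `x`. This is all that
`reach_stable` needs, whatever e and the residues are. -/
theorem braid_mem (H : KLRAction e n P Y W) {i : ℕ → ZMod e} {x : M} {r : ℕ} (h1 : 1 ≤ r)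
    (hn : r + 1 < n) (hx : W i x) {N : Submodule F M} (hxN : x ∈ N)
    (hY : ∀ s, 1 ≤ s → s ≤ n → Y s x ∈ N) :
    P r (P (r + 1) (P r x)) - P (r + 1) (P r (P (r + 1) x)) ∈ N := by
  have h3 := hY r h1 (by omega)
  have h4 := hY (r + 1) (by omega) (by omega)
  have h5 := hY (r + 2) (by omega) (by omega)
  by_cases ha : i (r + 2) ≠ i r ∨ (i r ≠ i (r + 1) + 1 ∧ i r ≠ i (r + 1) - 1)
  · rw [H.braid_far _ _ _ h1 hn hx ha, sub_self]
    exact N.zero_mem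
  push Not at ha
  obtain ⟨ha, hb⟩ := ha
  by_cases he : e = 2
  · have hne : i r ≠ i (r + 1) := by
      subst he
      have key : ∀ a b : ZMod 2, (a ≠ b + 1 → a = b - 1) → a ≠ b := by decide
      exact key _ _ hb
    rw [H.braid_two he _ _ _ h1 hn hx ha hne]
    have := N.add_mem (N.sub_mem h3 (N.smul_mem (2 : F) h4)) h5
    convert this using 1
    abel
  by_cases hc : i r = i (r + 1) + 1
  · rw [H.braid_add he _ _ _ h1 hn hx ha hc, add_sub_cancel_left]
    exact hxN
  · rw [H.braid_sub he _ _ _ h1 hn hx ha (hb hc), sub_right_comm, sub_self, zero_sub]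
    exact N.neg_mem hxN

theorem sq_mem (H : KLRAction e n P Y W) {i : ℕ → ZMod e} {x : M} {r : ℕ} (h1 : 1 ≤ r)
    (hn : r < n) (hx : W i x) {N : Submodule F M} (hxN : x ∈ N)
    (hY : ∀ w ∈ N, ∀ s, 1 ≤ s → s ≤ n → Y s w ∈ N) : P r (P r x) ∈ N := by
  have h3 := hY x hxN r h1 (by omega)
  have h4 := hY x hxN (r + 1) (by omega) (by omega)
  by_cases ha : i r = i (r + 1)
  · rw [H.sq_eq _ _ _ h1 hn hx ha]; exact N.zero_mem
  by_cases he : e = 2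
  · rw [H.sq_two he _ _ _ h1 hn hx ha]
    exact N.sub_mem (hY _ (N.sub_mem h3 h4) _ (by omega) (by omega))
      (hY _ (N.sub_mem h3 h4) _ (by omega) (by omega))
  by_cases hb : i r = i (r + 1) + 1
  · rw [H.sq_add he _ _ _ h1 hn hx hb]; exact N.sub_mem h4 h3
  by_cases hc : i r = i (r + 1) - 1
  · rw [H.sq_sub he _ _ _ h1 hn hx hc]; exact N.sub_mem h3 h4
  · rw [H.sq_far _ _ _ h1 hn hx (fun h => ha h.symm) (fun h => hc (by rw [h]; ring))
      (fun h => hb (by rw [h]; ring))]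
    exact hxN

/-- The span of the vectors reached from `z` is stable under dots and crossings. -/
theorem reach_stable (H : KLRAction e n P Y W) (hz : W (shuffleSeq e T₀) z)
    (hT₀ : ∀ r, T₀ r = true → T₀ (r + 1) = true)
    (hY₀ : ∀ s, 1 ≤ s → s ≤ n → Y s z = 0)
    (hP₀ : ∀ r, 1 ≤ r → r < n → T₀ r = T₀ (r + 1) → P r z = 0) (l : ℕ) :
    ∀ T x, Reach n P T₀ z l T x →
      (∀ s, 1 ≤ s → s ≤ n → Y s x ∈ reachSpan n P T₀ z l) ∧
      (∀ r, 1 ≤ r → r < n → P r x ∈ reachSpan n P T₀ z (l + 1)) ∧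
      (∀ r, 1 ≤ r → r < n → T r = T (r + 1) → P r x ∈ reachSpan n P T₀ z l) := by
  -- The three claims depend on each other, so they are proved together: squares and braid defects
  -- need dots on vectors with fewer steps, and dots produce such vectors.
  induction l using Nat.strong_induction_on with
  | _ l ih =>
  have ihY : ∀ l' < l, ∀ x ∈ reachSpan n P T₀ z l', ∀ s, 1 ≤ s → s ≤ n →
      Y s x ∈ reachSpan n P T₀ z l' := fun l' hl' x hx s hs1 hs2 =>
    map_mem_of_reach (fun k hk T x hx => reachSpan_mono hk ((ih k (by omega) T x hx).1 s hs1 hs2)) hx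
  have ihP : ∀ l' < l, ∀ x ∈ reachSpan n P T₀ z l', ∀ r, 1 ≤ r → r < n →
      P r x ∈ reachSpan n P T₀ z (l' + 1) := fun l' hl' x hx r hr1 hr2 =>
    map_mem_of_reach (fun k hk T x hx => reachSpan_mono (Nat.succ_le_succ hk)
      ((ih k (by omega) T x hx).2.1 r hr1 hr2)) hx
  intro T x hx
  have hYx : ∀ s, 1 ≤ s → s ≤ n → Y s x ∈ reachSpan n P T₀ z l := by
    intro s hs1 hs2
    cases hx with
    | base => rw [hY₀ s hs1 hs2]; exact Submodule.zero_mem _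
    | step l T x r h1 hn hr hr' hx =>
      have hxm := reachSpan_mono (Nat.le_succ l) hx.mem_reachSpan
      have hd : ∀ (c : Prop) [Decidable c], (if c then x else 0) ∈ reachSpan n P T₀ z (l + 1) := by
        intro c _
        split_ifs
        exacts [hxm, Submodule.zero_mem _]
      have hw := hx.weight H hz
      have hPY : ∀ s, 1 ≤ s → s ≤ n → P r (Y s x) ∈ reachSpan n P T₀ z (l + 1) := fun s h3 h4 =>
        ihP l (by omega) _ (ihY l (by omega) _ hx.mem_reachSpan s h3 h4) r h1 hn
      by_cases e1 : s = r
      · subst e1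
        rw [H.Y_P _ _ _ h1 hn hw]
        exact Submodule.sub_mem _ (hPY _ (by omega) (by omega)) (hd _)
      by_cases e2 : s = r + 1
      · subst e2
        rw [H.Y_succ_P _ _ _ h1 hn hw]
        exact Submodule.add_mem _ (hPY _ (by omega) (by omega)) (hd _)
      · rw [KLRAction.commute_apply (H.Y_P_comm _ _ e1 e2)]
        exact hPY s hs1 hs2
  have hPP : ∀ r, 1 ≤ r → r < n → T r = T (r + 1) → P r x ∈ reachSpan n P T₀ z l := by
    intro r h1 hn hr
    cases hx with
    | base => rw [hP₀ r h1 hn hr]; exact Submodule.zero_mem _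
    | step l T x s hs1 hsn hs hs' hx =>
      have n1 : s ≠ r := by rintro rfl; simp [sw, hs, hs'] at hr
      -- When two equal letters are preceded by a step that involves one of them, that letter has
      -- crossed two adjacent strands. The braid relation moves the crossing of equal letters below
      -- both steps, where the induction hypothesis applies.
      have hbraid : ∀ q l'' T'' x'', 1 ≤ q → q + 1 < n → l'' + 1 ≤ l →
          Reach n P T₀ z l'' T'' x'' →
          (P q x'' ∈ reachSpan n P T₀ z l'' →
            P (q + 1) (P q (P (q + 1) x'')) ∈ reachSpan n P T₀ z (l + 1)) ∧
          (P (q + 1) x'' ∈ reachSpan n P T₀ z l'' →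
            P q (P (q + 1) (P q x'')) ∈ reachSpan n P T₀ z (l + 1)) := by
        intro q l'' T'' x'' hq1 hqn hl'' hx''
        have hb := braid_mem H hq1 hqn (hx''.weight H hz) hx''.mem_reachSpan
          (ihY l'' (by omega) _ hx''.mem_reachSpan)
        have hm := reachSpan_mono (n := n) (P := P) (T₀ := T₀) (z := z)
          (show l'' + 2 ≤ l + 1 by omega)
        have hb' := reachSpan_mono (by omega : l'' ≤ l + 1) hb
        constructor
        · intro h
          have h2 := ihP (l'' + 1) (by omega) _ (ihP l'' (by omega) _ h (q + 1) (by omega) hqn) q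
            hq1 (by omega)
          have := Submodule.sub_mem _ (hm h2) hb'
          rwa [sub_sub_cancel] at this
        · intro h
          have h2 := ihP (l'' + 1) (by omega) _ (ihP l'' (by omega) _ h q hq1 (by omega)) (q + 1)
            (by omega) hqn
          have := Submodule.add_mem _ hb' (hm h2)
          rwa [sub_add_cancel] at this
      by_cases e1 : r = s + 1
      · subst e1
        have t2 : T (s + 2) = false := by
          simp only [sw, if_true, Nat.succ_ne_self, if_false] at hr
          rw [← hs, hr]; simp (disch := omega) only [if_neg]
        obtain ⟨l'', T'', x'', rfl, hx'', rfl, rfl⟩ :=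
          hx.exists_step H hT₀ (r := s + 1) (by omega) hn hs' t2
        have t1 : T'' s = T'' (s + 1) := by
          rw [show T'' s = sw (s + 1) T'' s by simp (disch := omega) only [sw, if_neg], hs, ← t2]
          simp [sw]
        exact (hbraid s l'' T'' x'' hs1 hn le_rfl hx'').1
          ((ih l'' (by omega) _ _ hx'').2.2 s hs1 (by omega) t1)
      by_cases e2 : s = r + 1
      · subst e2
        have t2 : T r = true := by
          simp only [sw, if_true] at hr
          rw [← hs', ← hr]; simp (disch := omega) only [if_neg]
        obtain ⟨l'', T'', x'', rfl, hx'', rfl, rfl⟩ :=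
          hx.exists_step H hT₀ (r := r) h1 (by omega) t2 hs
        have t1 : T'' (r + 1) = T'' (r + 2) := by
          rw [show T'' (r + 2) = sw r T'' (r + 2) by simp (disch := omega) only [sw, if_neg], hs',
            ← t2]
          simp [sw]
        exact (hbraid r l'' T'' x'' h1 hsn le_rfl hx'').2
          ((ih l'' (by omega) _ _ hx'').2.2 (r + 1) (by omega) hsn t1)
      · rw [KLRAction.commute_apply (H.P_comm' r s (by omega))]
        refine ihP l (by omega) _ ((ih l (by omega) _ _ hx).2.2 r h1 hn ?_) s hs1 hsn
        simp (disch := omega) only [sw, if_neg] at hr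
        exact hr
  refine ⟨hYx, fun r h1 hn => ?_, hPP⟩
  cases h2 : T r <;> cases h3 : T (r + 1)
  · exact reachSpan_mono (Nat.le_succ l) (hPP r h1 hn (h2.trans h3.symm))
  · exact (Reach.step _ _ _ r h1 hn h2 h3 hx).mem_reachSpan
  -- The two strands have already crossed, and that crossing may be taken last, so ψ_r acts as a
  -- square.
  · obtain ⟨l', T', x', rfl, hx', rfl, rfl⟩ := hx.exists_step H hT₀ h1 hn h2 h3
    exact reachSpan_mono (by omega) (sq_mem H h1 hn (hx'.weight H hz) hx'.mem_reachSpan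
      (ihY l' (by omega)))
  · exact reachSpan_mono (Nat.le_succ l) (hPP r h1 hn (h2.trans h3.symm))

end

end KLR

/-! ## Modules over the KLR algebra -/

namespace KLR

section

variable (F : Type*) [Field F] {e : ℕ} [NeZero e] (κ : Fin 2 → ZMod e) (n : ℕ)

/-- A sequence with positions counted from `1`, restricted to the positions `1, …, n`. -/
def toFin {e : ℕ} (n : ℕ) (i : ℕ → ZMod e) : Fin n → ZMod e := fun t => i (t + 1)

theorem swapSeq_toFin {e n r : ℕ} (h : r + 1 < n) (i : ℕ → ZMod e) :
    swapSeq r h (toFin n i) = toFin n (sw (r + 1) i) := by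
  funext t
  simp only [swapSeq, toFin, sw, Function.comp_apply, Equiv.swap_apply_def, Fin.ext_iff]
  split_ifs <;> first | rfl | omega

theorem y_eq {r : ℕ} (h : r < n) :
    y F κ n (r + 1) = RingQuot.mkAlgHom F (Rel F κ n) (fY F r h) :=
  dif_pos ⟨by omega, by omega⟩

theorem psi_eq {r : ℕ} (h : r + 1 < n) :
    psi F κ n (r + 1) = RingQuot.mkAlgHom F (Rel F κ n) (fP F r h) :=
  dif_pos ⟨by omega, by omega⟩

theorem y_of_not {r : ℕ} (h : ¬(1 ≤ r ∧ r ≤ n)) : y F κ n r = 0 := dif_neg h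

theorem psi_of_not {r : ℕ} (h : ¬(1 ≤ r ∧ r < n)) : psi F κ n r = 0 := dif_neg h

theorem psi_comm (r s : ℕ) (h : r + 1 < s) : Commute (psi F κ n r) (psi F κ n s) := by
  by_cases hr : 1 ≤ r ∧ r < n
  · by_cases hs : 1 ≤ s ∧ s < n
    · obtain ⟨r, rfl⟩ := Nat.exists_eq_succ_of_ne_zero (by omega : r ≠ 0)
      obtain ⟨s, rfl⟩ := Nat.exists_eq_succ_of_ne_zero (by omega : s ≠ 0)
      rw [Nat.succ_eq_add_one, Nat.succ_eq_add_one, psi_eq F κ n (by omega),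
        psi_eq F κ n (by omega)]
      have := RingQuot.mkAlgHom_rel F (Rel.psi_comm (F := F) (κ := κ) (n := n) r s (by omega)
        (by omega) (Or.inl (by omega)))
      rw [map_mul, map_mul] at this
      exact this
    · rw [psi_of_not F κ n hs]; exact Commute.zero_right _
  · rw [psi_of_not F κ n hr]; exact Commute.zero_left _

theorem y_psi_comm (r s : ℕ) (h1 : s ≠ r) (h2 : s ≠ r + 1) :
    Commute (y F κ n s) (psi F κ n r) := by
  by_cases hr : 1 ≤ r ∧ r < n
  · by_cases hs : 1 ≤ s ∧ s ≤ n
    · obtain ⟨r, rfl⟩ := Nat.exists_eq_succ_of_ne_zero (by omega : r ≠ 0)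
      obtain ⟨s, rfl⟩ := Nat.exists_eq_succ_of_ne_zero (by omega : s ≠ 0)
      rw [Nat.succ_eq_add_one, Nat.succ_eq_add_one, psi_eq F κ n (by omega),
        y_eq F κ n (by omega)]
      have := RingQuot.mkAlgHom_rel F (Rel.psi_y_comm (F := F) (κ := κ) (n := n) r s (by omega)
        (by omega) (by omega) (by omega))
      rw [map_mul, map_mul] at this
      exact this.symm
    · rw [y_of_not F κ n hs]; exact Commute.zero_left _
  · rw [psi_of_not F κ n hr]; exact Commute.zero_right _

theorem idem_mul_self (i : Fin n → ZMod e) : idem F κ n i * idem F κ n i = idem F κ n i := by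
  have := RingQuot.mkAlgHom_rel F (Rel.idem_mul_self (F := F) (κ := κ) (n := n) i)
  rw [map_mul] at this
  exact this

theorem idem_mul_of_ne {i i' : Fin n → ZMod e} (h : i ≠ i') :
    idem F κ n i * idem F κ n i' = 0 := by
  have := RingQuot.mkAlgHom_rel F (Rel.idem_mul_of_ne (F := F) (κ := κ) (n := n) i i' h)
  rw [map_mul, map_zero] at this
  exact this

/-- The relations are stated with a right factor e(i), which acts as the identity on vectors of
weight i. -/
theorem smul_eq_of_rel {M : Type*} [AddCommGroup M] [Module (KLRAlgebra F κ n) M]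
    {a b : FreeAlgebra F (KLRGen e n)} {i : Fin n → ZMod e}
    (h : Rel F κ n (a * fE F i) (b * fE F i)) {v : M} (hv : idem F κ n i • v = v) :
    RingQuot.mkAlgHom F (Rel F κ n) a • v = RingQuot.mkAlgHom F (Rel F κ n) b • v := by
  have := RingQuot.mkAlgHom_rel F h
  rw [map_mul, map_mul] at this
  change _ * idem F κ n i = _ * idem F κ n i at this
  rw [← hv, ← mul_smul, this, mul_smul]

variable (M : Type*) [AddCommGroup M] [Module F M] [Module (KLRAlgebra F κ n) M]
  [IsScalarTower F (KLRAlgebra F κ n) M]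

/-- The action of `ψ_r` on a module. -/
noncomputable def psiEnd (r : ℕ) : Module.End F M := Algebra.lsmul F F M (psi F κ n r)

/-- The action of `y_r` on a module. -/
noncomputable def yEnd (r : ℕ) : Module.End F M := Algebra.lsmul F F M (y F κ n r)

/-- The vectors of weight `i`. -/
def HasWeight {M : Type*} [AddCommGroup M] [Module (KLRAlgebra F κ n) M] (i : ℕ → ZMod e)
    (v : M) : Prop := idem F κ n (toFin n i) • v = v

variable {M}

theorem psiEnd_apply (r : ℕ) (v : M) : psiEnd F κ n M r v = psi F κ n r • v := rfl

theorem klrAction : KLRAction e n (psiEnd F κ n M) (yEnd F κ n M) (HasWeight F κ n) where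
  P_comm r s h := (psi_comm F κ n r s h).map (Algebra.lsmul F F M)
  Y_P_comm r s h1 h2 := (y_psi_comm F κ n r s h1 h2).map (Algebra.lsmul F F M)
  W_congr i i' v h hv := by
    have : toFin n i' = toFin n i := funext fun t => (h (t + 1) (by omega) (by omega)).symm
    rw [HasWeight, this]; exact hv
  W_P i v r h1 hn hv := by
    obtain ⟨r, rfl⟩ := Nat.exists_eq_succ_of_ne_zero (by omega : r ≠ 0)
    have := RingQuot.mkAlgHom_rel F (Rel.psi_idem (F := F) (κ := κ) r hn (toFin n i))
    rw [map_mul, map_mul, swapSeq_toFin, ← psi_eq] at this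
    change psi F κ n (r + 1) * idem F κ n _ = idem F κ n _ * psi F κ n (r + 1) at this
    rw [HasWeight, psiEnd_apply, ← mul_smul, ← this, mul_smul, hv]
  Y_P i v r h1 hn hv := by
    obtain ⟨r, rfl⟩ := Nat.exists_eq_succ_of_ne_zero (by omega : r ≠ 0)
    have := smul_eq_of_rel F κ n (Rel.y_psi r hn (toFin n i)) hv
    rw [map_mul, map_sub, map_mul, ← psi_eq, ← y_eq, ← y_eq, mul_smul, sub_smul, mul_smul] at this
    refine this.trans (congrArg₂ _ rfl ?_)
    change _ = if toFin n i ⟨r, Nat.lt_of_succ_lt hn⟩ = toFin n i ⟨r + 1, hn⟩ then v else 0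
    split_ifs <;> simp
  Y_succ_P i v r h1 hn hv := by
    obtain ⟨r, rfl⟩ := Nat.exists_eq_succ_of_ne_zero (by omega : r ≠ 0)
    have := smul_eq_of_rel F κ n (Rel.y_succ_psi r hn (toFin n i)) hv
    rw [map_mul, map_add, map_mul, ← psi_eq, ← y_eq, ← y_eq, mul_smul, add_smul, mul_smul] at this
    refine this.trans (congrArg₂ _ rfl ?_)
    change _ = if toFin n i ⟨r, Nat.lt_of_succ_lt hn⟩ = toFin n i ⟨r + 1, hn⟩ then v else 0
    split_ifs <;> simp
  sq_eq i v r h1 hn hv hi := by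
    obtain ⟨r, rfl⟩ := Nat.exists_eq_succ_of_ne_zero (by omega : r ≠ 0)
    have := Rel.psi_sq_eq (F := F) (κ := κ) r hn (toFin n i) hi
    rw [← zero_mul (fE F (toFin n i))] at this
    have := smul_eq_of_rel F κ n this hv
    rwa [map_mul, ← psi_eq, mul_smul, map_zero, zero_smul] at this
  sq_far i v r h1 hn hv hi1 hi2 hi3 := by
    obtain ⟨r, rfl⟩ := Nat.exists_eq_succ_of_ne_zero (by omega : r ≠ 0)
    have := Rel.psi_sq_far (F := F) (κ := κ) r hn (toFin n i) hi1 hi2 hi3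
    nth_rw 2 [← one_mul (fE F (toFin n i))] at this
    have := smul_eq_of_rel F κ n this hv
    rwa [map_mul, ← psi_eq, mul_smul, map_one, one_smul] at this
  sq_add he i v r h1 hn hv hi := by
    obtain ⟨r, rfl⟩ := Nat.exists_eq_succ_of_ne_zero (by omega : r ≠ 0)
    have := smul_eq_of_rel F κ n (Rel.psi_sq_add (F := F) (κ := κ) he r hn (toFin n i) hi) hv
    rwa [map_mul, map_sub, ← psi_eq, ← y_eq, ← y_eq, mul_smul, sub_smul] at this
  sq_sub he i v r h1 hn hv hi := by
    obtain ⟨r, rfl⟩ := Nat.exists_eq_succ_of_ne_zero (by omega : r ≠ 0)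
    have := smul_eq_of_rel F κ n (Rel.psi_sq_sub (F := F) (κ := κ) he r hn (toFin n i) hi) hv
    rwa [map_mul, map_sub, ← psi_eq, ← y_eq, ← y_eq, mul_smul, sub_smul] at this
  sq_two he i v r h1 hn hv hi := by
    obtain ⟨r, rfl⟩ := Nat.exists_eq_succ_of_ne_zero (by omega : r ≠ 0)
    have := smul_eq_of_rel F κ n (Rel.psi_sq_two (F := F) (κ := κ) he r hn (toFin n i) hi) hv
    rwa [map_mul, map_mul, map_sub, map_sub, ← psi_eq, ← y_eq, ← y_eq, mul_smul, mul_smul, sub_smul,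
      sub_smul] at this
  braid_add he i v r h1 hn hv hi1 hi2 := by
    obtain ⟨r, rfl⟩ := Nat.exists_eq_succ_of_ne_zero (by omega : r ≠ 0)
    have := smul_eq_of_rel F κ n (Rel.braid_add (F := F) (κ := κ) he r (by omega) (toFin n i)
      hi1 hi2) hv
    rwa [map_add, map_mul, map_mul, map_mul, map_mul, ← psi_eq, ← psi_eq, map_one, add_smul,
      one_smul, mul_smul, mul_smul, mul_smul, mul_smul] at this
  braid_sub he i v r h1 hn hv hi1 hi2 := by
    obtain ⟨r, rfl⟩ := Nat.exists_eq_succ_of_ne_zero (by omega : r ≠ 0)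
    have := smul_eq_of_rel F κ n (Rel.braid_sub (F := F) (κ := κ) he r (by omega) (toFin n i)
      hi1 hi2) hv
    rwa [map_sub, map_mul, map_mul, map_mul, map_mul, ← psi_eq, ← psi_eq, map_one, sub_smul,
      one_smul, mul_smul, mul_smul, mul_smul, mul_smul] at this
  braid_two he i v r h1 hn hv hi1 hi2 := by
    obtain ⟨r, rfl⟩ := Nat.exists_eq_succ_of_ne_zero (by omega : r ≠ 0)
    have := smul_eq_of_rel F κ n (Rel.braid_two (F := F) (κ := κ) he r (by omega) (toFin n i)
      hi1 hi2) hv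
    rw [map_add, map_sub, map_add, map_mul, map_mul, map_mul, map_mul, map_mul, ← psi_eq, ← psi_eq,
      ← y_eq, ← y_eq, ← y_eq, add_smul, sub_smul, add_smul, mul_smul, mul_smul, mul_smul, mul_smul,
      mul_smul] at this
    refine this.trans (congrArg₂ _ (congrArg₂ _ rfl ?_) rfl)
    rw [map_ofNat, ofNat_smul_eq_nsmul, two_smul, two_smul]; rfl
  braid_far i v r h1 hn hv hi := by
    obtain ⟨r, rfl⟩ := Nat.exists_eq_succ_of_ne_zero (by omega : r ≠ 0)
    have := smul_eq_of_rel F κ n (Rel.braid_far (F := F) (κ := κ) r (by omega) (toFin n i) hi) hv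
    rwa [map_mul, map_mul, map_mul, map_mul, ← psi_eq, ← psi_eq, mul_smul, mul_smul, mul_smul,
      mul_smul] at this

end

end KLR

/-! ### Weights of the Specht module. -/

namespace KLR

section

variable {F : Type*} [Field F] {e : ℕ} [NeZero e] {κ : Fin 2 → ZMod e} {n : ℕ}
  {M : Type*} [AddCommGroup M] [Module F M] [Module (KLRAlgebra F κ n) M]

theorem idem_smul_mem (i : Fin n → ZMod e) {i' : ℕ → ZMod e} {x : M} (hx : HasWeight F κ n i' x)
    {N : Submodule F M} (hN : x ∈ N) : idem F κ n i • x ∈ N := by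
  rw [← hx, ← mul_smul]
  by_cases h : i = toFin n i'
  · rw [h, idem_mul_self, hx]; exact hN
  · rw [idem_mul_of_ne F κ n h, zero_smul]; exact N.zero_mem

variable [IsScalarTower F (KLRAlgebra F κ n) M]

/-- A subspace stable under the generators is stable under the whole algebra. -/
theorem smul_mem_of_stable {N : Submodule F M}
    (hE : ∀ i, ∀ x ∈ N, idem F κ n i • x ∈ N)
    (hY : ∀ r, 1 ≤ r → r ≤ n → ∀ x ∈ N, y F κ n r • x ∈ N)
    (hP : ∀ r, 1 ≤ r → r < n → ∀ x ∈ N, psi F κ n r • x ∈ N)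
    (a : KLRAlgebra F κ n) : ∀ x ∈ N, a • x ∈ N := by
  obtain ⟨a, rfl⟩ := RingQuot.mkAlgHom_surjective F (Rel F κ n) a
  induction a using FreeAlgebra.induction with
  | grade0 c =>
    intro x hx
    rw [AlgHom.commutes, algebraMap_smul]
    exact N.smul_mem c hx
  | grade1 g =>
    intro x hx
    cases g with
    | idem i => exact hE i x hx
    | y r =>
      have := hY (r + 1) (by omega) r.2 x hx
      rwa [y_eq F κ n r.2] at this
    | psi r h =>
      have := hP (r + 1) (by omega) h x hx
      rwa [psi_eq F κ n h] at this
  | mul a b ha hb =>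
    intro x hx
    rw [map_mul, mul_smul]
    exact ha _ (hb _ hx)
  | add a b ha hb =>
    intro x hx
    rw [map_add, add_smul]
    exact N.add_mem (ha _ hx) (hb _ hx)

/-- The weights of the module generated by `z` are residue sequences of shuffles. -/
theorem eq_zero_of_notShuffle {T₀ : ℕ → Bool} {z : M}
    (hgen : ∀ x : M, ∃ a : KLRAlgebra F κ n, x = a • z)
    (hz : HasWeight F κ n (shuffleSeq e T₀) z)
    (hT₀ : ∀ r, T₀ r = true → T₀ (r + 1) = true)
    (hY₀ : ∀ s, 1 ≤ s → s ≤ n → y F κ n s • z = 0)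
    (hP₀ : ∀ r, 1 ≤ r → r < n → T₀ r = T₀ (r + 1) → psi F κ n r • z = 0)
    (i : ℕ → ZMod e) (x : M) (hx : HasWeight F κ n i x) (hi : NotShuffle n i) : x = 0 := by
  have hst := reach_stable (klrAction F κ n) hz hT₀ hY₀ hP₀
  set N : Submodule F M :=
    Submodule.span F {x | ∃ l T, Reach n (psiEnd F κ n M) T₀ z l T x} with hN
  have hle : ∀ l, reachSpan n (psiEnd F κ n M) T₀ z l ≤ N := fun l =>
    Submodule.span_mono fun x ⟨l', _, T, h⟩ => ⟨l', T, h⟩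
  have hmap : ∀ f : Module.End F M,
      (∀ l T x, Reach n (psiEnd F κ n M) T₀ z l T x → f x ∈ N) → ∀ x ∈ N, f x ∈ N := by
    intro f hf x hx
    have : N ≤ N.comap f := Submodule.span_le.2 fun x ⟨l, T, h⟩ => hf l T x h
    exact this hx
  have hE : ∀ i, ∀ x ∈ N, idem F κ n i • x ∈ N := fun i =>
    hmap (Algebra.lsmul F F M (idem F κ n i)) fun l T x h =>
      idem_smul_mem i (h.weight (klrAction F κ n) hz) (hle l h.mem_reachSpan)
  have htop : ∀ x : M, x ∈ N := by
    intro x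
    obtain ⟨a, rfl⟩ := hgen x
    refine smul_mem_of_stable hE ?_ ?_ a z (hle 0 Reach.base.mem_reachSpan)
    · exact fun r h1 h2 => hmap (yEnd F κ n M r) fun l T x h => hle l ((hst l T x h).1 r h1 h2)
    · exact fun r h1 h2 => hmap (psiEnd F κ n M r) fun l T x h =>
        hle _ ((hst l T x h).2.1 r h1 h2)
  -- The reached vectors span the whole module and their weights are shuffles, so the idempotent of
  -- any other sequence acts by 0.
  have hzero : N ≤ LinearMap.ker (Algebra.lsmul F F M (idem F κ n (toFin n i))) := by
    refine Submodule.span_le.2 fun x ⟨l, T, h⟩ => ?_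
    have hw := h.weight (klrAction F κ n) hz
    change idem F κ n (toFin n i) • x = 0
    have hne : toFin n i ≠ toFin n (shuffleSeq e T) := by
      intro heq
      obtain ⟨t, h1, h2, h3⟩ := hi T
      obtain ⟨t, rfl⟩ := Nat.exists_eq_succ_of_ne_zero (by omega : t ≠ 0)
      exact h3 (congrFun heq ⟨t, h2⟩).symm
    rw [← hw, ← mul_smul, idem_mul_of_ne F κ n hne, zero_smul]
  rw [← hx]
  exact hzero (htop x)

end

theorem resSeq_colInitial {e n k j : ℕ} (h : k * e + j * e = n) :
    (BiTableau.colInitial n (k * e) (j * e) h).resSeq (0 : Fin 2 → ZMod e) =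
      toFin n (stdSeq e) := by
  funext t
  simp only [BiTableau.resSeq, BiTableau.colInitial, BiNode.res, toFin, stdSeq]
  split_ifs with ht
  · simp
  · rw [Nat.cast_sub (not_lt.1 ht)]; simp

theorem letterCount_threshold {e : ℕ} (b r : ℕ) :
    (r ≤ b + 1 → letterCount e (fun t => decide (b < t)) false r = ((r - 1 : ℕ) : ZMod e)) ∧
    letterCount e (fun t => decide (b < t)) true r = ((r - 1 - b : ℕ) : ZMod e) := by
  induction r with
  | zero => simp [letterCount]
  | succ r ih =>
    rcases Nat.eq_zero_or_pos r with rfl | hr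
    · simp [letterCount]
    rw [letterCount_succ _ _ hr, letterCount_succ _ _ hr, ih.2]
    constructor
    · intro hrb
      rw [ih.1 (by omega), if_pos (by simp; omega), ← Nat.cast_add_one]
      congr 1; omega
    · by_cases hb : b < r
      · rw [if_pos (by simpa using hb), ← Nat.cast_add_one]
        congr 1; omega
      · rw [if_neg (by simpa using hb), add_zero]
        congr 1; omega

/-- The first string has length je ≡ 0, so the second one starts where `stdSeq` returns to 0. -/
theorem shuffleSeq_threshold {e : ℕ} (j t : ℕ) (ht : 1 ≤ t) :
    shuffleSeq e (fun t => decide (j * e < t)) t = stdSeq e t := by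
  obtain ⟨c1, c2⟩ := letterCount_threshold (e := e) (j * e) t
  simp only [shuffleSeq, stdSeq]
  by_cases hb : j * e < t
  · rw [decide_eq_true hb, c2, Nat.cast_sub (by omega), Nat.cast_sub ht]
    simp
  · rw [decide_eq_false hb, c1 (by omega), Nat.cast_sub ht]
    simp

section Specht

variable (F : Type*) [Field F] {e : ℕ} [NeZero e] (n k j : ℕ) (h : k * e + j * e = n)

theorem smul_spechtGen (κ : Fin 2 → ZMod e) (a : KLRAlgebra F κ n) :
    a • spechtGen F κ n k j h = (spechtIdeal F κ n k j h).mkQ a := by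
  rw [spechtGen, ← map_smul, smul_eq_mul, mul_one]

theorem exists_smul_spechtGen (κ : Fin 2 → ZMod e) (x : SpechtModule F κ n k j h) :
    ∃ a : KLRAlgebra F κ n, x = a • spechtGen F κ n k j h := by
  obtain ⟨a, rfl⟩ := (spechtIdeal F κ n k j h).mkQ_surjective x
  exact ⟨a, (smul_spechtGen F n k j h κ a).symm⟩

theorem smul_spechtGen_eq_zero (κ : Fin 2 → ZMod e) {a : KLRAlgebra F κ n}
    (ha : a ∈ spechtIdeal F κ n k j h) : a • spechtGen F κ n k j h = 0 := by
  rw [smul_spechtGen]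
  exact (Submodule.Quotient.mk_eq_zero _).2 ha

theorem hasWeight_spechtGen :
    HasWeight F (0 : Fin 2 → ZMod e) n (stdSeq e) (spechtGen F 0 n k j h) := by
  have := smul_spechtGen_eq_zero F n k j h (0 : Fin 2 → ZMod e)
    (Submodule.subset_span (Or.inl (Or.inl rfl)))
  rw [sub_smul, one_smul, sub_eq_zero, resSeq_colInitial] at this
  exact this

theorem y_smul_spechtGen (r : ℕ) (h1 : 1 ≤ r) (h2 : r ≤ n) :
    y F (0 : Fin 2 → ZMod e) n r • spechtGen F 0 n k j h = 0 :=
  smul_spechtGen_eq_zero F n k j h _ (Submodule.subset_span (Or.inl (Or.inr ⟨r, h1, h2, rfl⟩)))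

theorem psi_smul_spechtGen (r : ℕ) (h1 : 1 ≤ r) (h2 : r < n) (h3 : r ≠ j * e) :
    psi F (0 : Fin 2 → ZMod e) n r • spechtGen F 0 n k j h = 0 :=
  smul_spechtGen_eq_zero F n k j h _ (Submodule.subset_span (Or.inr ⟨r, h1, h2, h3, rfl⟩))

theorem specht_eq_zero (i : ℕ → ZMod e) (x : SpechtModule F (0 : Fin 2 → ZMod e) n k j h)
    (hx : HasWeight F (0 : Fin 2 → ZMod e) n i x) (hi : NotShuffle n i) : x = 0 := by
  refine eq_zero_of_notShuffle (T₀ := fun t => decide (j * e < t))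
    (exists_smul_spechtGen F n k j h 0) ?_ ?_ (y_smul_spechtGen F n k j h) ?_ i x hx hi
  · exact (klrAction F _ n).W_congr _ _ _ (fun t ht _ => (shuffleSeq_threshold j t ht).symm)
      (hasWeight_spechtGen F n k j h)
  · intro r hr
    simp only [decide_eq_true_eq] at hr ⊢
    omega
  · intro r h1 h2 hr
    refine psi_smul_spechtGen F n k j h r h1 h2 ?_
    rintro rfl
    simp at hr

theorem isBrickVector_spechtGen :
    IsBrickVector n (psiEnd F (0 : Fin 2 → ZMod e) n _)
      (yEnd F (0 : Fin 2 → ZMod e) n _) (HasWeight F (0 : Fin 2 → ZMod e) n)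
      (spechtGen F 0 n k j h) where
  weight := hasWeight_spechtGen F n k j h
  Y_eq := y_smul_spechtGen F n k j h
  P_eq r h1 h2 hr := psi_smul_spechtGen F n k j h r h1 h2 (by rintro rfl; simp at hr)

end Specht

end KLR

/-! ### The linear combination of products of brick transpositions. -/

namespace KLR

section

variable {e n : ℕ} {F M : Type*} [Field F] [AddCommGroup M] [Module F M]
  {P Y : ℕ → Module.End F M} {W : (ℕ → ZMod e) → M → Prop}

/-- The brick transposition of the strands `d * e + 1, …, (d + 2) * e`. -/
def brickOp {A : Type*} [Monoid A] (f : ℕ → A) (e d : ℕ) : A := moveBlock f (d * e + 1) e e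

theorem P_brickOp (H : KLRAction e n P Y W) (hvan : ∀ i x, W i x → NotShuffle n i → x = 0)
    (he : 2 ≤ e) {v : M} (hv : IsBrickVector n P Y W v) {d : ℕ} (hn : (d + 2) * e ≤ n) :
    P ((d + 1) * e) (brickOp P e d v) = -(2 : F) • P ((d + 1) * e) v := by
  have hpe : ((d * e + 1 : ℕ) : ZMod e) = 1 := by simp
  rw [add_mul] at hn
  rcases he.eq_or_lt with rfl | he
  · have := KLRAction.P_brick_two H hv hpe (by omega) (by omega)
    rwa [show d * 2 + 1 + 1 = (d + 1) * 2 by ring] at this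
  · obtain ⟨g, rfl⟩ := Nat.exists_eq_add_of_le' (show 1 ≤ e by omega)
    have := KLRAction.P_brick H hvan hv hpe (by omega) (by omega) rfl (by omega)
    rwa [show d * (g + 1) + 1 + g = (d + 1) * (g + 1) by ring] at this

theorem isBrickVector_brickOp (H : KLRAction e n P Y W)
    (hvan : ∀ i x, W i x → NotShuffle n i → x = 0) (he : 2 ≤ e) {v : M}
    (hv : IsBrickVector n P Y W v) {d : ℕ} (hn : (d + 2) * e ≤ n) :
    IsBrickVector n P Y W (brickOp P e d v) := by
  have hpe : ((d * e + 1 : ℕ) : ZMod e) = 1 := by simp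
  rw [add_mul] at hn
  rcases he.eq_or_lt with rfl | he
  · exact KLRAction.isBrickVector_moveBlock_two H hvan hv hpe (by omega) (by omega)
  · obtain ⟨g, rfl⟩ := Nat.exists_eq_add_of_le' (show 1 ≤ e by omega)
    exact KLRAction.isBrickVector_moveBlock H hvan hv hpe (by omega) (by omega) rfl (by omega)

theorem P_brickOp_brickOp (H : KLRAction e n P Y W)
    (hvan : ∀ i x, W i x → NotShuffle n i → x = 0) (he : 2 ≤ e) {v : M}
    (hv : IsBrickVector n P Y W v) {d : ℕ} (hn : (d + 3) * e ≤ n) :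
    P ((d + 1) * e) (brickOp P e (d + 1) (brickOp P e d v)) = P ((d + 1) * e) v := by
  have hpe : ((d * e + 1 : ℕ) : ZMod e) = 1 := by simp
  rw [add_mul] at hn
  rcases he.eq_or_lt with rfl | he
  · have := KLRAction.P_brick_brick_two H hvan hv hpe (by omega) (by omega)
    rwa [show d * 2 + 1 + 1 = (d + 1) * 2 by ring,
      show d * 2 + 1 + 2 = (d + 1) * 2 + 1 by ring] at this
  · obtain ⟨g, rfl⟩ := Nat.exists_eq_add_of_le' (show 1 ≤ e by omega)
    have := KLRAction.P_brick_brick H hvan hv hpe (by omega) (by omega) rfl (by omega)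
    rwa [show d * (g + 1) + 1 + g = (d + 1) * (g + 1) by ring,
      show d * (g + 1) + 1 + (g + 1) = (d + 1) * (g + 1) + 1 by ring] at this

theorem commute_brickOp (H : KLRAction e n P Y W) {c d : ℕ}
    (h : c + 1 < d ∨ d + 1 < c) : Commute (P ((c + 1) * e)) (brickOp P e d) := by
  refine commute_moveBlock fun t h1 h2 => H.P_comm' _ _ ?_
  rcases h with h | h
  · have := Nat.mul_le_mul_right e (show c + 2 ≤ d by omega)
    rw [add_mul] at this ⊢
    omega
  · have := Nat.mul_le_mul_right e (show d + 2 ≤ c by omega)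
    rw [add_mul] at this ⊢
    omega

/-- The first crossing to act is that of the last strand of the left brick with the first strand of
the right brick. -/
theorem brickOp_eq_zero (he : 1 ≤ e) {d : ℕ} {v : M} (h : P ((d + 1) * e) v = 0) :
    brickOp P e d v = 0 := by
  obtain ⟨g, rfl⟩ := Nat.exists_eq_add_of_le' he
  rw [brickOp, moveBlock_succ, moveRight_succ', Module.End.mul_apply, Module.End.mul_apply,
    show d * (g + 1) + 1 + g = (d + 1) * (g + 1) by ring, h, map_zero, map_zero]

/-- The vector obtained from `z` by `i` successive brick transpositions. -/
def brickVec (P : ℕ → Module.End F M) (e J : ℕ) (z : M) : ℕ → M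
  | 0 => z
  | i + 1 => brickOp P e (J + i) (brickVec P e J z i)

variable {J k : ℕ} {z : M}

theorem isBrickVector_brickVec (H : KLRAction e n P Y W)
    (hvan : ∀ i x, W i x → NotShuffle n i → x = 0) (he : 2 ≤ e)
    (hz : IsBrickVector n P Y W z) (hn : (J + 1 + k) * e = n) (i : ℕ) (hi : i ≤ k) :
    IsBrickVector n P Y W (brickVec P e J z i) := by
  induction i with
  | zero => exact hz
  | succ i ih =>
    refine isBrickVector_brickOp H hvan he (ih (by omega)) ?_
    rw [← hn]
    exact Nat.mul_le_mul_right e (by omega)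

theorem P_brickVec_of_far (H : KLRAction e n P Y W)
    (hz : ∀ d, (d + 1) * e < n → d ≠ J → P ((d + 1) * e) z = 0) {d : ℕ} (hd : (d + 1) * e < n)
    (i : ℕ) (h : d + 1 < J ∨ J + i < d) : P ((d + 1) * e) (brickVec P e J z i) = 0 := by
  induction i with
  | zero => exact hz d hd (by omega)
  | succ i ih =>
    rw [brickVec, KLRAction.commute_apply (commute_brickOp H (by omega)), ih (by omega),
      map_zero]

/-- With r = J+m+1 and v = `brickVec P e J z m`: since ψ_{re} commutes with Ψ_{r+2}, the case q = 0
gives ψ_{re}Ψ_{r+2}Ψ_{r+1}Ψ_r v = Ψ_{r+2}ψ_{re} v = ψ_{re}Ψ_{r+2} v. This is 0, because ψ_{(r+2)e}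
still kills v. Later transpositions commute with ψ_{re}. -/
theorem P_brickVec_add_three (H : KLRAction e n P Y W)
    (hvan : ∀ i x, W i x → NotShuffle n i → x = 0) (he : 2 ≤ e)
    (hv : IsBrickVector n P Y W z)
    (hz : ∀ d, (d + 1) * e < n → d ≠ J → P ((d + 1) * e) z = 0) (hn : (J + 1 + k) * e = n)
    {m : ℕ} (hm : m + 3 ≤ k) (q : ℕ) :
    P ((J + m + 1) * e) (brickVec P e J z (m + 3 + q)) = 0 := by
  induction q with
  | zero =>
    have hlt : (J + m + 2 + 1) * e < n := by
      rw [← hn]; exact Nat.mul_lt_mul_of_pos_right (by omega) (by omega)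
    have hle : (J + m + 3) * e ≤ n := by rw [← hn]; exact Nat.mul_le_mul_right e (by omega)
    have hb := isBrickVector_brickVec H hvan he hv hn m (by omega)
    rw [add_zero, brickVec, KLRAction.commute_apply (commute_brickOp H (by omega)),
      brickVec, brickVec, ← add_assoc J, ← add_assoc J, P_brickOp_brickOp H hvan he hb hle,
      ← KLRAction.commute_apply (commute_brickOp H (by omega)),
      brickOp_eq_zero (by omega) (P_brickVec_of_far H hz hlt m (by omega)), map_zero]
  | succ q ih =>
    rw [← add_assoc, brickVec, KLRAction.commute_apply (commute_brickOp H (by omega)),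
      ih, map_zero]

theorem P_sum_brickVec (H : KLRAction e n P Y W)
    (hvan : ∀ i x, W i x → NotShuffle n i → x = 0) (he : 2 ≤ e)
    (hv : IsBrickVector n P Y W z)
    (hz : ∀ d, (d + 1) * e < n → d ≠ J → P ((d + 1) * e) z = 0) (hn : (J + 1 + k) * e = n)
    {m : ℕ} (hm : m < k) :
    P ((J + m + 1) * e)
      (∑ i ∈ Finset.range (k + 1), ((k : F) + 1 - (i : F)) • brickVec P e J z i) = 0 := by
  set x := P ((J + m + 1) * e) (brickVec P e J z m) with hx
  have hb := isBrickVector_brickVec H hvan he hv hn m (by omega)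
  have hlt : (J + m + 1) * e < n := by
    rw [← hn]; exact Nat.mul_lt_mul_of_pos_right (by omega) (by omega)
  have hterm : ∀ i ∈ Finset.range (k + 1),
      P ((J + m + 1) * e) (((k : F) + 1 - (i : F)) • brickVec P e J z i) =
        (if i = m then ((k : F) + 1 - m) • x else 0) +
        ((if i = m + 1 then (((k : F) - m) * -2) • x else 0) +
        (if i = m + 2 then ((k : F) - 1 - m) • x else 0)) := by
    intro i hi
    have hi := Finset.mem_range.1 hi
    rw [map_smul]
    rcases lt_or_ge i m with h | h
    · rw [P_brickVec_of_far H hz hlt i (by omega), if_neg (by omega),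
        if_neg (by omega), if_neg (by omega)]
      simp
    obtain ⟨q, rfl⟩ := Nat.exists_eq_add_of_le h
    match q with
    | 0 => simp [hx]
    | 1 =>
      have hle : (J + m + 2) * e ≤ n := by rw [← hn]; exact Nat.mul_le_mul_right e (by omega)
      rw [brickVec, P_brickOp H hvan he hb hle, ← hx, smul_smul, if_neg (by omega), if_pos rfl,
        if_neg (by omega)]
      push_cast
      rw [zero_add, add_zero]
      congr 1; ring
    | 2 =>
      have hle : (J + m + 3) * e ≤ n := by rw [← hn]; exact Nat.mul_le_mul_right e (by omega)
      rw [brickVec, brickVec, ← add_assoc J, P_brickOp_brickOp H hvan he hb hle, ← hx,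
        if_neg (by omega), if_neg (by omega), if_pos rfl]
      push_cast
      rw [zero_add, zero_add]
      congr 1; ring
    | q + 3 =>
      rw [show m + (q + 3) = m + 3 + q by ring,
        P_brickVec_add_three H hvan he hv hz hn (by omega), if_neg (by omega), if_neg (by omega),
        if_neg (by omega)]
      simp
  rw [map_sum, Finset.sum_congr rfl hterm, Finset.sum_add_distrib, Finset.sum_add_distrib,
    Finset.sum_ite_eq', Finset.sum_ite_eq', Finset.sum_ite_eq', if_pos (by simp; omega),
    if_pos (by simp; omega)]
  -- For m = k-1 the sum has no term with index m+2, but its coefficient would be 0. This fixes the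
  -- constant k+1 in the coefficients.
  have : (if m + 2 ∈ Finset.range (k + 1) then ((k : F) - 1 - m) • x else 0) =
      ((k : F) - 1 - m) • x := by
    split_ifs with h
    · rfl
    · obtain rfl : k = m + 1 := by simp at h; omega
      push_cast
      rw [show (m : F) + 1 - 1 - m = 0 by ring, zero_smul]
  rw [this, ← add_smul, ← add_smul, show (k : F) + 1 - m + ((k - m) * -2 + (k - 1 - m)) = 0 by ring,
    zero_smul]

end

end KLR

/-! ### The homomorphism. -/

namespace KLR

section

variable {A : Type*} [Monoid A] (f : ℕ → A)

theorem list_prod_moveRight (p l : ℕ) :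
    ((List.range l).map fun t => f (p + l - 1 - t)).prod = moveRight f p l := by
  induction l with
  | zero => simp
  | succ l ih =>
    rw [List.range_succ_eq_map, List.map_cons, List.prod_cons, moveRight_succ, ← ih, List.map_map]
    congr 3
    funext t
    simp only [Function.comp_apply]
    congr 1; omega

theorem descProd_eq_moveRight {p : ℕ} (hp : 1 ≤ p) (l : ℕ) :
    descProd f (p + l - 1) p = moveRight f p l := by
  rw [descProd, ← list_prod_moveRight, show p + l - 1 + 1 - p = l by omega]

theorem list_prod_moveBlock (p m l : ℕ) :
    ((List.range m).map fun t => moveRight f (p + t) l).prod = moveBlock f p m l := by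
  induction m with
  | zero => simp
  | succ m ih =>
    rw [List.range_succ, List.map_append, List.prod_append, ih, moveBlock_succ]
    simp

end

section

variable (F : Type*) [Field F] {e : ℕ} [NeZero e] (κ : Fin 2 → ZMod e) (n : ℕ)

theorem brick_succ (d : ℕ) : brick F κ n (d + 1) = brickOp (psi F κ n) e d := by
  rw [brick, brickOp, ← list_prod_moveBlock]
  congr 2
  funext t
  rw [← descProd_eq_moveRight _ (by omega), add_mul, Nat.add_sub_cancel]
  congr 1; omega

variable {M : Type*} [AddCommGroup M] [Module F M] [Module (KLRAlgebra F κ n) M]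
  [IsScalarTower F (KLRAlgebra F κ n) M]

theorem brickOp_psiEnd (d : ℕ) (v : M) :
    brickOp (psiEnd F κ n M) e d v = brickOp (psi F κ n) e d • v :=
  congrArg (fun g : Module.End F M => g v)
    (map_moveBlock (psi F κ n) (Algebra.lsmul F F M : _ →ₐ[F] Module.End F M).toMonoidHom
      (d * e + 1) e e).symm

theorem brickVec_psiEnd (J : ℕ) (z : M) (i : ℕ) :
    brickVec (psiEnd F κ n M) e J z i = moveRight (brick F κ n) (J + 1) i • z := by
  induction i with
  | zero => simp [brickVec]
  | succ i ih =>
    rw [brickVec, ih, brickOp_psiEnd, ← brick_succ, moveRight_succ, mul_smul,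
      show J + 1 + i = J + i + 1 by omega]

end

section Hom

variable (F : Type*) [Field F] (e : ℕ) [NeZero e] (k j n : ℕ)

/-- The element of the KLR algebra that maps the generator of `S^{((ke),(je))}` to the image of
the generator of `S^{((ke+e),(je-e))}`. -/
noncomputable def brickSum : KLRAlgebra F (0 : Fin 2 → ZMod e) n :=
  ∑ i ∈ Finset.range (k + 1), ((k : F) + 1 - (i : F)) • moveRight (brick F 0 n) j i

variable {e k j n} (h : k * e + j * e = n)

theorem brickSum_smul (hj : 1 ≤ j) :
    brickSum F e k j n • spechtGen F 0 n k j h =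
      ∑ i ∈ Finset.range (k + 1), ((k : F) + 1 - (i : F)) •
        brickVec (psiEnd F (0 : Fin 2 → ZMod e) n _) e (j - 1) (spechtGen F 0 n k j h) i := by
  rw [brickSum, Finset.sum_smul]
  refine Finset.sum_congr rfl fun i _ => ?_
  rw [smul_assoc, brickVec_psiEnd, Nat.sub_add_cancel hj]

theorem spechtIdeal_smul_eq_zero (he : 2 ≤ e) (hj : 1 ≤ j) {a : KLRAlgebra F (0 : Fin 2 → ZMod e) n}
    (ha : a ∈ spechtIdeal F (0 : Fin 2 → ZMod e) n (k + 1) (j - 1) (specht_size_shift hj h)) :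
    a • brickSum F e k j n • spechtGen F 0 n k j h = 0 := by
  have H := klrAction F (0 : Fin 2 → ZMod e) n (M := SpechtModule F 0 n k j h)
  have hvan := specht_eq_zero F n k j h
  have hz := isBrickVector_spechtGen F n k j h
  have hn : (j - 1 + 1 + k) * e = n := by rw [Nat.sub_add_cancel hj, ← h]; ring
  have hb := isBrickVector_brickVec H hvan he hz hn
  have hfar : ∀ d, (d + 1) * e < n → d ≠ j - 1 →
      psiEnd F (0 : Fin 2 → ZMod e) n _ ((d + 1) * e) (spechtGen F 0 n k j h) = 0 := by
    intro d hd hdj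
    refine psi_smul_spechtGen F n k j h _ (Nat.mul_pos (by omega) (by omega)) hd fun hc => ?_
    have := Nat.eq_of_mul_eq_mul_right (by omega) hc
    omega
  set w := brickSum F e k j n • spechtGen F 0 n k j h with hw
  have hsum := brickSum_smul F h hj
  have hterm : ∀ f : Module.End F (SpechtModule F (0 : Fin 2 → ZMod e) n k j h),
      (∀ i ≤ k, f (brickVec (psiEnd F (0 : Fin 2 → ZMod e) n _) e (j - 1)
        (spechtGen F 0 n k j h) i) = 0) → f w = 0 := by
    intro f hf
    have : w ∈ LinearMap.ker f := by
      rw [hw, hsum]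
      exact Submodule.sum_mem _ fun i hi =>
        Submodule.smul_mem _ _ (hf i (Nat.lt_succ_iff.1 (Finset.mem_range.1 hi)))
    exact this
  suffices hle : spechtIdeal F (0 : Fin 2 → ZMod e) n (k + 1) (j - 1) (specht_size_shift hj h) ≤
      LinearMap.ker (LinearMap.toSpanSingleton (KLRAlgebra F (0 : Fin 2 → ZMod e) n) _ w) from
    hle ha
  refine Submodule.span_le.2 ?_
  rintro x ((rfl | ⟨r, h1, h2, rfl⟩) | ⟨r, h1, h2, h3, rfl⟩)
  · rw [resSeq_colInitial]
    refine hterm (Algebra.lsmul F F _ (idem F _ n (toFin n (stdSeq e)) - 1)) fun i hi => ?_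
    refine (sub_smul (idem F (0 : Fin 2 → ZMod e) n (toFin n (stdSeq e))) 1 _).trans ?_
    rw [one_smul, sub_eq_zero]
    exact (hb i hi).weight
  · exact hterm (yEnd F _ n _ r) fun i hi => (hb i hi).Y_eq r h1 h2
  · by_cases hr : (r : ZMod e) = 0
    · obtain ⟨c, rfl⟩ := (ZMod.natCast_eq_zero_iff _ _).1 hr
      obtain ⟨d, rfl⟩ := Nat.exists_eq_succ_of_ne_zero (by rintro rfl; omega : c ≠ 0)
      rw [Nat.succ_eq_add_one, mul_comm e] at h1 h2 h3 ⊢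
      -- If r < j-1, then ψ_{re} commutes with all the transpositions and kills the generator; r =
      -- j-1 is not among the relations; for r ≥ j the terms cancel in the sum.
      by_cases hd : d + 1 < j - 1
      · exact hterm (psiEnd F _ n _ _) fun i hi => P_brickVec_of_far H hfar h2 i (Or.inl hd)
      · have hd2 : d + 1 ≠ j - 1 := by rintro hc; exact h3 (by rw [hc])
        obtain ⟨m, rfl⟩ := Nat.exists_eq_add_of_le (show j - 1 ≤ d by omega)
        have := lt_of_mul_lt_mul_right (hn ▸ h2) (Nat.zero_le e)
        have := P_sum_brickVec H hvan he hz hfar hn (m := m) (by omega)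
        rwa [← hsum] at this
    · exact hterm (psiEnd F _ n _ r) fun i hi => (hb i hi).P_eq r h1 h2 hr

/-- The homomorphism from `S^{((ke+e),(je-e))}` to `S^{((ke),(je))}`. -/
noncomputable def spechtHom (he : 2 ≤ e) (hj : 1 ≤ j) :
    SpechtModule F (0 : Fin 2 → ZMod e) n (k + 1) (j - 1) (specht_size_shift hj h)
      →ₗ[KLRAlgebra F (0 : Fin 2 → ZMod e) n] SpechtModule F (0 : Fin 2 → ZMod e) n k j h :=
  Submodule.liftQ _
    (LinearMap.toSpanSingleton _ _ (brickSum F e k j n • spechtGen F 0 n k j h))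
    fun _ ha => spechtIdeal_smul_eq_zero F h he hj ha

theorem spechtHom_mkQ (he : 2 ≤ e) (hj : 1 ≤ j) (a : KLRAlgebra F (0 : Fin 2 → ZMod e) n) :
    spechtHom F h he hj (Submodule.mkQ _ a) = a • brickSum F e k j n • spechtGen F 0 n k j h :=
  rfl

end Hom

end KLR

/-! ## Degrees -/

namespace KLR

theorem seqBlock_stdSeq {e : ℕ} (p : ℕ) : seqBlock p e e (stdSeq e) = stdSeq e := by
  funext t
  simp only [seqBlock, stdSeq]
  split_ifs
  · rfl
  · simp
  · rw [Nat.cast_sub (by omega)]; simp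
  · rfl

section Degree

variable (F : Type*) [Field F] {e : ℕ} [NeZero e] (κ : Fin 2 → ZMod e) (n : ℕ)

theorem mul_mem_degreePart {x x' : KLRAlgebra F κ n} {d d' : ℤ} (hx : x ∈ degreePart F κ n d)
    (hx' : x' ∈ degreePart F κ n d') : x * x' ∈ degreePart F κ n (d + d') := by
  have := Submodule.mul_mem_mul hx hx'
  rw [degreePart, degreePart, Submodule.span_mul_span] at this
  refine Submodule.span_mono ?_ this
  rintro _ ⟨a, ha, b, hb, rfl⟩
  exact HasDegree.mul a b d d' ha hb

/-- `x` maps vectors of weight `i` to vectors of weight `i'` and is homogeneous of degree `d` on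
them. -/
structure IsHomogeneousBetween (i i' : ℕ → ZMod e) (d : ℤ) (x : KLRAlgebra F κ n) : Prop where
  mem : x * idem F κ n (toFin n i) ∈ degreePart F κ n d
  comm : x * idem F κ n (toFin n i) = idem F κ n (toFin n i') * x

variable {F κ n}

namespace IsHomogeneousBetween

theorem one (i : ℕ → ZMod e) : IsHomogeneousBetween F κ n i i 0 1 where
  mem := by rw [one_mul]; exact Submodule.subset_span (HasDegree.idem _)
  comm := by rw [one_mul, mul_one]

theorem mul {i i' i'' : ℕ → ZMod e} {d d' : ℤ} {x x' : KLRAlgebra F κ n}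
    (hx' : IsHomogeneousBetween F κ n i' i'' d' x') (hx : IsHomogeneousBetween F κ n i i' d x) :
    IsHomogeneousBetween F κ n i i'' (d' + d) (x' * x) where
  mem := by
    have : x' * x * idem F κ n (toFin n i) =
        x' * idem F κ n (toFin n i') * (x * idem F κ n (toFin n i)) := by
      rw [mul_assoc x', mul_assoc x', ← mul_assoc (idem F κ n (toFin n i')), ← hx.comm,
        mul_assoc x, idem_mul_self]
    rw [this]
    exact mul_mem_degreePart F κ n hx'.mem hx.mem
  comm := by rw [mul_assoc, hx.comm, ← mul_assoc, hx'.comm, mul_assoc]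

theorem psi {r : ℕ} (h1 : 1 ≤ r) (hn : r < n) (i : ℕ → ZMod e) :
    IsHomogeneousBetween F κ n i (sw r i) (-cartan (i r) (i (r + 1))) (psi F κ n r) where
  mem := by
    have := HasDegree.psi (F := F) (κ := κ) r h1 hn (toFin n i)
    simp only [toFin, Nat.sub_add_cancel h1] at this
    exact Submodule.subset_span this
  comm := by
    obtain ⟨r, rfl⟩ := Nat.exists_eq_succ_of_ne_zero (by omega : r ≠ 0)
    have := RingQuot.mkAlgHom_rel F (Rel.psi_idem (F := F) (κ := κ) r hn (toFin n i))
    rwa [map_mul, map_mul, swapSeq_toFin, ← psi_eq] at this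

theorem moveRight {p l : ℕ} (hp : 1 ≤ p) (hn : p + l ≤ n) (i : ℕ → ZMod e) :
    IsHomogeneousBetween F κ n i (seqRight p l i)
      (-∑ t ∈ Finset.range l, cartan (i p) (i (p + 1 + t))) (moveRight (KLR.psi F κ n) p l) := by
  induction l with
  | zero => simpa [seqRight_zero] using one i
  | succ l ih =>
    have := (psi (r := p + l) (by omega) (by omega) (seqRight p l i)).mul (ih (by omega))
    rw [sw_seqRight] at this
    rw [moveRight_succ, Finset.sum_range_succ]
    convert this using 1
    rw [neg_add, add_comm]
    congr 3
    · simp [seqRight]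
    · simp only [seqRight]
      simp (disch := omega) only [if_neg]
      congr 1; omega

theorem moveBlock {p m l : ℕ} (hp : 1 ≤ p) (hn : p + m + l ≤ n + 1) (i : ℕ → ZMod e)
    (hi : ∀ a, ∑ t ∈ Finset.range l, cartan a (i (p + m + t)) = 0) :
    IsHomogeneousBetween F κ n i (seqBlock p m l i) 0 (moveBlock (KLR.psi F κ n) p m l) := by
  induction m generalizing p with
  | zero => simpa [seqBlock_zero] using one i
  | succ m ih =>
    have h1 := ih (p := p + 1) (by omega) (by omega) fun a => by
      rw [show p + 1 + m = p + (m + 1) by omega]; exact hi a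
    have h2 := (moveRight (l := l) hp (by omega) (seqBlock (p + 1) m l i)).mul h1
    rw [seqRight_seqBlock] at h2
    rw [moveBlock_succ']
    convert h2 using 1
    rw [Finset.sum_congr rfl fun t ht => ?_, hi (seqBlock (p + 1) m l i p)]
    · rfl
    · have := Finset.mem_range.1 ht
      congr 1
      simp (disch := omega) only [seqBlock, if_neg, if_pos]
      congr 1; omega

end IsHomogeneousBetween

theorem sum_range_natCast_add {A : Type*} [AddCommMonoid A] (g : ZMod e → A) (c : ZMod e) :
    ∑ t ∈ Finset.range e, g (c + t) = ∑ a, g a := by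
  refine Finset.sum_nbij' (fun t => c + (t : ZMod e)) (fun a => (a - c).val) (by simp)
    (fun a _ => Finset.mem_range.2 (ZMod.val_lt _)) ?_ (by simp) (by simp)
  intro t ht
  simp [ZMod.val_cast_of_lt (Finset.mem_range.1 ht)]

theorem sum_cartan (a : ZMod e) : ∑ b, cartan a b = 0 := by
  have h1 : ∀ b, (if a = b + 1 then (1 : ℤ) else 0) = if b = a - 1 then 1 else 0 := fun b => by
    simp only [eq_sub_iff_add_eq, eq_comm]
  have h2 : ∀ b, (if a = b - 1 then (1 : ℤ) else 0) = if b = a + 1 then 1 else 0 := fun b => by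
    simp only [eq_sub_iff_add_eq, eq_comm]
  simp only [cartan, h1, h2, Finset.sum_sub_distrib, ← Finset.mul_sum, Finset.sum_ite_eq,
    Finset.sum_ite_eq', Finset.mem_univ, if_true]
  norm_num

/-- Each strand of one brick passes every residue exactly once, which contributes a full row sum of
the Cartan matrix, that is 0. -/
theorem isHomogeneousBetween_brick {d : ℕ} (hn : (d + 2) * e ≤ n) :
    IsHomogeneousBetween F κ n (stdSeq e) (stdSeq e) 0 (brick F κ n (d + 1)) := by
  rw [add_mul] at hn
  have := IsHomogeneousBetween.moveBlock (F := F) (κ := κ) (n := n) (p := d * e + 1) (m := e)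
    (l := e) (by omega) (by omega) (stdSeq e) fun a => by
      rw [← sum_cartan a, ← sum_range_natCast_add (fun b => cartan a b) 0]
      exact Finset.sum_congr rfl fun t _ => by simp [stdSeq]
  rwa [seqBlock_stdSeq, ← brickOp, ← brick_succ] at this

theorem isHomogeneousBetween_moveRight_brick {j i : ℕ} (hj : 1 ≤ j) (hn : (j + i) * e ≤ n) :
    IsHomogeneousBetween F κ n (stdSeq e) (stdSeq e) 0 (moveRight (brick F κ n) j i) := by
  induction i with
  | zero => exact IsHomogeneousBetween.one _
  | succ i ih =>
    obtain ⟨d, rfl⟩ := Nat.exists_eq_add_of_le' hj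
    have := (isHomogeneousBetween_brick (F := F) (κ := κ) (d := d + i)
      (by rwa [show d + i + 2 = d + 1 + (i + 1) by omega])).mul
      (ih ((Nat.mul_le_mul_right e (by omega)).trans hn))
    rwa [add_zero, show d + i + 1 = d + 1 + i by omega] at this

end Degree

theorem brickSum_mul_idem_mem (F : Type*) [Field F] {e : ℕ} [NeZero e] {k j n : ℕ} (hj : 1 ≤ j)
    (h : k * e + j * e = n) :
    brickSum F e k j n * idem F 0 n (toFin n (stdSeq e)) ∈ degreePart F (0 : Fin 2 → ZMod e) n 0 := by
  rw [brickSum, Finset.sum_mul]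
  refine Submodule.sum_mem _ fun i hi => ?_
  rw [smul_mul_assoc]
  refine Submodule.smul_mem _ _ (isHomogeneousBetween_moveRight_brick hj ?_).mem
  rw [← h, ← add_mul]
  have := Finset.mem_range.1 hi
  exact Nat.mul_le_mul_right e (by omega)

end KLR

/-! ## Codegrees -/

section Codegree

variable {e : ℕ}

theorem Bipartition.mem_nodes_twoRow {a b : ℕ} {A : BiNode} :
    A ∈ (Bipartition.twoRow a b).nodes ↔
      A.row = 0 ∧ ((A.comp = 0 ∧ A.col < a) ∨ (A.comp = 1 ∧ A.col < b)) := by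
  obtain ⟨i, c, m⟩ := A
  fin_cases m <;>
    simp [Bipartition.nodes, Bipartition.twoRow, Bipartition.oneRow, ← YoungDiagram.mem_cells,
      and_comm, eq_comm]

theorem BiNode.above_iff_of_row_eq_zero {A B : BiNode} (hA : A.row = 0) :
    B.Above A ↔ B.comp = 0 ∧ A.comp = 1 := by
  simp only [BiNode.Above, hA, Nat.not_lt_zero, and_false, or_false]
  generalize A.comp = a
  generalize B.comp = b
  revert a b
  decide

/-- A node of the first component is addable to a diagram with empty first component if and only
if it is the corner. -/
theorem BiNode.addable_twoRow_zero {b : ℕ} {B : BiNode} (hB : B.comp = 0) :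
    BiNode.Addable (Bipartition.twoRow 0 b).nodes B ↔ B = ⟨0, 0, 0⟩ := by
  constructor
  · rintro ⟨_, lam, hlam⟩
    obtain ⟨i, c, m⟩ := B
    obtain rfl : m = 0 := hB
    have hmem : (⟨i, c, 0⟩ : BiNode) ∈ lam.nodes := hlam ▸ Set.mem_insert _ _
    have h0 : (⟨0, 0, 0⟩ : BiNode) ∈ lam.nodes :=
      (lam 0).up_left_mem (Nat.zero_le i) (Nat.zero_le c) hmem
    rw [hlam] at h0
    rcases h0 with h0 | h0
    · exact h0.symm
    · simp [Bipartition.mem_nodes_twoRow] at h0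
  · rintro rfl
    refine ⟨by simp [Bipartition.mem_nodes_twoRow], Bipartition.twoRow 1 b, ?_⟩
    ext ⟨i, c, m⟩
    rw [Set.mem_insert_iff, Bipartition.mem_nodes_twoRow, Bipartition.mem_nodes_twoRow]
    fin_cases m <;> simp

namespace BiTableau

theorem image_colInitial {n a b : ℕ} (h : a + b = n) {r : Fin n} (hr : r.1 < b) :
    (colInitial n a b h).node '' Set.Iic r = (Bipartition.twoRow 0 (r + 1)).nodes := by
  ext ⟨i, c, m⟩
  rw [Bipartition.mem_nodes_twoRow]
  constructor
  · rintro ⟨s, hs, hsm⟩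
    have hs : s.1 ≤ r.1 := hs
    simp only [colInitial, if_pos (hs.trans_lt hr), BiNode.mk.injEq] at hsm
    obtain ⟨rfl, rfl, rfl⟩ := hsm
    simp; omega
  · rintro ⟨rfl, h2⟩
    have h2 : m = 1 ∧ c < r + 1 := by simpa using h2
    obtain ⟨rfl, hc⟩ := h2
    refine ⟨⟨c, by omega⟩, show c ≤ r.1 by omega, ?_⟩
    simp only [colInitial]
    rw [if_pos (by omega)]

/-- Only the first component can lie above, and only for entries of the second component. At that
time the first component is still empty: nothing in it is removable, and its corner, of residue 0,
is the only addable node. -/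
theorem dAbove_colInitial {n a b : ℕ} (h : a + b = n) (r : Fin n) :
    BiNode.dAbove (0 : Fin 2 → ZMod e) ((colInitial n a b h).node '' Set.Iic r)
      ((colInitial n a b h).node r) = if r.1 < b ∧ (r.1 : ZMod e) = 0 then 1 else 0 := by
  have hrow : ((colInitial n a b h).node r).row = 0 := by
    simp only [colInitial]; split_ifs <;> rfl
  simp only [BiNode.dAbove, BiNode.above_iff_of_row_eq_zero hrow]
  by_cases hr : r.1 < b
  · have hnode : (colInitial n a b h).node r = ⟨0, r.1, 1⟩ := by simp [colInitial, hr]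
    rw [image_colInitial h hr, hnode]
    have h1 : {B : BiNode | BiNode.Addable (Bipartition.twoRow 0 (r + 1)).nodes B ∧
        B.res (0 : Fin 2 → ZMod e) = BiNode.res 0 ⟨0, r.1, 1⟩ ∧ B.comp = 0 ∧ (1 : Fin 2) = 1} =
        if (r.1 : ZMod e) = 0 then {⟨0, 0, 0⟩} else ∅ := by
      ext B
      have : (BiNode.Addable (Bipartition.twoRow 0 (r + 1)).nodes B ∧
        B.res (0 : Fin 2 → ZMod e) = BiNode.res 0 ⟨0, r.1, 1⟩ ∧ B.comp = 0 ∧ (1 : Fin 2) = 1) ↔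
          (B = ⟨0, 0, 0⟩ ∧ (r.1 : ZMod e) = 0) := by
        constructor
        · rintro ⟨h1, h2, h3, _⟩
          obtain rfl := (BiNode.addable_twoRow_zero h3).1 h1
          exact ⟨rfl, by simpa [BiNode.res] using h2.symm⟩
        · rintro ⟨rfl, h2⟩
          exact ⟨(BiNode.addable_twoRow_zero rfl).2 rfl, by simp [BiNode.res, h2], rfl, rfl⟩
      rw [Set.mem_ofPred_eq, this]
      split_ifs with h0 <;> simp [h0]
    have h2 : {B : BiNode | BiNode.Removable (Bipartition.twoRow 0 (r + 1)).nodes B ∧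
        B.res (0 : Fin 2 → ZMod e) = BiNode.res 0 ⟨0, r.1, 1⟩ ∧ B.comp = 0 ∧ (1 : Fin 2) = 1} =
        ∅ := by
      refine Set.eq_empty_iff_forall_notMem.2 fun B ⟨h1, _, h3, _⟩ => ?_
      have := Bipartition.mem_nodes_twoRow.1 h1.1
      simp [h3] at this
    rw [h1, h2]
    by_cases h0 : (r.1 : ZMod e) = 0 <;> simp [h0, hr]
  · have hnode : ((colInitial n a b h).node r).comp = 0 := by simp [colInitial, hr]
    simp [hnode, hr]

theorem sum_range_mul_ite [NeZero e] (j : ℕ) :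
    ∑ r ∈ Finset.range (j * e), (if (r : ZMod e) = 0 then (1 : ℤ) else 0) = j := by
  induction j with
  | zero => simp
  | succ j ih =>
    rw [add_mul, one_mul, Finset.sum_range_add, ih, Finset.sum_eq_single 0]
    · simp
    · intro b hb h0
      refine if_neg fun hc => h0 ?_
      rw [Nat.cast_add, Nat.cast_mul, ZMod.natCast_self, mul_zero, zero_add,
        ZMod.natCast_eq_zero_iff] at hc
      exact Nat.eq_zero_of_dvd_of_lt hc (Finset.mem_range.1 hb)
    · intro hc
      exact absurd (Finset.mem_range.2 (NeZero.pos e)) hc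

theorem codeg_colInitial [NeZero e] {n k j : ℕ} (h : k * e + j * e = n) :
    (colInitial n (k * e) (j * e) h).codeg (0 : Fin 2 → ZMod e) = j := by
  rw [codeg, Finset.sum_congr rfl fun r _ => dAbove_colInitial h r,
    Fin.sum_univ_eq_sum_range
      (fun r => if r < j * e ∧ (r : ZMod e) = 0 then (1 : ℤ) else 0) n,
    ← h, add_comm, Finset.sum_range_add, ← sum_range_mul_ite (e := e) j]
  rw [Finset.sum_eq_zero (s := Finset.range (k * e)) fun r _ => if_neg (by omega), add_zero]
  exact Finset.sum_congr rfl fun r hr => by simp [Finset.mem_range.1 hr]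

end BiTableau

end Codegree

theorem mainTheorem11 (F : Type*) [Field F] (e : ℕ) [NeZero e] (he : 2 ≤ e)
    (k j n : ℕ) (hj : 1 ≤ j) (hjk : j ≤ k) (h : k * e + j * e = n) :
    ∃ α : SpechtModule F (0 : Fin 2 → ZMod e) n (k + 1) (j - 1) (specht_size_shift hj h)
        →ₗ[KLRAlgebra F (0 : Fin 2 → ZMod e) n] SpechtModule F (0 : Fin 2 → ZMod e) n k j h,
      (∀ d : ℤ, ∀ v ∈ spechtDegreePart F (0 : Fin 2 → ZMod e) n (k + 1) (j - 1)
          (specht_size_shift hj h) d,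
        α v ∈ spechtDegreePart F (0 : Fin 2 → ZMod e) n k j h (d + 1)) ∧
      α (spechtGen F (0 : Fin 2 → ZMod e) n (k + 1) (j - 1) (specht_size_shift hj h)) =
        ∑ i ∈ Finset.range (k + 1), ((k : F) + 1 - (i : F)) •
          (KLR.descProd (KLR.brick F (0 : Fin 2 → ZMod e) n) (j + i - 1) j •
            spechtGen F (0 : Fin 2 → ZMod e) n k j h) := by
  refine ⟨KLR.spechtHom F h he hj, ?_, ?_⟩
  · rintro d _ ⟨a, ha, rfl⟩
    rw [BiTableau.codeg_colInitial] at ha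
    have hm := KLR.mul_mem_degreePart F _ n ha (KLR.brickSum_mul_idem_mem F hj h)
    -- ψ_r has a degree only next to an idempotent. Inserting the idempotent of the weight of z
    -- makes the factor homogeneous and does not change its action on z.
    refine ⟨a * (KLR.brickSum F e k j n * KLR.idem F _ n (KLR.toFin n (KLR.stdSeq e))), ?_, ?_⟩
    · rw [BiTableau.codeg_colInitial]
      rwa [add_zero, Nat.cast_sub hj, Nat.cast_one, ← sub_add, sub_add_eq_add_sub] at hm
    · refine Eq.trans ?_ (KLR.spechtHom_mkQ F h he hj a).symm
      change (spechtIdeal F (0 : Fin 2 → ZMod e) n k j h).mkQ _ = _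
      rw [← KLR.smul_spechtGen, mul_smul, mul_smul]
      exact congrArg _ (congrArg _ (KLR.hasWeight_spechtGen F n k j h))
  · rw [spechtGen, KLR.spechtHom_mkQ, one_smul, KLR.brickSum, Finset.sum_smul]
    refine Finset.sum_congr rfl fun i _ => ?_
    rw [smul_assoc, KLR.descProd_eq_moveRight _ hj]
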